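/- Let $Q$ be a smooth manifold (finite-dimensional, without boundary) and let a Lie group $G$ act on $Q$ smoothly, freely and properly, $\Phi_g(q)=gq$; write $\mathfrak g$ for its Lie algebra, $\xi_Q$ for the infinitesimal generator of $\xi\in\mathfrak g$, and $\mathcal O_q$ for the orbit of $q$. Let $L(v_q)=\tfrac12 g_q(v_q,v_q)-V(q)$ be a smooth Lagrangian on $TQ$, where $g$ is a symmetric, possibly degenerate, bilinear form on $TQ$, and let $\Delta_Q\subset TQ$ be a regular distribution. Assume that $(L,\Delta_Q)$ is a weakly degenerate Chaplygin system: $L\circ T\Phi_g=L$, $T\Phi_g(\Delta_Q(q))=\Delta_Q(gq)$, $T_qQ=\Delta_Q(q)\oplus T_q\mathcal O_q$, and $g$ is positive-definite on $\Delta_Q$. **Notation.** Let $\pi:Q\to\bar Q=Q/G$ be the projection, $\bar Q$ carrying its quotient manifold structure (the one for which $\pi$ is a smooth submersion). Let $\mathcal A:TQ\to\mathfrak g$ be the principal connection with $\ker\mathcal A=\Delta_Q$, $\mathcal B=d\mathcal A(\mathrm{hor}\,\cdot,\mathrm{hor}\,\cdot)$ its curvature, ${\rm hl}^\Delta_q=(T_q\pi|_{\Delta_Q(q)})^{-1}$,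 and $\langle{\bf J}(\alpha_q),\xi\rangle=\langle\alpha_q,\xi_Q(q)\rangle$. Let $\mathbb FL$ be the Legendre transformation, $\bar L=L\circ{\rm hl}^\Delta$, ${\rm hl}^P_q=\mathbb FL_q\circ{\rm hl}^\Delta_q\circ(\mathbb F\bar L)^{-1}_{\pi(q)}$, and $\bar H(p)=\langle p,v\rangle-\bar L(v)$ with $v=(\mathbb F\bar L)^{-1}(p)$. Let $P=\mathbb FL(\Delta_Q)$, an embedded submanifold $\iota_P:P\hookrightarrow T^*Q$, and $H_P(p_q)=\langle p_q,v_q\rangle-L(v_q)$ with $v_q=(\mathbb FL|_{\Delta_Q})^{-1}(p_q)$. Let $\Omega$, $\bar\Omega$ be the canonical symplectic forms ($=dq^i\wedge dp_i$) of $T^*Q$, $T^*\bar Q$, $\Omega_P=\iota_P^*\Omega$, $\mathcal H=TP\cap(T\pi_Q)^{-1}(\Delta_Q)$ with $\pi_Q:T^*Q\to Q$, and $$D_P(z)=\{(v,\alpha)\in T_zP\oplus T_z^*P \mid v\in\mathcal H_z,\ \alpha-\Omega_P^\flat(v)\in\mathcal H_z^\circ\}.$$ $G$ acts on $P$ by $\Phi^P_g=T^*\Phi_{g^{-1}}|_P$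 and on $TP\oplus T^*P$ by $\Psi_g(v_z,\alpha_z)=(T\Phi^P_g(v_z),T^*\Phi^P_{g^{-1}}(\alpha_z))$. Put $\rho:P\to T^*\bar Q$, $\rho(z)=({\rm hl}^P_q)^{-1}(z)$ for $z\in P\cap T^*_qQ$. A Dirac structure on a manifold $M$ is a smooth subbundle $D\subset TM\oplus T^*M$ with $D^\perp=D$ for the pairing $\alpha'(X)+\alpha(X')$. **Theorem.** 1. $\rho$ is smooth and surjective, its fibres are exactly the $G$-orbits of $P$, and $T_z\rho|_{\mathcal H_z}:\mathcal H_z\to T_{\rho(z)}T^*\bar Q$ is an isomorphism for every $z\in P$; so $P/G$ is identified with $T^*\bar Q$. Put $f(v_z,\alpha_z)=\bigl(T_z\rho(v_z),\ \alpha_z\circ(T_z\rho|_{\mathcal H_z})^{-1}\bigr)$. 2. The formula $$\Xi_{\alpha_{\bar q}}(\mathcal Y,\mathcal Z)=\bigl\langle{\bf J}\circ{\rm hl}^P_q(\alpha_{\bar q}),\ \mathcal B_q\bigl({\rm hl}^\Delta_q(T\pi_{\bar Q}\mathcal Y),{\rm hl}^\Delta_q(T\pi_{\bar Q}\mathcal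 Z)\bigr)\bigr\rangle,\qquad \pi(q)=\bar q,$$ where $\pi_{\bar Q}:T^*\bar Q\to\bar Q$, does not depend on the choice of $q$; the two-form $\bar\Omega^{\rm nh}=\bar\Omega-\Xi$ on $T^*\bar Q$ is non-degenerate; and its graph $$\bar D(\bar z)=\{(v,\alpha)\in T_{\bar z}T^*\bar Q\oplus T^*_{\bar z}T^*\bar Q \mid \alpha=(\bar\Omega^{\rm nh})^\flat(v)\}$$ is a Dirac structure on $T^*\bar Q$. 3. $D_P$ is invariant under $\Psi$, $f\circ\Psi_g=f$, and $f(D_P(z))=\bar D(\rho(z))$ for all $z\in P$. Hence $f$ induces a map $\bar f:[D_P]_G=D_P/G\to TT^*\bar Q\oplus T^*T^*\bar Q$, through which $[D_P]_G$ is identified with $\bar D$ in the following sense: the image of $\bar f$ is $\bar D$, and $\bar f([x])=\bar f([y])$ if and only if, for some $g\in G$, $\Psi_g(x)$ and $y$ have the same base point $z$ and differ by an element of $\{0\}\oplus\mathcal H_z^\circ$. 4. $H_P$ and $\bar H$ are smooth and $H_P=\bar H\circ\rho$. If a vector field $X_P$ on $P$ satisfies $(X_P,dH_P)\in D_P$,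 then there is a vector field $\bar X$ on $T^*\bar Q$ (smooth if $X_P$ is) with $\bar X(\rho(z))=T_z\rho(X_P(z))$ and $f(X_P(z),dH_P(z))=(\bar X(\rho(z)),d\bar H(\rho(z)))$ for all $z\in P$; moreover $(\bar X,d\bar H)\in\bar D$, that is, $i_{\bar X}\bar\Omega^{\rm nh}=d\bar H$. -/

import Mathlib

open scoped Manifold ContDiff Topology
open Bundle Function Set

noncomputable section

namespace Nonholonomic

section Forms

variable {EM : Type*} [NormedAddCommGroup EM] [NormedSpace ℝ EM]
  {HM : Type*} [TopologicalSpace HM] (I : ModelWithCorners ℝ EM HM)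
  {M : Type*} [TopologicalSpace M] [ChartedSpace HM M]

/-- The cotangent space `T*ₓM`. -/
abbrev CotangentSpace (x : M) : Type _ := TangentSpace I x →L[ℝ] ℝ

/-- The differential `df(x) ∈ T*ₓM` of a real function. -/
def differential (f : M → ℝ) (x : M) : CotangentSpace I x := mfderiv I 𝓘(ℝ, ℝ) f x

/-- A one-form with values in `V`, written in the preferred chart `φ` at `x₀`: the pull-back
`(φ⁻¹)^* θ`, a one-form on (the target of `φ` in) the model space. -/
def oneFormInChart {V : Type*} [NormedAddCommGroup V] [NormedSpace ℝ V]
    (θ : ∀ x : M, TangentSpace I x →L[ℝ] V) (x₀ : M) : EM → (EM →L[ℝ] V) :=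
  fun y => (θ ((extChartAt I x₀).symm y)).comp
    (mfderiv 𝓘(ℝ, EM) I (extChartAt I x₀).symm y)

/-- The exterior derivative of a `V`-valued one-form on a manifold without boundary, computed at
`x` in the preferred chart at `x`: `dθ(u, w) = ∂_u θ(w) - ∂_w θ(u)`. -/
def dOneForm [I.Boundaryless] {V : Type*} [NormedAddCommGroup V] [NormedSpace ℝ V]
    (θ : ∀ x : M, TangentSpace I x →L[ℝ] V) (x : M) (u w : TangentSpace I x) : V :=
  let φ : M → EM := extChartAt I x
  let Tφ : TangentSpace I x →L[ℝ] EM := mfderiv I 𝓘(ℝ, EM) φ x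
  fderiv ℝ (oneFormInChart I θ x) (φ x) (Tφ u) (Tφ w)
    - fderiv ℝ (oneFormInChart I θ x) (φ x) (Tφ w) (Tφ u)

/-- The Whitney sum `TM ⊕ T*M`, as a set over `M`. -/
abbrev PontryaginBundle (M : Type*) [TopologicalSpace M] [ChartedSpace HM M] : Type _ :=
  Σ x : M, TangentSpace I x × CotangentSpace I x

/-- The orthogonal `D^⊥` of `D ⊂ TM ⊕ T*M` for the symmetric pairing
`⟨(X, α), (X', α')⟩ = α'(X) + α(X')`. -/
def diracOrthogonal (D : ∀ x : M, Set (TangentSpace I x × CotangentSpace I x)) (x : M) :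
    Set (TangentSpace I x × CotangentSpace I x) :=
  {a | ∀ b ∈ D x, b.2 a.1 + a.2 b.1 = 0}

end Forms

section Cotangent

variable (E : Type*) [NormedAddCommGroup E] [NormedSpace ℝ E]
  (M : Type*) [TopologicalSpace M] [ChartedSpace E M]

/-- The cotangent bundle `T*M`; its points are pairs `⟨q, p⟩` with `p ∈ T*_q M`. -/
abbrev CotangentBundle : Type _ :=
  TotalSpace (E →L[ℝ] ℝ) (fun x : M => TangentSpace 𝓘(ℝ, E) x →L[ℝ] ℝ)

/-- The model with corners of the manifold `T*M`. -/
abbrev cotangentModel : ModelWithCorners ℝ (E × (E →L[ℝ] ℝ)) (ModelProd E (E →L[ℝ] ℝ)) :=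
  𝓘(ℝ, E).prod 𝓘(ℝ, E →L[ℝ] ℝ)

variable {E M} [IsManifold 𝓘(ℝ, E) ∞ M]

/-- The tangent map `T_z π_M : T_z T*M → T_{π(z)} M` of the cotangent bundle projection. -/
def tangentProj (z : CotangentBundle E M) :
    TangentSpace (cotangentModel E) z →L[ℝ] TangentSpace 𝓘(ℝ, E) z.proj :=
  mfderiv (cotangentModel E) 𝓘(ℝ, E) (fun y : CotangentBundle E M => y.proj) z

/-- The canonical one-form `Θ` on `T*M`: `Θ_z(w) = ⟨z, Tπ_M(w)⟩`. -/
def canonicalOneForm (z : CotangentBundle E M) :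
    TangentSpace (cotangentModel E) z →L[ℝ] ℝ :=
  z.snd.comp (tangentProj z)

/-- The canonical symplectic form `Ω = -dΘ` on `T*M` (`= dqⁱ ∧ dpᵢ` in coordinates). -/
def canonicalTwoForm (z : CotangentBundle E M) (u w : TangentSpace (cotangentModel E) z) : ℝ :=
  - dOneForm (cotangentModel E) (canonicalOneForm (E := E) (M := M)) z u w

end Cotangent

section Dirac

variable {EM : Type*} [NormedAddCommGroup EM] [NormedSpace ℝ EM]
  {HM : Type*} [TopologicalSpace HM] (I : ModelWithCorners ℝ EM HM)
  {M : Type*} [TopologicalSpace M] [ChartedSpace HM M] [IsManifold I ∞ M]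

/-- The vector field `X` is smooth on `U`. -/
def SmoothVectorFieldOn (X : ∀ x : M, TangentSpace I x) (U : Set M) : Prop :=
  ContMDiffOn I I.tangent ∞ (fun x => (⟨x, X x⟩ : TangentBundle I M)) U

/-- The one-form `α` is smooth on `U`. -/
def SmoothOneFormOn (α : ∀ x : M, CotangentSpace I x) (U : Set M) : Prop :=
  ContMDiffOn I (I.prod 𝓘(ℝ, EM →L[ℝ] ℝ)) ∞
    (fun x => (⟨x, α x⟩ :
      TotalSpace (EM →L[ℝ] ℝ) (fun y : M => TangentSpace I y →L[ℝ] ℝ))) U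

/-- A regular distribution: constant rank, and every vector of it extends to a smooth local
vector field with values in it (that is, a smooth subbundle of `TM`). -/
def IsRegularDistribution (Δ : ∀ x : M, Submodule ℝ (TangentSpace I x)) : Prop :=
  (∃ k : ℕ, ∀ x, Module.finrank ℝ (Δ x) = k) ∧
  ∀ x₀, ∀ v ∈ Δ x₀, ∃ (U : Set M) (X : ∀ x : M, TangentSpace I x),
    IsOpen U ∧ x₀ ∈ U ∧ SmoothVectorFieldOn I X U ∧ X x₀ = v ∧ ∀ x ∈ U, X x ∈ Δ x

/-- A (generalized) Dirac structure on `M`: a smooth subbundle `D ⊂ TM ⊕ T*M` with `D^⊥ = D`.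
The condition `D^⊥ = D` makes every fibre a subspace of dimension `dim M`; smoothness says that
every element extends to a smooth local section. -/
def IsDiracStructure (D : ∀ x : M, Set (TangentSpace I x × CotangentSpace I x)) : Prop :=
  (∀ x, diracOrthogonal I D x = D x) ∧
  ∀ x₀, ∀ a ∈ D x₀, ∃ (U : Set M) (X : ∀ x : M, TangentSpace I x)
      (α : ∀ x : M, CotangentSpace I x),
    IsOpen U ∧ x₀ ∈ U ∧ SmoothVectorFieldOn I X U ∧ SmoothOneFormOn I α U ∧
      (X x₀, α x₀) = a ∧ ∀ x ∈ U, (X x, α x) ∈ D x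

end Dirac

section Action

variable {E : Type*} [NormedAddCommGroup E] [NormedSpace ℝ E]
  (EG : Type*) [NormedAddCommGroup EG] [NormedSpace ℝ EG]
  {Q : Type*} [TopologicalSpace Q] [ChartedSpace E Q]
  {G : Type*} [TopologicalSpace G] [ChartedSpace EG G] [Group G] [MulAction G Q]

/-- The tangent map `T_q Φ_g : T_q Q → T_{gq} Q` of `Φ_g : q ↦ g q`. -/
def tangentAction (g : G) (q : Q) :
    TangentSpace 𝓘(ℝ, E) q →L[ℝ] TangentSpace 𝓘(ℝ, E) (g • q) :=
  mfderiv 𝓘(ℝ, E) 𝓘(ℝ, E) (fun x : Q => g • x) q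

variable (G) in
/-- The infinitesimal generator `ξ ↦ ξ_Q(q)`, i.e. the derivative at the identity of the orbit
map `g ↦ g q`, where `𝔤 = T₁G`. -/
def infGen (q : Q) : GroupLieAlgebra 𝓘(ℝ, EG) G →L[ℝ] TangentSpace 𝓘(ℝ, E) q :=
  mfderiv 𝓘(ℝ, EG) 𝓘(ℝ, E) (fun g : G => g • q) 1

variable (G) in
/-- The tangent space `T_q 𝒪_q` of the orbit through `q`. -/
def orbitTangent (q : Q) : Submodule ℝ (TangentSpace 𝓘(ℝ, E) q) :=
  LinearMap.range (infGen EG G q).toLinearMap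

/-- The momentum map `J : T*Q → 𝔤*` of the action: `⟨J(α_q), ξ⟩ = ⟨α_q, ξ_Q(q)⟩`. -/
def momentumMap (z : CotangentBundle E Q) : GroupLieAlgebra 𝓘(ℝ, EG) G →L[ℝ] ℝ :=
  z.snd.comp (infGen EG G z.proj)

end Action

/-- The orbit space `Q̄ = Q/G`, with the quotient topology. -/
abbrev OrbitSpace (G Q : Type*) [Group G] [MulAction G Q] : Type _ :=
  MulAction.orbitRel.Quotient G Q

/-- The projection `π : Q → Q/G`. -/
def orbitProj (G : Type*) {Q : Type*} [Group G] [MulAction G Q] (q : Q) : OrbitSpace G Q :=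
  Quotient.mk (MulAction.orbitRel G Q) q

/-- A Chaplygin system with (possibly degenerate) metric `g`, potential `V` and constraint
distribution `Δ_Q`, in which the restriction of `g` to `Δ_Q` is positive-definite. The
Lagrangian is `L(v_q) = ½ g_q(v_q, v_q) - V(q)`. -/
structure WeaklyDegenerateChaplyginSystem
    (E : Type*) [NormedAddCommGroup E] [NormedSpace ℝ E]
    (EG : Type*) [NormedAddCommGroup EG] [NormedSpace ℝ EG]
    (Q : Type*) [TopologicalSpace Q] [ChartedSpace E Q] [IsManifold 𝓘(ℝ, E) ∞ Q]
    (G : Type*) [TopologicalSpace G] [ChartedSpace EG G] [Group G] [MulAction G Q] where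
  /-- The constraint distribution `Δ_Q`. -/
  Δ : ∀ q : Q, Submodule ℝ (TangentSpace 𝓘(ℝ, E) q)
  /-- The possibly degenerate metric. -/
  metric : ∀ q : Q, TangentSpace 𝓘(ℝ, E) q →L[ℝ] TangentSpace 𝓘(ℝ, E) q →L[ℝ] ℝ
  /-- The potential. -/
  V : Q → ℝ
  regular : IsRegularDistribution 𝓘(ℝ, E) Δ
  metric_symm : ∀ q v w, metric q v w = metric q w v
  metric_smooth : ContMDiff 𝓘(ℝ, E) (𝓘(ℝ, E).prod 𝓘(ℝ, E →L[ℝ] E →L[ℝ] ℝ)) ∞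
    (fun q => TotalSpace.mk' (E →L[ℝ] E →L[ℝ] ℝ)
      (E := fun q : Q => TangentSpace 𝓘(ℝ, E) q →L[ℝ] TangentSpace 𝓘(ℝ, E) q →L[ℝ] ℝ)
      q (metric q))
  V_smooth : ContMDiff 𝓘(ℝ, E) 𝓘(ℝ, ℝ) ∞ V
  /-- `L ∘ TΦ_g = L`. -/
  lagrangian_invariant : ∀ (g : G) (q : Q) (v : TangentSpace 𝓘(ℝ, E) q),
    (1 / 2) * metric (g • q) (tangentAction g q v) (tangentAction g q v) - V (g • q)
      = (1 / 2) * metric q v v - V q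
  /-- `TΦ_g(Δ_Q(q)) = Δ_Q(g q)`. -/
  Δ_invariant : ∀ (g : G) (q : Q), (Δ q).map (tangentAction g q).toLinearMap = Δ (g • q)
  /-- `T_q Q = Δ_Q(q) ⊕ T_q 𝒪_q`. -/
  isCompl : ∀ q : Q, IsCompl (Δ q) (orbitTangent EG G q)
  pos_on_Δ : ∀ q : Q, ∀ v ∈ Δ q, v ≠ 0 → 0 < metric q v v

namespace WeaklyDegenerateChaplyginSystem

variable {E : Type*} [NormedAddCommGroup E] [NormedSpace ℝ E] [FiniteDimensional ℝ E]
  {EG : Type*} [NormedAddCommGroup EG] [NormedSpace ℝ EG] [FiniteDimensional ℝ EG]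
  {Q : Type*} [TopologicalSpace Q] [ChartedSpace E Q] [IsManifold 𝓘(ℝ, E) ∞ Q]
  {G : Type*} [TopologicalSpace G] [ChartedSpace EG G] [Group G] [MulAction G Q]
  (S : WeaklyDegenerateChaplyginSystem E EG Q G)

/-- The Lagrangian `L(v_q) = ½ g_q(v_q, v_q) - V(q)`. -/
def L (q : Q) (v : TangentSpace 𝓘(ℝ, E) q) : ℝ := (1 / 2) * S.metric q v v - S.V q

/-- The Legendre transformation `⟨𝔽L(v_q), w_q⟩ = d/dε|₀ L(v_q + ε w_q)`, as the derivative of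
`L` along the fibre `T_q Q`. -/
def FL (q : Q) (v : TangentSpace 𝓘(ℝ, E) q) : CotangentSpace 𝓘(ℝ, E) q :=
  fderiv ℝ (fun w : E => S.L q w) v

/-- The projection `hor : T_q Q → Δ_Q(q)` along `T_q 𝒪_q`. -/
def hor (q : Q) : TangentSpace 𝓘(ℝ, E) q →ₗ[ℝ] TangentSpace 𝓘(ℝ, E) q :=
  (S.Δ q).projection (orbitTangent EG G q) (S.isCompl q)

/-- The projection `ver : T_q Q → T_q 𝒪_q` along `Δ_Q(q)`. -/
def ver (q : Q) : TangentSpace 𝓘(ℝ, E) q →ₗ[ℝ] TangentSpace 𝓘(ℝ, E) q :=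
  (orbitTangent EG G q).projection (S.Δ q) (S.isCompl q).symm

/-- The connection form `𝒜 : TQ → 𝔤` with kernel `Δ_Q`: `𝒜_q(v)` is the `ξ ∈ 𝔤` with
`ξ_Q(q) = ver(v)`. It is unique because `ξ ↦ ξ_Q(q)` is injective for a free action. -/
def connection (q : Q) : TangentSpace 𝓘(ℝ, E) q →L[ℝ] EG :=
  let A : E →ₗ[ℝ] EG := (infGen EG G q).toLinearMap.leftInverse ∘ₗ S.ver q
  let A' : E →L[ℝ] EG := LinearMap.toContinuousLinearMap A
  A'

/-- The curvature two-form of the connection: `ℬ_q(u, w) = d𝒜(hor u, hor w) ∈ 𝔤`. -/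
def curvature (q : Q) (u w : TangentSpace 𝓘(ℝ, E) q) : GroupLieAlgebra 𝓘(ℝ, EG) G :=
  let b : EG := dOneForm (V := EG) 𝓘(ℝ, E) S.connection q (S.hor q u) (S.hor q w)
  b

/-- The submanifold `P = 𝔽L(Δ_Q) ⊂ T*Q`. -/
def P : Set (CotangentBundle E Q) :=
  {z | ∃ v ∈ S.Δ z.proj, S.FL z.proj v = z.snd}

/-- The constrained Hamiltonian `H_P(p_q) = ⟨p_q, v_q⟩ - L(v_q)`, `v_q = (𝔽L|_Δ)⁻¹(p_q)`. -/
def HP (z : S.P) : ℝ :=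
  let v := invFunOn (S.FL z.1.proj) (S.Δ z.1.proj) z.1.snd
  z.1.snd v - S.L z.1.proj v

/-! ### The action of `G` on `P` -/

section ActionP

variable [ContMDiffSMul 𝓘(ℝ, EG) 𝓘(ℝ, E) ∞ G Q]

/-- The cotangent lift `T*Φ_{g⁻¹} : T*Q → T*Q`,
`⟨T*Φ_{g⁻¹}(α_q), v⟩ = ⟨α_q, TΦ_{g⁻¹}(v)⟩` for `v ∈ T_{gq} Q`. -/
def _root_.Nonholonomic.cotangentLift (g : G) (z : CotangentBundle E Q) : CotangentBundle E Q :=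
  ⟨g • z.proj, z.snd.comp (tangentAction g⁻¹ (g • z.proj))⟩

set_option linter.unusedSectionVars false in
theorem mem_P_cotangentLift (g : G) {z : CotangentBundle E Q} (hz : z ∈ S.P) :
    cotangentLift g z ∈ S.P := by
  obtain ⟨v, hv, hFL⟩ := hz
  have hd : ∀ (h : G) (x : Q), HasMFDerivAt 𝓘(ℝ, E) 𝓘(ℝ, E) (fun y : Q => h • y) x
      (tangentAction h x) := fun h x =>
    ((contMDiff_smul (I := 𝓘(ℝ, EG)) (I' := 𝓘(ℝ, E)) (n := ∞) (G := G) (M := Q)).comp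
      (contMDiff_const.prodMk contMDiff_id) : ContMDiff 𝓘(ℝ, E) 𝓘(ℝ, E) ∞ fun y : Q => h • y)
      |>.mdifferentiable (by simp) x |>.hasMFDerivAt
  have key : ∀ (h k : G) (x : Q), k * h = 1 →
      ∀ u : E, (tangentAction k (h • x) : E →L[ℝ] E) ((tangentAction h x : E →L[ℝ] E) u) = u := by
    intro h k x hk u
    have h1 := (hd k (h • x)).comp x (hd h x)
    have h2 : ((fun y : Q => k • y) ∘ fun y : Q => h • y) = id := by
      funext y; simp [smul_smul, hk]
    rw [h2] at h1
    exact congrArg (fun T : E →L[ℝ] E => T u) (h1.mfderiv.symm.trans mfderiv_id)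
  set T : E →L[ℝ] E := tangentAction g z.proj with hT
  set T' : E →L[ℝ] E := tangentAction g⁻¹ (g • z.proj) with hT'
  have hT'T : ∀ u : E, T' (T u) = u := key g g⁻¹ z.proj (by simp)
  have hTT' : ∀ u : E, T (T' u) = u := by
    have hinj : Injective T := LeftInverse.injective hT'T
    have hsurj : Surjective T := LinearMap.injective_iff_surjective (f := T.toLinearMap).1 hinj
    intro u
    obtain ⟨w, rfl⟩ := hsurj u
    rw [hT'T]
  have hL : (fun u : E => S.L (g • z.proj) u) = (fun u : E => S.L z.proj u) ∘ T' := by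
    funext u
    have := S.lagrangian_invariant g z.proj (T' u)
    change (1 / 2) * S.metric (g • z.proj) (T (T' u)) (T (T' u)) - _ = _ at this
    rw [hTT'] at this
    exact this
  refine ⟨T v, ?_, ?_⟩
  · change T v ∈ S.Δ (g • z.proj)
    rw [← S.Δ_invariant g z.proj]
    exact ⟨v, hv, rfl⟩
  · have hdiff : ∀ u : E, DifferentiableAt ℝ (fun u : E => S.L z.proj u) u := by
      intro u
      let b : E →L[ℝ] E →L[ℝ] ℝ := S.metric z.proj
      change DifferentiableAt ℝ (fun u : E => (1 / 2) * b u u - S.V z.proj) u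
      fun_prop
    change fderiv ℝ (fun u : E => S.L (g • z.proj) u) (T v) = (z.snd : E →L[ℝ] ℝ).comp T'
    have h3 := fderiv_comp (T v) (hdiff (T' (T v))) T'.differentiableAt
    have h4 : fderiv ℝ (fun u : E => S.L z.proj u) (T' (T v)) = z.snd :=
      (congrArg (fun y : E => fderiv ℝ (fun u : E => S.L z.proj u) y) (hT'T v)).trans hFL
    exact (congrArg (fun F : E → ℝ => fderiv ℝ F (T v)) hL).trans (h3.trans
      (congrArg₂ (fun (A : E →L[ℝ] ℝ) (B : E →L[ℝ] E) => A.comp B) h4 T'.fderiv))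

/-- The action `Φ^P_g = T*Φ_{g⁻¹}|_P`. -/
def actP (g : G) (z : S.P) : S.P := ⟨cotangentLift g z.1, S.mem_P_cotangentLift g z.2⟩

end ActionP

/-! ### The reduced system on `T*Q̄` -/

section Reduced

variable {EB : Type*} [NormedAddCommGroup EB] [NormedSpace ℝ EB] [FiniteDimensional ℝ EB]
  [ChartedSpace EB (OrbitSpace G Q)] [IsManifold 𝓘(ℝ, EB) ∞ (OrbitSpace G Q)]

variable (E EB G) in
/-- The tangent map `T_q π : T_q Q → T_{π(q)} Q̄`. -/
def _root_.Nonholonomic.tangentOrbitProj (q : Q) :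
    TangentSpace 𝓘(ℝ, E) q →L[ℝ] TangentSpace 𝓘(ℝ, EB) (orbitProj G q) :=
  mfderiv 𝓘(ℝ, E) 𝓘(ℝ, EB) (orbitProj G : Q → OrbitSpace G Q) q

variable (EB) in
/-- The horizontal lift `hl^Δ_q = (T_qπ|_{Δ_Q(q)})⁻¹ : T_{π(q)} Q̄ → Δ_Q(q) ⊂ T_q Q`. -/
def hlΔ (q : Q) : TangentSpace 𝓘(ℝ, EB) (orbitProj G q) →ₗ[ℝ] TangentSpace 𝓘(ℝ, E) q :=
  (S.Δ q).subtype ∘ₗ ((tangentOrbitProj E G EB q).toLinearMap ∘ₗ (S.Δ q).subtype).leftInverse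

/-- The reduced Lagrangian `L̄ = L ∘ hl^Δ : TQ̄ → ℝ`, computed at a representative `q` of `x`. -/
def Lbar (x : OrbitSpace G Q) (v : TangentSpace 𝓘(ℝ, EB) x) : ℝ :=
  S.L x.out (S.hlΔ EB x.out v)

/-- The Legendre transformation of `L̄`. -/
def FLbar (x : OrbitSpace G Q) (v : TangentSpace 𝓘(ℝ, EB) x) : CotangentSpace 𝓘(ℝ, EB) x :=
  fderiv ℝ (fun w : EB => S.Lbar (EB := EB) x w) v

/-- The inverse `(𝔽L̄)⁻¹_x : T*_x Q̄ → T_x Q̄`. -/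
def FLbarInv (x : OrbitSpace G Q) : CotangentSpace 𝓘(ℝ, EB) x → TangentSpace 𝓘(ℝ, EB) x :=
  invFun (S.FLbar (EB := EB) x)

variable (EB) in
/-- The horizontal lift `hl^P_q = 𝔽L_q ∘ hl^Δ_q ∘ (𝔽L̄)⁻¹ : T*_{π(q)} Q̄ → P_q ⊂ T*_q Q`. -/
def hlP (q : Q) (α : CotangentSpace 𝓘(ℝ, EB) (orbitProj G q)) : CotangentSpace 𝓘(ℝ, E) q :=
  S.FL q (S.hlΔ EB q (S.FLbarInv (orbitProj G q) α))

/-- The reduced Hamiltonian `H̄(p) = ⟨p, v⟩ - L̄(v)` with `v = (𝔽L̄)⁻¹(p)`. -/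
def Hbar (z : CotangentBundle EB (OrbitSpace G Q)) : ℝ :=
  z.snd (S.FLbarInv z.proj z.snd) - S.Lbar z.proj (S.FLbarInv z.proj z.snd)

/-- The value `⟨J ∘ hl^P_q(α), ℬ_q(hl^Δ_q(Y), hl^Δ_q(Z))⟩` for `α ∈ T*_{π(q)} Q̄` and
`Y, Z ∈ T_{π(q)} Q̄`. -/
def xiAt (q : Q) (α : CotangentSpace 𝓘(ℝ, EB) (orbitProj G q))
    (Y Z : TangentSpace 𝓘(ℝ, EB) (orbitProj G q)) : ℝ :=
  momentumMap EG (G := G) (⟨q, S.hlP EB q α⟩ : CotangentBundle E Q)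
    (S.curvature q (S.hlΔ EB q Y) (S.hlΔ EB q Z))

/-- The two-form `Ξ` on `T*Q̄`, computed at a representative `q` of the base point. -/
def Xi (z : CotangentBundle EB (OrbitSpace G Q)) (Y Z : TangentSpace (cotangentModel EB) z) : ℝ :=
  S.xiAt (EB := EB) z.proj.out z.snd (tangentProj z Y) (tangentProj z Z)

/-- The two-form `Ω̄^nh = Ω̄ - Ξ` on `T*Q̄`. -/
def OmegaNH (z : CotangentBundle EB (OrbitSpace G Q))
    (Y Z : TangentSpace (cotangentModel EB) z) : ℝ :=
  canonicalTwoForm z Y Z - S.Xi z Y Z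

/-- The structure `D̄` on `T*Q̄`: the graph `α = (Ω̄^nh)^♭(v)`. -/
def Dbar (z : CotangentBundle EB (OrbitSpace G Q)) :
    Set (TangentSpace (cotangentModel EB) z × CotangentSpace (cotangentModel EB) z) :=
  {a | ∀ w, a.2 w = S.OmegaNH z a.1 w}

variable (EB) in
/-- The map `ρ : P → T*Q̄`, `ρ(z) = (hl^P_q)⁻¹(z)` for `z ∈ P_q`. -/
def rho (z : S.P) : CotangentBundle EB (OrbitSpace G Q) :=
  ⟨orbitProj G z.1.proj, invFun (S.hlP EB z.1.proj) z.1.snd⟩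

end Reduced

/-! ### The constrained Dirac structure on `P` and its reduction -/

section ConstrainedDirac

variable {EP : Type*} [NormedAddCommGroup EP] [NormedSpace ℝ EP] [FiniteDimensional ℝ EP]
  [ChartedSpace EP S.P]

variable (EP) in
/-- The tangent map `T_z ι_P : T_z P → T_z T*Q` of the inclusion `ι_P : P ↪ T*Q`. -/
def tangentInclusion (z : S.P) :
    TangentSpace 𝓘(ℝ, EP) z →L[ℝ] TangentSpace (cotangentModel E) z.1 :=
  mfderiv 𝓘(ℝ, EP) (cotangentModel E) (Subtype.val : S.P → CotangentBundle E Q) z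

variable (EP) in
/-- The distribution `ℋ = TP ∩ Δ_{T*Q}` on `P`, with `Δ_{T*Q} = (Tπ_Q)⁻¹(Δ_Q)`. -/
def 𝓗 (z : S.P) : Submodule ℝ (TangentSpace 𝓘(ℝ, EP) z) :=
  (S.Δ z.1.proj).comap ((tangentProj z.1).comp (S.tangentInclusion EP z)).toLinearMap

/-- The two-form `Ω_P = ι_P^* Ω`. -/
def OmegaP (z : S.P) (u w : TangentSpace 𝓘(ℝ, EP) z) : ℝ :=
  canonicalTwoForm z.1 (S.tangentInclusion EP z u) (S.tangentInclusion EP z w)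

/-- The constrained Dirac structure
`D_P(z) = {(v, α) | v ∈ ℋ_z, α - Ω_P^♭(v) ∈ ℋ_z°}`. -/
def DP (z : S.P) : Set (TangentSpace 𝓘(ℝ, EP) z × CotangentSpace 𝓘(ℝ, EP) z) :=
  {a | a.1 ∈ S.𝓗 EP z ∧ ∀ w ∈ S.𝓗 EP z, a.2 w - S.OmegaP z a.1 w = 0}

variable (EP) in
/-- `D_P` as a subset of `TP ⊕ T*P`. -/
def totalDP : Set (PontryaginBundle 𝓘(ℝ, EP) S.P) := {x | x.2 ∈ S.DP x.1}

section Quotient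

variable [ContMDiffSMul 𝓘(ℝ, EG) 𝓘(ℝ, E) ∞ G Q]

/-- The action `Ψ_g(v_z, α_z) = (TΦ^P_g(v_z), T*Φ^P_{g⁻¹}(α_z))` on `TP ⊕ T*P`. -/
def Psi (g : G) (x : PontryaginBundle 𝓘(ℝ, EP) S.P) : PontryaginBundle 𝓘(ℝ, EP) S.P :=
  ⟨S.actP g x.1,
    (mfderiv 𝓘(ℝ, EP) 𝓘(ℝ, EP) (S.actP g) x.1 x.2.1,
      ContinuousLinearMap.comp x.2.2
        (mfderiv 𝓘(ℝ, EP) 𝓘(ℝ, EP) (S.actP g⁻¹) (S.actP g x.1) : EP →L[ℝ] EP))⟩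

variable (EP) in
/-- The quotient `[D_P]_G = D_P/G`. -/
def QuotDP : Type _ :=
  Quot (fun x y : S.totalDP EP => ∃ g : G, S.Psi g x.1 = y.1)

end Quotient

section Reduction

variable {EB : Type*} [NormedAddCommGroup EB] [NormedSpace ℝ EB] [FiniteDimensional ℝ EB]
  [ChartedSpace EB (OrbitSpace G Q)] [IsManifold 𝓘(ℝ, EB) ∞ (OrbitSpace G Q)]

variable (EP EB) in
/-- The tangent map `T_z ρ : T_z P → T_{ρ(z)} T*Q̄`. -/
def tangentRho (z : S.P) :
    TangentSpace 𝓘(ℝ, EP) z →L[ℝ] TangentSpace (cotangentModel EB) (S.rho EB z) :=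
  mfderiv 𝓘(ℝ, EP) (cotangentModel EB) (S.rho EB) z

variable (EP EB) in
/-- The horizontal lift `(T_zρ|_{ℋ_z})⁻¹ : T_{ρ(z)} T*Q̄ → ℋ_z ⊂ T_z P`. -/
def hlH (z : S.P) :
    TangentSpace (cotangentModel EB) (S.rho EB z) →L[ℝ] TangentSpace 𝓘(ℝ, EP) z :=
  let A : EB × (EB →L[ℝ] ℝ) →ₗ[ℝ] EP :=
    (S.𝓗 EP z).subtype ∘ₗ ((S.tangentRho EP EB z).toLinearMap ∘ₗ (S.𝓗 EP z).subtype).leftInverse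
  let A' : EB × (EB →L[ℝ] ℝ) →L[ℝ] EP := LinearMap.toContinuousLinearMap A
  A'

variable (EP EB) in
/-- The map `f : TP ⊕ T*P → T(T*Q̄) ⊕ T*(T*Q̄)`, sending `(v_z, α_z)` to `T_zρ(v_z)` and the
pull-back of `α_z` by the horizontal lift `T_{ρ(z)} T*Q̄ → ℋ_z`. -/
def redMap (x : PontryaginBundle 𝓘(ℝ, EP) S.P) :
    PontryaginBundle (cotangentModel EB) (CotangentBundle EB (OrbitSpace G Q)) :=
  ⟨S.rho EB x.1, (S.tangentRho EP EB x.1 x.2.1, x.2.2.comp (S.hlH EP EB x.1))⟩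

end Reduction

end ConstrainedDirac

end WeaklyDegenerateChaplyginSystem

end Nonholonomic

open Nonholonomic

/-! The proof moves every object from `P` to the whole of `T*Q`. Since `g` is positive-definite on
`Δ_Q`, the reduced metric `gbar` is invertible on each fibre, so a point of `P` over `q` is
determined by the restriction of its covector to `Δ_Q(q)`. Hence `ρ` is the restriction to `P` of
the smooth map `red : T*Q → T*Q̄`, `p ↦ p ∘ hl^Δ` (`rho_eq_red`), and `toP` is a smooth retraction
of `T*Q` onto `P` that does not change `red` (`red_toP`). Smoothness and derivatives on `P` are
computed through these two maps; only the restriction of `g` to `Δ_Q` is ever inverted, so its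
degeneracy does no harm.

The heart is an identity of one-forms. Splitting a tangent vector of `Q` into its horizontal and
vertical parts gives `red^*Θ̄ = Θ - ⟨J, 𝒜 ∘ Tπ_Q⟩` (`liouville_red`). Apply `d` and evaluate on
vectors lying over `Δ_Q = ker 𝒜`: the term `dJ ∧ 𝒜` drops out, leaving `Ω = red^*Ω̄ - ⟨J, d𝒜⟩`
(`omega_eq`). On `P` the right-hand side is the pull-back of `Ω̄ - Ξ` (`omega_eq_omegaNH`). As `Ω`
and `red` are both invariant under cotangent lifts, the same identity shows that `Ξ` does not depend
on the representative (`jmap_curvature_smul`). Non-degeneracy of `Ω̄ - Ξ` holds because `Ξ` is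
semibasic.

The rest is linear algebra over each point, once `Tρ` is known to be an isomorphism on `ℋ`
(`eq_zero_of_rhoT_eq_zero`, `exists_mem_horP_rhoT_eq`). Then `D_P` is the set of `(v, α)` with `v`
in `ℋ` whose image under `f` satisfies the equation of `D̄` (`mem_diracP_iff`); the fibres of `f` on
`D_P` and the reduction of the dynamics follow, the latter from `H_P = H̄ ∘ ρ` and non-degeneracy.

Two geometric inputs need separate work: `ker Tπ` is the tangent space of the orbit (`ker_projQ`),
which uses the injectivity of `ξ ↦ ξ_Q(q)` (`gen_injective`) and the bound `dim Q - dim Q̄ ≤ dim G`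
(`finrank_complement_le`); and a submersion has local sections with prescribed derivative
(`exists_local_section`).

All tangent spaces have the model space as underlying type, so each object has a copy between model
spaces; values at different points are compared through the frames of a fixed chart. -/

set_option linter.unusedSectionVars false

/-! ### Derivatives and smoothness of bundle-valued maps, read in chart frames. -/

namespace Nonholonomic

/-- The derivative of `F : N → M` at `n`, as a map between the model spaces. -/
def tmap {EN : Type*} [NormedAddCommGroup EN] [NormedSpace ℝ EN]
    {HN : Type*} [TopologicalSpace HN] (J : ModelWithCorners ℝ EN HN)
    {EM : Type*} [NormedAddCommGroup EM] [NormedSpace ℝ EM]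
    {HM : Type*} [TopologicalSpace HM] (I : ModelWithCorners ℝ EM HM)
    {N : Type*} [TopologicalSpace N] [ChartedSpace HN N]
    {M : Type*} [TopologicalSpace M] [ChartedSpace HM M] (F : N → M) (n : N) : EN →L[ℝ] EM :=
  mfderiv J I F n

section Frames

variable {EM : Type*} [NormedAddCommGroup EM] [NormedSpace ℝ EM]
  {HM : Type*} [TopologicalSpace HM] (I : ModelWithCorners ℝ EM HM) [I.Boundaryless]
  {M : Type*} [TopologicalSpace M] [ChartedSpace HM M]

/-- The coordinate frame at `x` of the preferred chart at `x₀`, as a map `E → T_x M`. -/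
def frame (x₀ x : M) : EM →L[ℝ] EM :=
  mfderiv 𝓘(ℝ, EM) I (extChartAt I x₀).symm (extChartAt I x₀ x)

/-- The derivative at `x` of the preferred chart at `x₀`, as a map `T_x M → E`. -/
def coframe (x₀ x : M) : EM →L[ℝ] EM :=
  mfderiv I 𝓘(ℝ, EM) (extChartAt I x₀) x

variable [IsManifold I ∞ M]

variable {I}

theorem coframe_comp_frame {x₀ x : M} (hx : x ∈ (extChartAt I x₀).source) :
    (coframe I x₀ x).comp (frame I x₀ x) = ContinuousLinearMap.id ℝ EM := by
  have h := mfderiv_extChartAt_comp_mfderivWithin_extChartAt_symm' (I := I) hx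
  rw [I.range_eq_univ, mfderivWithin_univ] at h
  exact h

theorem frame_comp_coframe {x₀ x : M} (hx : x ∈ (extChartAt I x₀).source) :
    (frame I x₀ x).comp (coframe I x₀ x) = ContinuousLinearMap.id ℝ EM := by
  have h := mfderivWithin_extChartAt_symm_comp_mfderiv_extChartAt' (I := I) hx
  rw [I.range_eq_univ, mfderivWithin_univ] at h
  exact h

theorem coframe_frame {x₀ x : M} (hx : x ∈ (extChartAt I x₀).source) (v : EM) :
    coframe I x₀ x (frame I x₀ x v) = v :=
  congrArg (fun T : EM →L[ℝ] EM => T v) (coframe_comp_frame hx)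

theorem frame_coframe {x₀ x : M} (hx : x ∈ (extChartAt I x₀).source) (v : EM) :
    frame I x₀ x (coframe I x₀ x v) = v :=
  congrArg (fun T : EM →L[ℝ] EM => T v) (frame_comp_coframe hx)

theorem coframe_self (x : M) : coframe I x x = ContinuousLinearMap.id ℝ EM := by
  exact mfderiv_extChartAt_self

theorem frame_self (x : M) : frame I x x = ContinuousLinearMap.id ℝ EM := by
  have h := frame_comp_coframe (I := I) (mem_extChartAt_source (I := I) x)
  rw [coframe_self] at h
  exact h

theorem trivializationAt_eq_coframe {x₀ x : M} (hx : x ∈ (extChartAt I x₀).source)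
    (v : TangentSpace I x) :
    (trivializationAt EM (TangentSpace I) x₀ ⟨x, v⟩).2 = coframe I x₀ x v := by
  rw [extChartAt_source] at hx
  have h := TangentBundle.continuousLinearMapAt_trivializationAt (I := I) hx
  have h2 := congrArg (fun T : EM →L[ℝ] EM => T v) h
  refine Eq.trans ?_ h2
  exact (Trivialization.continuousLinearMapAt_apply_of_mem _ _ hx _).symm

theorem symmL_eq_frame {x₀ x : M} (hx : x ∈ (extChartAt I x₀).source) :
    ((trivializationAt EM (TangentSpace I) x₀).symmL ℝ x : EM →L[ℝ] EM) = frame I x₀ x := by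
  rw [extChartAt_source] at hx
  have h := TangentBundle.symmL_trivializationAt (I := I) hx
  rw [I.range_eq_univ, mfderivWithin_univ] at h
  exact h

variable {EN : Type*} [NormedAddCommGroup EN] [NormedSpace ℝ EN]
  {HN : Type*} [TopologicalSpace HN] {J : ModelWithCorners ℝ EN HN}
  {N : Type*} [TopologicalSpace N] [ChartedSpace HN N]

/-- The coframe belongs to one fixed chart, the preferred one at the base point of `f n₀`.
Smoothness in a bundle thereby becomes smoothness into a fixed vector space, which is the form of
all later smoothness arguments; `contMDiffAt_oneForm_iff` does the same for covectors. -/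
theorem contMDiffAt_tangentBundle_iff {f : N → TangentBundle I M} {n₀ : N} :
    ContMDiffAt J I.tangent ∞ f n₀ ↔ ContMDiffAt J I ∞ (fun n => (f n).proj) n₀ ∧
      ContMDiffAt J 𝓘(ℝ, EM) ∞ (fun n => coframe I (f n₀).proj (f n).proj (f n).2) n₀ := by
  rw [contMDiffAt_totalSpace]
  refine and_congr_right fun h => ?_
  have hs : ∀ᶠ n in 𝓝 n₀, (f n).proj ∈ (extChartAt I (f n₀).proj).source :=
    h.continuousAt (extChartAt_source_mem_nhds (I := I) (f n₀).proj)
  exact Filter.EventuallyEq.contMDiffAt_iff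
    (hs.mono fun n hn => trivializationAt_eq_coframe hn (f n).2)

theorem inCoordinates_eq_comp_frame {x₀ x : M} (hx : x ∈ (extChartAt I x₀).source)
    {B : Type*} [TopologicalSpace B] {V : Type*} [NormedAddCommGroup V] [NormedSpace ℝ V]
    (y₀ y : B) (A : EM →L[ℝ] V) :
    ContinuousLinearMap.inCoordinates EM (TangentSpace I : M → Type _) V (Bundle.Trivial B V)
      x₀ x y₀ y A = A.comp (frame I x₀ x) := by
  rw [← symmL_eq_frame hx]
  ext v
  simp [ContinuousLinearMap.inCoordinates]
  rfl

theorem contMDiffAt_oneForm_iff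
    {f : N → TotalSpace (EM →L[ℝ] ℝ) (fun x : M => TangentSpace I x →L[ℝ] ℝ)} {n₀ : N} :
    ContMDiffAt J (I.prod 𝓘(ℝ, EM →L[ℝ] ℝ)) ∞ f n₀ ↔
      ContMDiffAt J I ∞ (fun n => (f n).proj) n₀ ∧
      ContMDiffAt J 𝓘(ℝ, EM →L[ℝ] ℝ) ∞
        (fun n => ((f n).2 : EM →L[ℝ] ℝ).comp (frame I (f n₀).proj (f n).proj)) n₀ := by
  rw [contMDiffAt_hom_bundle]
  refine and_congr_right fun h => ?_
  have hs : ∀ᶠ n in 𝓝 n₀, (f n).proj ∈ (extChartAt I (f n₀).proj).source :=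
    h.continuousAt (extChartAt_source_mem_nhds (I := I) (f n₀).proj)
  exact Filter.EventuallyEq.contMDiffAt_iff
    (hs.mono fun n hn => inCoordinates_eq_comp_frame hn _ _ (f n).2)

variable [J.Boundaryless] [IsManifold J ∞ N]

theorem contMDiffAt_mfderiv_in_frames {F : N → M} {n₀ : N} (hF : ContMDiffAt J I ∞ F n₀) :
    ContMDiffAt J 𝓘(ℝ, EN →L[ℝ] EM) ∞ (fun n => (coframe I (F n₀) (F n)).comp
      ((tmap J I F n).comp (frame J n₀ n))) n₀ := by
  have h := ContMDiffAt.mfderiv_const (m := ∞) hF (by simp)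
  refine h.congr_of_eventuallyEq ?_
  filter_upwards [hF.continuousAt (extChartAt_source_mem_nhds (I := I) (F n₀)),
    extChartAt_source_mem_nhds (I := J) n₀] with n h1 h2
  rw [extChartAt_source] at h2
  have h1' : F n ∈ (chartAt HM (F n₀)).source := by rw [← extChartAt_source I]; exact h1
  have := inTangentCoordinates_eq_mfderiv_comp (I := J) (I' := I) (f := id) (g := F)
    (ϕ := mfderiv J I F) (x₀ := n₀) (x := n) h2 h1'
  rw [J.range_eq_univ, mfderivWithin_univ] at this
  exact this.symm

variable {EL : Type*} [NormedAddCommGroup EL] [NormedSpace ℝ EL]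
  {HL : Type*} [TopologicalSpace HL] {K : ModelWithCorners ℝ EL HL}
  {L : Type*} [TopologicalSpace L] [ChartedSpace HL L]

theorem hasMFDerivAt_tmap {F : N → M} {n : N} (hF : MDifferentiableAt J I F n) :
    HasMFDerivAt J I F n (tmap J I F n :) := hF.hasMFDerivAt

theorem tmap_eq_of_hasMFDerivAt {F : N → M} {n : N} {A : EN →L[ℝ] EM}
    (h : HasMFDerivAt J I F n A) : tmap J I F n = A := h.mfderiv

theorem tmap_comp {F : N → M} {F' : L → N} {l : L} (hF : MDifferentiableAt J I F (F' l))
    (hF' : MDifferentiableAt K J F' l) :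
    tmap K I (fun l => F (F' l)) l = (tmap J I F (F' l)).comp (tmap K J F' l) :=
  (hF.hasMFDerivAt.comp l hF'.hasMFDerivAt).mfderiv

theorem tmap_id (n : N) : tmap J J (fun x : N => x) n = ContinuousLinearMap.id ℝ EN := mfderiv_id

theorem tmap_congr {F F' : N → M} {n : N} (h : F =ᶠ[𝓝 n] F') : tmap J I F n = tmap J I F' n :=
  h.mfderiv_eq

end Frames

end Nonholonomic

/-! ### The exterior derivative of vector-valued one-forms: naturality and the Leibniz rule. -/

namespace Nonholonomic

section ExteriorDerivative

variable {EM : Type*} [NormedAddCommGroup EM] [NormedSpace ℝ EM]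
  {HM : Type*} [TopologicalSpace HM] {I : ModelWithCorners ℝ EM HM} [I.Boundaryless]
  {M : Type*} [TopologicalSpace M] [ChartedSpace HM M] [IsManifold I ∞ M]
  {EN : Type*} [NormedAddCommGroup EN] [NormedSpace ℝ EN]
  {HN : Type*} [TopologicalSpace HN] {J : ModelWithCorners ℝ EN HN} [J.Boundaryless]
  {N : Type*} [TopologicalSpace N] [ChartedSpace HN N] [IsManifold J ∞ N]
  {V : Type*} [NormedAddCommGroup V] [NormedSpace ℝ V]

variable (I) in
/-- `oneFormInChart`, between the model spaces. -/
def formInChart (θ : M → (EM →L[ℝ] V)) (x₀ : M) : EM → (EM →L[ℝ] V) := oneFormInChart I θ x₀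

variable (I) in
/-- `dOneForm`, between the model spaces. -/
def extD (θ : M → (EM →L[ℝ] V)) (x : M) (u w : EM) : V := dOneForm I θ x u w

theorem formInChart_extChartAt (θ : M → (EM →L[ℝ] V)) {x₀ x : M}
    (hx : x ∈ (extChartAt I x₀).source) :
    formInChart I θ x₀ (extChartAt I x₀ x) = (θ x).comp (frame I x₀ x) := by
  unfold formInChart oneFormInChart
  rw [(extChartAt I x₀).left_inv hx]
  rfl

theorem formInChart_eq (θ : M → (EM →L[ℝ] V)) {x₀ : M} {y : EM}
    (hy : y ∈ (extChartAt I x₀).target) :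
    formInChart I θ x₀ y = (θ ((extChartAt I x₀).symm y)).comp
      (frame I x₀ ((extChartAt I x₀).symm y)) := by
  have h := formInChart_extChartAt θ ((extChartAt I x₀).map_target hy)
  rwa [(extChartAt I x₀).right_inv hy] at h

theorem contMDiffAt_extChartAt_symm_of_mem {x₀ : M} {y : EM} (hy : y ∈ (extChartAt I x₀).target) :
    ContMDiffAt 𝓘(ℝ, EM) I ∞ (extChartAt I x₀).symm y :=
  (contMDiffOn_extChartAt_symm x₀ y hy).contMDiffAt ((isOpen_extChartAt_target x₀).mem_nhds hy)

theorem contDiffAt_formInChart {θ : M → (EM →L[ℝ] V)} {x₀ x : M}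
    (hx : x ∈ (extChartAt I x₀).source)
    (h : ContMDiffAt I 𝓘(ℝ, EM →L[ℝ] V) ∞
      (fun x => (θ x).comp (frame I x₀ x)) x) :
    ContDiffAt ℝ ∞ (formInChart I θ x₀) (extChartAt I x₀ x) := by
  have hy := (extChartAt I x₀).map_source hx
  rw [← contMDiffAt_iff_contDiffAt]
  have h1 : ContMDiffAt 𝓘(ℝ, EM) 𝓘(ℝ, EM →L[ℝ] V) ∞ ((fun x =>
      (θ x).comp (frame I x₀ x)) ∘ (extChartAt I x₀).symm) (extChartAt I x₀ x) := by
    refine ContMDiffAt.comp (I' := I) _ ?_ (contMDiffAt_extChartAt_symm_of_mem hy)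
    rwa [(extChartAt I x₀).left_inv hx]
  refine h1.congr_of_eventuallyEq ?_
  filter_upwards [(isOpen_extChartAt_target (I := I) x₀).mem_nhds hy] with y hy
  exact formInChart_eq θ hy

/-- The coordinate expression of `F` in the preferred charts at `n` and `F n`. -/
theorem contDiffAt_writtenInExtChartAt {F : N → M} {n : N} (hF : ContMDiffAt J I ∞ F n) :
    ContDiffAt ℝ ∞ (fun y => extChartAt I (F n) (F ((extChartAt J n).symm y)))
      (extChartAt J n n) := by
  have h := (contMDiffAt_iff.1 hF).2
  rw [J.range_eq_univ, contDiffWithinAt_univ] at h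
  exact h

theorem fderiv_writtenInExtChartAt {F : N → M} {n x : N} (hF : MDifferentiableAt J I F x)
    (hx : x ∈ (extChartAt J n).source) (hx' : F x ∈ (extChartAt I (F n)).source) :
    fderiv ℝ (fun y => extChartAt I (F n) (F ((extChartAt J n).symm y))) (extChartAt J n x)
      = (coframe I (F n) (F x)).comp
        ((tmap J I F x).comp (frame J n x)) := by
  have hy := (extChartAt J n).map_source hx
  have h1 : HasMFDerivAt 𝓘(ℝ, EN) J (extChartAt J n).symm (extChartAt J n x) (frame J n x :) :=
    ((contMDiffAt_extChartAt_symm_of_mem hy).mdifferentiableAt (by simp)).hasMFDerivAt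
  have hl := (extChartAt J n).left_inv hx
  have h2 : HasMFDerivAt J I F ((extChartAt J n).symm (extChartAt J n x)) (tmap J I F x :) := by
    rw [hl]; exact hF.hasMFDerivAt
  have h3 : HasMFDerivAt I 𝓘(ℝ, EM) (extChartAt I (F n))
      (F ((extChartAt J n).symm (extChartAt J n x))) (coframe I (F n) (F x) :) := by
    rw [hl]
    exact (mdifferentiableAt_extChartAt (by rwa [← extChartAt_source I])).hasMFDerivAt
  have h4 : HasMFDerivAt 𝓘(ℝ, EN) 𝓘(ℝ, EM)
      (fun y => extChartAt I (F n) (F ((extChartAt J n).symm y))) (extChartAt J n x)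
      ((coframe I (F n) (F x)).comp ((tmap J I F x).comp (frame J n x)) :) :=
    h3.comp (extChartAt J n x) (h2.comp (extChartAt J n x) h1)
  have h5 : HasFDerivAt (fun y => extChartAt I (F n) (F ((extChartAt J n).symm y)))
      ((coframe I (F n) (F x)).comp ((tmap J I F x).comp (frame J n x))) (extChartAt J n x) :=
    hasMFDerivAt_iff_hasFDerivAt.1 h4
  exact h5.fderiv

theorem extD_self_chart (θ : M → (EM →L[ℝ] V)) (x : M) (u w : EM) :
    extD I θ x u w = fderiv ℝ (formInChart I θ x) (extChartAt I x x) u w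
      - fderiv ℝ (formInChart I θ x) (extChartAt I x x) w u := by
  have h : coframe I x x = ContinuousLinearMap.id ℝ EM := coframe_self x
  change fderiv ℝ (formInChart I θ x) (extChartAt I x x) (coframe I x x u) (coframe I x x w) -
      fderiv ℝ (formInChart I θ x) (extChartAt I x x) (coframe I x x w) (coframe I x x u) = _
  rw [h]
  rfl

/-- The exterior derivative commutes with pull-back by a smooth map. -/
theorem extD_pullback {F : N → M} {n : N} (hF : ContMDiffAt J I ∞ F n)
    {θ : M → (EM →L[ℝ] V)} {θ' : N → (EN →L[ℝ] V)}
    (hθ : DifferentiableAt ℝ (formInChart I θ (F n)) (extChartAt I (F n) (F n)))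
    (hθ' : ∀ᶠ x in 𝓝 n, θ' x = (θ (F x)).comp (tmap J I F x)) (u w : EN) :
    extD J θ' n u w = extD I θ (F n) (tmap J I F n u)
      (tmap J I F n w) := by
  rw [extD_self_chart, extD_self_chart]
  set Fc : EN → EM := fun y => extChartAt I (F n) (F ((extChartAt J n).symm y)) with hFc
  set y₀ := extChartAt J n n with hy₀
  have hsm : ContDiffAt ℝ ∞ Fc y₀ := contDiffAt_writtenInExtChartAt hF
  have hFy : Fc y₀ = extChartAt I (F n) (F n) := by simp [hFc, hy₀]
  have hmd : ∀ᶠ x in 𝓝 n, MDifferentiableAt J I F x := by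
    have h1 : ContMDiffAt J I 1 F n := hF.of_le (by simp)
    exact (contMDiffAt_iff_contMDiffAt_nhds (by simp) |>.1 h1).mono fun x hx => hx.mdifferentiableAt (by simp)
  -- In coordinates the pulled-back form is `y ↦ θ(Fc y) ∘ DFc(y)`, a composition that the product
  -- rule can differentiate.
  have hev : ∀ᶠ x in 𝓝 n, formInChart J θ' n (extChartAt J n x)
      = (formInChart I θ (F n) (Fc (extChartAt J n x))).comp
        (fderiv ℝ Fc (extChartAt J n x)) := by
    filter_upwards [hθ', hmd, extChartAt_source_mem_nhds (I := J) n,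
      hF.continuousAt (extChartAt_source_mem_nhds (I := I) (F n))] with x h1 h2 h3 h4
    rw [formInChart_extChartAt θ' h3, fderiv_writtenInExtChartAt h2 h3 h4]
    have : Fc (extChartAt J n x) = extChartAt I (F n) (F x) := by
      simp only [hFc, (extChartAt J n).left_inv h3]
    rw [this, formInChart_extChartAt θ h4, h1]
    ext v
    simp only [ContinuousLinearMap.comp_apply]
    rw [frame_coframe h4]
  have hev' : formInChart J θ' n =ᶠ[𝓝 y₀]
      fun y => (formInChart I θ (F n) (Fc y)).comp (fderiv ℝ Fc y) := by
    have hc : Filter.Tendsto (extChartAt J n).symm (𝓝 y₀) (𝓝 n) := by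
      have := continuousAt_extChartAt_symm (I := J) n
      rw [ContinuousAt, extChartAt_to_inv] at this
      exact this
    filter_upwards [hc.eventually hev, extChartAt_target_mem_nhds (I := J) n] with y h1 h2
    rwa [(extChartAt J n).right_inv h2] at h1
  rw [hev'.fderiv_eq]
  have hd1 : HasFDerivAt Fc (tmap J I F n) y₀ := by
    have h2 := fderiv_writtenInExtChartAt (hF.mdifferentiableAt (by simp))
      (mem_extChartAt_source (I := J) n) (mem_extChartAt_source (I := I) (F n))
    rw [coframe_self, frame_self, ContinuousLinearMap.id_comp, ContinuousLinearMap.comp_id] at h2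
    rw [← h2]
    exact (hsm.differentiableAt (by simp)).hasFDerivAt
  have hd2 : HasFDerivAt (fderiv ℝ Fc) (fderiv ℝ (fderiv ℝ Fc) y₀) y₀ :=
    ((hsm.fderiv_right (m := ∞) (by simp)).differentiableAt (by simp)).hasFDerivAt
  have hd3 : HasFDerivAt (fun y => formInChart I θ (F n) (Fc y))
      ((fderiv ℝ (formInChart I θ (F n)) (extChartAt I (F n) (F n))).comp (tmap J I F n))
      y₀ := by
    rw [← hFy] at hθ ⊢
    exact hθ.hasFDerivAt.comp y₀ hd1
  -- Differentiating `θ(Fc y) ∘ DFc(y)` yields `dθ` on the pushed-forward vectors plus `θ` applied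
  -- to `D²Fc`; the latter is symmetric and cancels on antisymmetrising.
  have hsymm : ∀ a b, fderiv ℝ (fderiv ℝ Fc) y₀ a b = fderiv ℝ (fderiv ℝ Fc) y₀ b a := by
    have := hsm.isSymmSndFDerivAt (by simpa using WithTop.coe_le_coe.2 (le_top (a := (2 : ℕ∞))))
    exact fun a b => this a b
  rw [(hd3.clm_comp hd2).fderiv, hd1.fderiv]
  simp [hsymm u w]

theorem extD_add {θ η : M → (EM →L[ℝ] V)} {x : M}
    (hθ : DifferentiableAt ℝ (formInChart I θ x) (extChartAt I x x))
    (hη : DifferentiableAt ℝ (formInChart I η x) (extChartAt I x x)) (u w : EM) :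
    extD I (fun y => θ y + η y) x u w = extD I θ x u w + extD I η x u w := by
  simp only [extD_self_chart]
  have h : formInChart I (fun y => θ y + η y) x
      = fun y => formInChart I θ x y + formInChart I η x y := by
    funext y
    exact ContinuousLinearMap.add_comp (θ _) (η _) _
  rw [h, fderiv_fun_add hθ hη]
  simp only [add_apply]
  abel

/-- The exterior derivative of `⟨j, η⟩` on vectors annihilated by `η` is `⟨j, dη⟩`. -/
theorem extD_comp_of_eq_zero {W : Type*} [NormedAddCommGroup W] [NormedSpace ℝ W]
    {j : M → (V →L[ℝ] W)} {η : M → (EM →L[ℝ] V)} {x : M}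
    (hj : MDifferentiableAt I 𝓘(ℝ, V →L[ℝ] W) j x)
    (hη : DifferentiableAt ℝ (formInChart I η x) (extChartAt I x x)) {u w : EM}
    (hu : η x u = 0) (hw : η x w = 0) :
    extD I (fun y => (j y).comp (η y)) x u w = j x (extD I η x u w) := by
  simp only [extD_self_chart]
  have h : formInChart I (fun y => (j y).comp (η y)) x
      = fun y => (j ((extChartAt I x).symm y)).comp (formInChart I η x y) := by
    funext y
    exact ContinuousLinearMap.comp_assoc (j _) (η _) _
  have hj' : DifferentiableAt ℝ (fun y => j ((extChartAt I x).symm y)) (extChartAt I x x) := by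
    rw [← mdifferentiableAt_iff_differentiableAt]
    refine MDifferentiableAt.comp (I' := I) _ ?_
      ((contMDiffAt_extChartAt_symm_of_mem (mem_extChartAt_target x)).mdifferentiableAt (by simp))
    rwa [(extChartAt I x).left_inv (mem_extChartAt_source x)]
  have h0 : formInChart I η x (extChartAt I x x) = η x := by
    rw [formInChart_extChartAt η (mem_extChartAt_source x), frame_self]
    rfl
  have hjx : j ((extChartAt I x).symm (extChartAt I x x)) = j x := by simp
  -- In the product rule the derivative of `j` appears only applied to `η x u` or `η x w`, both
  -- zero.
  rw [h, (hj'.hasFDerivAt.clm_comp hη.hasFDerivAt).fderiv]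
  simp only [add_apply, ContinuousLinearMap.comp_apply, ContinuousLinearMap.compL_apply,
    ContinuousLinearMap.flip_apply, h0, hjx, hu, hw, map_sub, map_zero, add_zero]

/-- On a vector space the preferred chart is the identity. This turns the exterior derivative of a
form pulled back by an inverse chart into an ordinary antisymmetrised derivative. -/
theorem formInChart_model (θ : EM → (EM →L[ℝ] V)) (y₀ : EM) :
    formInChart 𝓘(ℝ, EM) θ y₀ = θ := by
  funext y
  have h : frame 𝓘(ℝ, EM) y₀ y = ContinuousLinearMap.id ℝ EM := by
    have h1 := coframe_comp_frame (I := 𝓘(ℝ, EM)) (x₀ := y₀) (x := y)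
      (by rw [extChartAt_model_space_eq_id]; trivial)
    have h2 : coframe 𝓘(ℝ, EM) y₀ y = ContinuousLinearMap.id ℝ EM := by
      unfold coframe
      rw [extChartAt_model_space_eq_id]
      exact mfderiv_id
    rwa [h2, ContinuousLinearMap.id_comp] at h1
  have h1 := formInChart_eq (I := 𝓘(ℝ, EM)) θ (x₀ := y₀) (y := y)
    (by rw [extChartAt_model_space_eq_id]; trivial)
  rw [h1]
  simp only [extChartAt_model_space_eq_id, PartialEquiv.refl_symm, PartialEquiv.refl_coe, id, h]
  rfl

/-- The exterior derivative at `x` computed in any preferred chart around `x`. -/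
theorem extD_frame {θ : M → (EM →L[ℝ] V)} {x₀ x : M} (hx : x ∈ (extChartAt I x₀).source)
    (hθ : DifferentiableAt ℝ (formInChart I θ x) (extChartAt I x x)) (a b : EM) :
    extD I θ x (frame I x₀ x a) (frame I x₀ x b)
      = fderiv ℝ (formInChart I θ x₀) (extChartAt I x₀ x) a b
        - fderiv ℝ (formInChart I θ x₀) (extChartAt I x₀ x) b a := by
  have hy := (extChartAt I x₀).map_source hx
  have hl := (extChartAt I x₀).left_inv hx
  -- Independence of the chart is naturality under pull-back, applied to the inverse chart at `x₀`.
  have h := extD_pullback (J := 𝓘(ℝ, EM)) (I := I) (F := (extChartAt I x₀).symm)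
    (n := extChartAt I x₀ x) (contMDiffAt_extChartAt_symm_of_mem hy) (θ := θ)
    (θ' := formInChart I θ x₀) (by rwa [hl]) (Filter.Eventually.of_forall fun y => rfl) a b
  rw [extD_self_chart, formInChart_model] at h
  rw [hl] at h
  exact h.symm

end ExteriorDerivative

end Nonholonomic

/-! ### Canonical coordinates on the cotangent bundle and the constancy of `Ω` in them. -/

namespace Nonholonomic

section CotangentCharts

variable {E : Type*} [NormedAddCommGroup E] [NormedSpace ℝ E]
  {M : Type*} [TopologicalSpace M] [ChartedSpace E M] [IsManifold 𝓘(ℝ, E) ∞ M]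

/-- The covector of a point of `T*M`, as a functional on the model space. -/
def cov (z : CotangentBundle E M) : E →L[ℝ] ℝ := z.snd

/-- The point of `T*M` with given base point and covector. -/
def mkCov (q : M) (p : E →L[ℝ] ℝ) : CotangentBundle E M := ⟨q, p⟩

theorem mkCov_cov (z : CotangentBundle E M) : mkCov z.proj (cov z) = z := rfl

theorem cotangent_ext {z z' : CotangentBundle E M} (h : z.proj = z'.proj) (h' : cov z = cov z') :
    z = z' := by
  rw [← mkCov_cov z, ← mkCov_cov z', h, h']

/-- A chart of `T*M` is a trivialisation followed by a chart of the base, both with the same domain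
in `M`. It therefore covers whole fibres, and its domain is controlled by the base point alone. -/
theorem mem_extChartAt_source_cotangent {z₀ z : CotangentBundle E M} :
    z ∈ (extChartAt (cotangentModel E) z₀).source ↔
      z.proj ∈ (extChartAt 𝓘(ℝ, E) z₀.proj).source := by
  rw [FiberBundle.extChartAt, PartialEquiv.trans_source]
  simp only [PartialEquiv.prod_source, PartialEquiv.refl_source, mem_inter_iff, mem_preimage,
    OpenPartialHomeomorph.coe_toPartialEquiv, mem_prod, mem_univ, and_true]
  refine ⟨fun h => ?_, fun h => ?_⟩
  · have h2 := h.2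
    rwa [Trivialization.coe_coe, Trivialization.coe_fst' _ (Trivialization.mem_source _ |>.1 h.1)]
      at h2
  · have h1 : z.proj ∈ (trivializationAt (E →L[ℝ] ℝ)
        (fun x : M => TangentSpace 𝓘(ℝ, E) x →L[ℝ] ℝ) z₀.proj).baseSet := by
      rw [hom_trivializationAt_baseSet]
      exact ⟨by simpa using h, mem_univ _⟩
    refine ⟨Trivialization.mem_source _ |>.2 h1, ?_⟩
    rwa [Trivialization.coe_coe, Trivialization.coe_fst' _ h1]

theorem extChartAt_cotangent {z₀ z : CotangentBundle E M}
    (hz : z.proj ∈ (extChartAt 𝓘(ℝ, E) z₀.proj).source) :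
    extChartAt (cotangentModel E) z₀ z = (extChartAt 𝓘(ℝ, E) z₀.proj z.proj,
      (cov z).comp (frame 𝓘(ℝ, E) z₀.proj z.proj)) := by
  rw [FiberBundle.extChartAt]
  have := inCoordinates_eq_comp_frame (I := 𝓘(ℝ, E)) hz z₀.proj z.proj (cov z)
  rw [← this]
  rfl

theorem contMDiff_proj : ContMDiff (cotangentModel E) 𝓘(ℝ, E) ∞
    (fun z : CotangentBundle E M => z.proj) :=
  Bundle.contMDiff_proj _

/-- The tangent map of the cotangent bundle projection, between the model spaces. -/
def projT (z : CotangentBundle E M) : E × (E →L[ℝ] ℝ) →L[ℝ] E :=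
  tmap (cotangentModel E) 𝓘(ℝ, E) (fun y : CotangentBundle E M => y.proj) z

theorem tmap_extChartAt {EM : Type*} [NormedAddCommGroup EM] [NormedSpace ℝ EM]
    {HM : Type*} [TopologicalSpace HM] (I : ModelWithCorners ℝ EM HM)
    {M : Type*} [TopologicalSpace M] [ChartedSpace HM M] (x₀ x : M) :
    tmap I 𝓘(ℝ, EM) (extChartAt I x₀) x = coframe I x₀ x := rfl

theorem mdifferentiableAt_extChartAt_of_mem {EM : Type*} [NormedAddCommGroup EM]
    [NormedSpace ℝ EM] {HM : Type*} [TopologicalSpace HM] {I : ModelWithCorners ℝ EM HM}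
    {M : Type*} [TopologicalSpace M] [ChartedSpace HM M] [IsManifold I ∞ M] {x₀ x : M}
    (hx : x ∈ (extChartAt I x₀).source) :
    MDifferentiableAt I 𝓘(ℝ, EM) (extChartAt I x₀) x :=
  mdifferentiableAt_extChartAt (by rwa [← extChartAt_source I])

/-- In canonical coordinates the projection is `(q, p) ↦ q`; this is the derivative of that
identity. -/
theorem coframe_comp_projT {z₀ z : CotangentBundle E M}
    (hz : z.proj ∈ (extChartAt 𝓘(ℝ, E) z₀.proj).source) :
    (coframe 𝓘(ℝ, E) z₀.proj z.proj).comp (projT z)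
      = (ContinuousLinearMap.fst ℝ E (E →L[ℝ] ℝ)).comp (coframe (cotangentModel E) z₀ z) := by
  have h1 : tmap (cotangentModel E) 𝓘(ℝ, E)
      (fun y : CotangentBundle E M => extChartAt 𝓘(ℝ, E) z₀.proj y.proj) z
      = (coframe 𝓘(ℝ, E) z₀.proj z.proj).comp (projT z) :=
    tmap_comp (mdifferentiableAt_extChartAt_of_mem hz)
      (contMDiff_proj.mdifferentiable (by simp) z)
  have h2 : tmap (cotangentModel E) 𝓘(ℝ, E)
      (fun y : CotangentBundle E M => (extChartAt (cotangentModel E) z₀ y).1) z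
      = (ContinuousLinearMap.fst ℝ E (E →L[ℝ] ℝ)).comp (coframe (cotangentModel E) z₀ z) := by
    have hz' := mem_extChartAt_source_cotangent.2 hz
    have h3 : HasMFDerivAt 𝓘(ℝ, E × (E →L[ℝ] ℝ)) 𝓘(ℝ, E) Prod.fst
        (extChartAt (cotangentModel E) z₀ z) (ContinuousLinearMap.fst ℝ E (E →L[ℝ] ℝ) :) :=
      hasFDerivAt_fst.hasMFDerivAt
    exact tmap_eq_of_hasMFDerivAt
      (h3.comp z (hasMFDerivAt_tmap (mdifferentiableAt_extChartAt_of_mem hz')))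
  rw [← h1, ← h2]
  refine tmap_congr ?_
  filter_upwards [extChartAt_source_mem_nhds' (I := cotangentModel E)
    (mem_extChartAt_source_cotangent.2 hz)] with y hy
  rw [extChartAt_cotangent (mem_extChartAt_source_cotangent.1 hy)]

theorem projT_frame {z₀ z : CotangentBundle E M}
    (hz : z.proj ∈ (extChartAt 𝓘(ℝ, E) z₀.proj).source) (u : E × (E →L[ℝ] ℝ)) :
    projT z (frame (cotangentModel E) z₀ z u) = frame 𝓘(ℝ, E) z₀.proj z.proj u.1 := by
  have h := congrArg (fun T : E × (E →L[ℝ] ℝ) →L[ℝ] E =>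
    frame 𝓘(ℝ, E) z₀.proj z.proj (T (frame (cotangentModel E) z₀ z u))) (coframe_comp_projT hz)
  simp only [ContinuousLinearMap.comp_apply] at h
  rw [frame_coframe hz, coframe_frame (mem_extChartAt_source_cotangent.2 hz)] at h
  exact h

theorem projT_self (z : CotangentBundle E M) :
    projT z = ContinuousLinearMap.fst ℝ E (E →L[ℝ] ℝ) := by
  have h := coframe_comp_projT (z₀ := z) (z := z) (mem_extChartAt_source _)
  rwa [coframe_self, coframe_self, ContinuousLinearMap.id_comp, ContinuousLinearMap.comp_id] at h

/-- The canonical one-form, between the model spaces. -/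
def liouville (z : CotangentBundle E M) : E × (E →L[ℝ] ℝ) →L[ℝ] ℝ :=
  (cov z).comp (projT z)

theorem canonicalTwoForm_eq_extD (z : CotangentBundle E M) (u w : E × (E →L[ℝ] ℝ)) :
    canonicalTwoForm z u w = - extD (cotangentModel E) liouville z u w := rfl

/-- The coordinate formula `Θ = p dq`: the frame cancels against the one that defines the fibre
coordinate `p`. -/
theorem formInChart_liouville {z₀ : CotangentBundle E M} {y : E × (E →L[ℝ] ℝ)}
    (hy : y ∈ (extChartAt (cotangentModel E) z₀).target) :
    formInChart (cotangentModel E) liouville z₀ y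
      = y.2.comp (ContinuousLinearMap.fst ℝ E (E →L[ℝ] ℝ)) := by
  rw [formInChart_eq _ hy]
  have hs := (extChartAt (cotangentModel E) z₀).map_target hy
  have hs' := mem_extChartAt_source_cotangent.1 hs
  have h := (extChartAt (cotangentModel E) z₀).right_inv hy
  rw [extChartAt_cotangent hs'] at h
  refine ContinuousLinearMap.ext fun u => ?_
  simp only [liouville, ContinuousLinearMap.comp_apply, projT_frame hs']
  conv_rhs => rw [← h]
  rfl

theorem contDiffAt_formInChart_liouville {z₀ : CotangentBundle E M} {y : E × (E →L[ℝ] ℝ)}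
    (hy : y ∈ (extChartAt (cotangentModel E) z₀).target) :
    ContDiffAt ℝ ∞ (formInChart (cotangentModel E) liouville z₀) y := by
  have h : ContDiffAt ℝ ∞ (fun y : E × (E →L[ℝ] ℝ) =>
      y.2.comp (ContinuousLinearMap.fst ℝ E (E →L[ℝ] ℝ))) y := by fun_prop
  refine h.congr_of_eventuallyEq ?_
  filter_upwards [(isOpen_extChartAt_target (I := cotangentModel E) z₀).mem_nhds hy] with y hy
  exact formInChart_liouville hy

theorem differentiableAt_formInChart_liouville (z : CotangentBundle E M) :
    DifferentiableAt ℝ (formInChart (cotangentModel E) liouville z)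
      (extChartAt (cotangentModel E) z z) :=
  (contDiffAt_formInChart_liouville (mem_extChartAt_target z)).differentiableAt (by simp)

set_option synthInstance.maxHeartbeats 400000 in
/-- The canonical symplectic form is constant in the canonical charts of `T*M`. -/
theorem canonicalTwoForm_frame {z₀ z : CotangentBundle E M}
    (hz : z.proj ∈ (extChartAt 𝓘(ℝ, E) z₀.proj).source) (u w : E × (E →L[ℝ] ℝ)) :
    canonicalTwoForm z (frame (cotangentModel E) z₀ z u) (frame (cotangentModel E) z₀ z w)
      = w.2 u.1 - u.2 w.1 := by
  rw [canonicalTwoForm_eq_extD]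
  have hs := mem_extChartAt_source_cotangent.2 hz
  have hy := (extChartAt (cotangentModel E) z₀).map_source hs
  rw [extD_frame hs (differentiableAt_formInChart_liouville z)]
  have hev : formInChart (cotangentModel E) liouville z₀
      =ᶠ[𝓝 (extChartAt (cotangentModel E) z₀ z)]
      fun y => y.2.comp (ContinuousLinearMap.fst ℝ E (E →L[ℝ] ℝ)) := by
    filter_upwards [(isOpen_extChartAt_target (I := cotangentModel E) z₀).mem_nhds hy] with y hy
    exact formInChart_liouville hy
  rw [hev.fderiv_eq]
  have hd : HasFDerivAt (fun y : E × (E →L[ℝ] ℝ) =>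
      y.2.comp (ContinuousLinearMap.fst ℝ E (E →L[ℝ] ℝ))) _
      (extChartAt (cotangentModel E) z₀ z) :=
    (hasFDerivAt_snd).clm_comp (hasFDerivAt_const (ContinuousLinearMap.fst ℝ E (E →L[ℝ] ℝ)) _)
  rw [HasFDerivAt.fderiv hd]
  -- The vanishing term is the product-rule contribution of the constant factor
  -- `ContinuousLinearMap.fst`.
  have h0 : ∀ a b : E × (E →L[ℝ] ℝ),
      ((extChartAt (cotangentModel E) z₀ z).2) ((0 : E × (E →L[ℝ] ℝ) →L[ℝ] E) b) + a.2 b.1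
        = a.2 b.1 := by intro a b; simp
  refine (congrArg Neg.neg (congrArg₂ (· - ·) (h0 u w) (h0 w u))).trans ?_
  ring

theorem contMDiffAt_cotangentBundle_iff {EN : Type*} [NormedAddCommGroup EN] [NormedSpace ℝ EN]
    {HN : Type*} [TopologicalSpace HN] {J : ModelWithCorners ℝ EN HN}
    {N : Type*} [TopologicalSpace N] [ChartedSpace HN N] {f : N → CotangentBundle E M} {n₀ : N} :
    ContMDiffAt J (cotangentModel E) ∞ f n₀ ↔
      ContMDiffAt J 𝓘(ℝ, E) ∞ (fun n => (f n).proj) n₀ ∧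
      ContMDiffAt J 𝓘(ℝ, E →L[ℝ] ℝ) ∞
        (fun n => (cov (f n)).comp (frame 𝓘(ℝ, E) (f n₀).proj (f n).proj)) n₀ :=
  contMDiffAt_oneForm_iff

end CotangentCharts

end Nonholonomic

/-! ### Infinitesimal generators of a free action. -/

namespace Nonholonomic

section FreeAction

variable {E : Type*} [NormedAddCommGroup E] [NormedSpace ℝ E]
  {EG : Type*} [NormedAddCommGroup EG] [NormedSpace ℝ EG]
  {Q : Type*} [TopologicalSpace Q] [ChartedSpace E Q]
  {G : Type*} [TopologicalSpace G] [ChartedSpace EG G] [Group G] [MulAction G Q]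

theorem eventually_eq_of_mfderiv_eq_zero [IsManifold 𝓘(ℝ, E) ∞ Q] {c : ℝ → Q} {t₀ : ℝ}
    (hc : ∀ᶠ t in 𝓝 t₀, HasMFDerivAt 𝓘(ℝ, ℝ) 𝓘(ℝ, E) c t (0 : ℝ →L[ℝ] E)) :
    ∀ᶠ t in 𝓝 t₀, c t = c t₀ := by
  have hcont : ContinuousAt c t₀ := hc.self_of_nhds.continuousAt
  have hs := hcont (extChartAt_source_mem_nhds (I := 𝓘(ℝ, E)) (c t₀))
  obtain ⟨ε, hε, hball⟩ := Metric.eventually_nhds_iff_ball.1 (hc.and hs)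
  have hd : ∀ t ∈ Metric.ball t₀ ε,
      HasFDerivAt (fun t => extChartAt 𝓘(ℝ, E) (c t₀) (c t)) (0 : ℝ →L[ℝ] E) t := by
    intro t ht
    have h1 := hasMFDerivAt_tmap (mdifferentiableAt_extChartAt_of_mem (hball t ht).2)
    have h2 := h1.comp t (hball t ht).1
    have h3 : HasMFDerivAt 𝓘(ℝ, ℝ) 𝓘(ℝ, E) (fun t => extChartAt 𝓘(ℝ, E) (c t₀) (c t)) t
      (0 : ℝ →L[ℝ] E) := by
      have h4 : (tmap 𝓘(ℝ, E) 𝓘(ℝ, E) (extChartAt 𝓘(ℝ, E) (c t₀)) (c t)).comp (0 : ℝ →L[ℝ] E)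
        = 0 := ContinuousLinearMap.comp_zero _
      rw [← h4]
      exact h2
    exact hasMFDerivAt_iff_hasFDerivAt.1 h3
  filter_upwards [Metric.ball_mem_nhds t₀ hε] with t ht
  have h := (convex_ball t₀ ε).is_const_of_fderivWithin_eq_zero
    (f := fun t => extChartAt 𝓘(ℝ, E) (c t₀) (c t)) (𝕜 := ℝ)
    (fun t ht => (hd t ht).differentiableAt.differentiableWithinAt)
    (fun t ht => by
      rw [fderivWithin_of_isOpen Metric.isOpen_ball ht, (hd t ht).fderiv]) ht
    (Metric.mem_ball_self hε)
  exact (extChartAt 𝓘(ℝ, E) (c t₀)).injOn (hball t ht).2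
    (mem_extChartAt_source (I := 𝓘(ℝ, E)) _) h

variable [LieGroup 𝓘(ℝ, EG) ∞ G] [ContMDiffSMul 𝓘(ℝ, EG) 𝓘(ℝ, E) ∞ G Q]

theorem contMDiff_smul_left (E EG : Type*) [NormedAddCommGroup E] [NormedSpace ℝ E]
    [NormedAddCommGroup EG] [NormedSpace ℝ EG] {Q : Type*} [TopologicalSpace Q] [ChartedSpace E Q]
    {G : Type*} [TopologicalSpace G] [ChartedSpace EG G] [Group G] [MulAction G Q]
    [ContMDiffSMul 𝓘(ℝ, EG) 𝓘(ℝ, E) ∞ G Q] (g : G) :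
    ContMDiff 𝓘(ℝ, E) 𝓘(ℝ, E) ∞ (fun q : Q => g • q) :=
  (contMDiff_smul (I := 𝓘(ℝ, EG)) (I' := 𝓘(ℝ, E)) (n := ∞) (G := G) (M := Q)).comp
    (contMDiff_const.prodMk contMDiff_id)

variable (E EG G) in
theorem contMDiff_orbit (q : Q) : ContMDiff 𝓘(ℝ, EG) 𝓘(ℝ, E) ∞ (fun g : G => g • q) :=
  (contMDiff_smul (I := 𝓘(ℝ, EG)) (I' := 𝓘(ℝ, E)) (n := ∞) (G := G) (M := Q)).comp
    (contMDiff_id.prodMk contMDiff_const)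

variable (E EG G) in
/-- The infinitesimal generator, between the model spaces. -/
def gen (q : Q) : EG →L[ℝ] E := tmap 𝓘(ℝ, EG) 𝓘(ℝ, E) (fun g : G => g • q) 1

variable [FiniteDimensional ℝ EG] [IsManifold 𝓘(ℝ, E) ∞ Q]

variable (E EG G) in
/-- The infinitesimal generators of a free action vanish nowhere. -/
theorem gen_injective [IsCancelSMul G Q] (q : Q) : Injective (gen E EG G q) := by
  have : LieGroup 𝓘(ℝ, EG) (minSmoothness ℝ 3) G := 
    LieGroup.of_le (n := ∞) (by simpa using WithTop.coe_le_coe.2 (le_top (a := (3 : ℕ∞))))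
  have := FiniteDimensional.complete ℝ EG
  rw [injective_iff_map_eq_zero]
  intro ξ hξ
  -- An integral curve through `1` of the left-invariant field of `ξ` plays the role of the
  -- one-parameter subgroup; only small times are needed.
  let v : ∀ g : G, TangentSpace 𝓘(ℝ, EG) g := mulInvariantVectorField (I := 𝓘(ℝ, EG)) ξ
  have hv : ContMDiffAt 𝓘(ℝ, EG) 𝓘(ℝ, EG).tangent 1
      (fun g : G => (⟨g, v g⟩ : TangentBundle 𝓘(ℝ, EG) G)) 1 :=
    (contMDiff_mulInvariantVectorField ξ 1).of_le (by simp)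
  obtain ⟨γ, hγ0, hγ⟩ := exists_isMIntegralCurveAt_of_contMDiffAt_boundaryless 0 hv
  have hvg : ∀ g : G, v g = tmap 𝓘(ℝ, EG) 𝓘(ℝ, EG) (fun h : G => g * h) 1 ξ := fun g => rfl
  have hmul : ∀ g h : G, MDifferentiableAt 𝓘(ℝ, EG) 𝓘(ℝ, EG) (fun h : G => g * h) h :=
    fun g h => (contMDiff_mul_left (I := 𝓘(ℝ, EG)) (n := ∞) (a := g)).mdifferentiable (by simp) h
  -- Because `(g h) q = g (h q)`, the orbit map sends the left-invariant field at `g` to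
  -- `TΦ_g(ξ_Q(q))`, which is zero as soon as `ξ_Q(q) = 0`.
  have hov : ∀ g : G, tmap 𝓘(ℝ, EG) 𝓘(ℝ, E) (fun g : G => g • q) g
      (tmap 𝓘(ℝ, EG) 𝓘(ℝ, EG) (fun h : G => g * h) 1 ξ) = 0 := by
    intro g
    have h1 := tmap_comp (F := fun g : G => g • q) (F' := fun h : G => g * h) (l := 1)
      (I := 𝓘(ℝ, E)) (J := 𝓘(ℝ, EG)) (K := 𝓘(ℝ, EG))
      ((contMDiff_orbit E EG G q).mdifferentiable (by simp) _) (hmul g 1)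
    have h2 := tmap_comp (F := fun x : Q => g • x) (F' := fun h : G => h • q) (l := 1)
      (I := 𝓘(ℝ, E)) (J := 𝓘(ℝ, E)) (K := 𝓘(ℝ, EG))
      ((contMDiff_smul_left E EG g).mdifferentiable (by simp) _)
      ((contMDiff_orbit E EG G q).mdifferentiable (by simp) _)
    simp only [mul_smul] at h1
    have h3 := congrArg (fun T : EG →L[ℝ] E => T ξ) (h1.symm.trans h2)
    simp only [ContinuousLinearMap.comp_apply] at h3
    rw [mul_one] at h3
    rw [h3]
    change tmap 𝓘(ℝ, E) 𝓘(ℝ, E) (fun x : Q => g • x) _ (gen E EG G q ξ) = 0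
    rw [hξ, map_zero]
  have hc : ∀ᶠ t in 𝓝 (0 : ℝ),
      HasMFDerivAt 𝓘(ℝ, ℝ) 𝓘(ℝ, E) (fun t => γ t • q) t (0 : ℝ →L[ℝ] E) := by
    filter_upwards [hγ] with t ht
    have h1 := hasMFDerivAt_tmap ((contMDiff_orbit E EG G q).mdifferentiable (by simp) (γ t))
    have h2 := h1.comp t ht
    have h4 : (tmap 𝓘(ℝ, EG) 𝓘(ℝ, E) (fun g : G => g • q) (γ t)).comp
        ((1 : ℝ →L[ℝ] ℝ).smulRight
          (tmap 𝓘(ℝ, EG) 𝓘(ℝ, EG) (fun h : G => γ t * h) 1 ξ)) = 0 := by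
      ext
      simp [hov]
    rw [← h4]
    exact h2
  -- The curve `γ t • q` has zero velocity, hence is locally constant. Freeness transfers this to
  -- `γ`, whose initial velocity `ξ` must then vanish.
  have hconst : γ =ᶠ[𝓝 0] fun _ => 1 := by
    filter_upwards [eventually_eq_of_mfderiv_eq_zero hc] with t ht
    rw [hγ0] at ht
    exact IsCancelSMul.right_cancel _ _ q ht
  have h0 := hγ.self_of_nhds
  have h1 : HasMFDerivAt 𝓘(ℝ, ℝ) 𝓘(ℝ, EG) γ 0 (0 : ℝ →L[ℝ] EG) :=
    (hasMFDerivAt_const (1 : G) (0 : ℝ)).congr_of_eventuallyEq hconst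
  have h2 : (1 : ℝ →L[ℝ] ℝ).smulRight
      (tmap 𝓘(ℝ, EG) 𝓘(ℝ, EG) (fun h : G => γ 0 * h) 1 ξ) = (0 : ℝ →L[ℝ] EG) :=
    hasMFDerivAt_unique h0 h1
  have h3 := congrArg (fun T : ℝ →L[ℝ] EG => T 1) h2
  simp only [hγ0, one_mul, tmap_id] at h3
  simpa using h3

end FreeAction

end Nonholonomic

/-! ### Local sections of submersions with prescribed derivative. -/

namespace Nonholonomic

section Submersion

variable {E : Type*} [NormedAddCommGroup E] [NormedSpace ℝ E]
  {EB : Type*} [NormedAddCommGroup EB] [NormedSpace ℝ EB]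
  {Q : Type*} [TopologicalSpace Q] [ChartedSpace E Q] [IsManifold 𝓘(ℝ, E) ∞ Q]
  {X : Type*} [TopologicalSpace X] [ChartedSpace EB X] [IsManifold 𝓘(ℝ, EB) ∞ X]

/-- Charts of `Q` and `X` in which `p : Q → X` is a linear projection. -/
structure SubmersionChart (E EB F : Type*) [NormedAddCommGroup E] [NormedSpace ℝ E]
    [NormedAddCommGroup EB] [NormedSpace ℝ EB] [NormedAddCommGroup F] [NormedSpace ℝ F]
    {Q : Type*} [TopologicalSpace Q] [ChartedSpace E Q]
    {X : Type*} [TopologicalSpace X] [ChartedSpace EB X] (p : Q → X) (q : Q) where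
  /-- The chart of the source. -/
  dom : OpenPartialHomeomorph Q (EB × F)
  /-- The chart of the target. -/
  cod : OpenPartialHomeomorph X EB
  mem_dom : q ∈ dom.source
  mem_cod : p q ∈ cod.source
  dom_smooth : ∀ x ∈ dom.source, ContMDiffAt 𝓘(ℝ, E) 𝓘(ℝ, EB × F) ∞ dom x
  symm_smooth : ∀ y ∈ dom.target, ContMDiffAt 𝓘(ℝ, EB × F) 𝓘(ℝ, E) ∞ dom.symm y
  cod_smooth : ∀ x ∈ cod.source, ContMDiffAt 𝓘(ℝ, EB) 𝓘(ℝ, EB) ∞ cod x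
  mapsTo : ∀ x ∈ dom.source, p x ∈ cod.source
  eq_fst : ∀ x ∈ dom.source, cod (p x) = (dom x).1

theorem exists_submersionChart {p : Q → X} {q : Q}
    (h : Manifold.IsSubmersionAt 𝓘(ℝ, E) 𝓘(ℝ, EB) ∞ p q) :
    Nonempty (SubmersionChart E EB h.complement p q) := by
  have hd : ∀ x ∈ h.domChart.source, ContMDiffAt 𝓘(ℝ, E) 𝓘(ℝ, E) ∞ h.domChart x := fun x hx =>
    contMDiffAt_of_mem_maximalAtlas h.domChart_mem_maximalAtlas hx
  refine ⟨⟨h.domChart.transHomeomorph h.equiv.toHomeomorph, h.codChart, h.mem_domChart_source,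
    h.mem_codChart_source, fun x hx => ?_, fun y hy => ?_, fun x hx =>
    contMDiffAt_of_mem_maximalAtlas h.codChart_mem_maximalAtlas hx,
    fun x hx => h.source_subset_preimage_source hx, fun x hx => ?_⟩⟩
  · exact (h.equiv : E →L[ℝ] EB × h.complement).contMDiff.contMDiffAt.comp x (hd x hx)
  · exact (contMDiffAt_symm_of_mem_maximalAtlas h.domChart_mem_maximalAtlas hy).comp y
      (h.equiv.symm : EB × h.complement →L[ℝ] E).contMDiff.contMDiffAt
  · have hy := h.domChart.map_source hx
    have hm : h.domChart x ∈ (h.domChart.extend 𝓘(ℝ, E)).target := by simpa using hy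
    have := h.writtenInCharts hm
    have hl := h.domChart.left_inv hx
    change h.codChart (p (h.domChart.symm (h.domChart x))) = (h.equiv (h.domChart x)).1 at this
    rw [hl] at this
    exact this

/-- In charts where `p` is a linear projection, an affine graph over the base is a section. Its
slope `B` is left free so that the derivative at `p q` can be adjusted afterwards. -/
theorem exists_local_section_aux {F : Type*} [NormedAddCommGroup F] [NormedSpace ℝ F] {p : Q → X}
    {q : Q} (c : SubmersionChart E EB F p q) (B : EB →L[ℝ] F) :
    ∃ σ : X → Q, σ (p q) = q ∧ ContMDiffAt 𝓘(ℝ, EB) 𝓘(ℝ, E) ∞ σ (p q) ∧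
      (∀ᶠ x in 𝓝 (p q), p (σ x) = x) ∧
      (tmap 𝓘(ℝ, E) 𝓘(ℝ, EB × F) c.dom q).comp (tmap 𝓘(ℝ, EB) 𝓘(ℝ, E) σ (p q))
        = ((ContinuousLinearMap.id ℝ EB).prod B).comp
          (tmap 𝓘(ℝ, EB) 𝓘(ℝ, EB) c.cod (p q)) := by
  let ζ : X → EB × F := fun x => (c.cod x, (c.dom q).2 + B (c.cod x - c.cod (p q)))
  have hζq : ζ (p q) = c.dom q := by
    simp only [ζ, sub_self, map_zero, add_zero, c.eq_fst q c.mem_dom]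
  have hcod := c.cod_smooth _ c.mem_cod
  have hζ : HasMFDerivAt 𝓘(ℝ, EB) 𝓘(ℝ, EB × F) ζ (p q)
      (((ContinuousLinearMap.id ℝ EB).prod B).comp (tmap 𝓘(ℝ, EB) 𝓘(ℝ, EB) c.cod (p q)) :) := by
    have h1 : HasFDerivAt (fun y : EB => (y, (c.dom q).2 + B (y - c.cod (p q))))
        ((ContinuousLinearMap.id ℝ EB).prod B) (c.cod (p q)) :=
      (hasFDerivAt_id _).prodMk
        ((B.hasFDerivAt.comp _ ((hasFDerivAt_id _).sub_const _)).const_add _)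
    exact h1.hasMFDerivAt.comp (p q) (hasMFDerivAt_tmap (hcod.mdifferentiableAt (by simp)))
  have hζsm : ContMDiffAt 𝓘(ℝ, EB) 𝓘(ℝ, EB × F) ∞ ζ (p q) := by
    have h1 : ContMDiff 𝓘(ℝ, EB) 𝓘(ℝ, EB × F) ∞
        (fun y : EB => (y, (c.dom q).2 + B (y - c.cod (p q)))) := by
      rw [contMDiff_iff_contDiff]; fun_prop
    exact h1.contMDiffAt.comp (p q) hcod
  have hmem : ∀ᶠ x in 𝓝 (p q), ζ x ∈ c.dom.target := hζsm.continuousAt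
    (c.dom.open_target.mem_nhds (hζq ▸ c.dom.map_source c.mem_dom))
  have hσ : ContMDiffAt 𝓘(ℝ, EB) 𝓘(ℝ, E) ∞ (fun x => c.dom.symm (ζ x)) (p q) :=
    (c.symm_smooth _ (hζq ▸ c.dom.map_source c.mem_dom)).comp (p q) hζsm
  have hσq : c.dom.symm (ζ (p q)) = q := by rw [hζq, c.dom.left_inv c.mem_dom]
  refine ⟨fun x => c.dom.symm (ζ x), hσq, hσ, ?_, ?_⟩
  · filter_upwards [hmem, c.cod.open_source.mem_nhds c.mem_cod] with x hx hx'
    have hs := c.dom.map_target hx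
    refine c.cod.injOn (c.mapsTo _ hs) hx' ?_
    rw [c.eq_fst _ hs, c.dom.right_inv hx]
  · have h2 := tmap_comp (F := c.dom) (F' := fun x => c.dom.symm (ζ x)) (l := p q)
      (I := 𝓘(ℝ, EB × F)) (J := 𝓘(ℝ, E)) (K := 𝓘(ℝ, EB))
      (by rw [hσq]; exact (c.dom_smooth q c.mem_dom).mdifferentiableAt (by simp))
      (hσ.mdifferentiableAt (by simp))
    rw [hσq] at h2
    rw [← h2, ← tmap_eq_of_hasMFDerivAt hζ]
    refine tmap_congr (hmem.mono fun x hx => ?_)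
    exact c.dom.right_inv hx

theorem SubmersionChart.injective_tmap_dom {F : Type*} [NormedAddCommGroup F] [NormedSpace ℝ F]
    {p : Q → X} {q : Q} (c : SubmersionChart E EB F p q) :
    Injective (tmap 𝓘(ℝ, E) 𝓘(ℝ, EB × F) c.dom q) := by
  have h := tmap_comp (F := c.dom.symm) (F' := c.dom) (l := q)
    (I := 𝓘(ℝ, E)) (J := 𝓘(ℝ, EB × F)) (K := 𝓘(ℝ, E))
    ((c.symm_smooth _ (c.dom.map_source c.mem_dom)).mdifferentiableAt (by simp))
    ((c.dom_smooth q c.mem_dom).mdifferentiableAt (by simp))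
  have h2 : tmap 𝓘(ℝ, E) 𝓘(ℝ, E) (fun x => c.dom.symm (c.dom x)) q
      = ContinuousLinearMap.id ℝ E := by
    rw [← tmap_id (J := 𝓘(ℝ, E)) q]
    refine tmap_congr ?_
    filter_upwards [c.dom.open_source.mem_nhds c.mem_dom] with x hx
    exact c.dom.left_inv hx
  rw [h2] at h
  intro u v huv
  have h3 := congrArg (fun T : E →L[ℝ] E => T u) h
  have h4 := congrArg (fun T : E →L[ℝ] E => T v) h
  simp only [ContinuousLinearMap.comp_apply] at h3 h4
  rw [huv, ← h4] at h3
  exact h3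

theorem SubmersionChart.cod_comp {F : Type*} [NormedAddCommGroup F] [NormedSpace ℝ F]
    {p : Q → X} {q : Q} (c : SubmersionChart E EB F p q)
    (hp : MDifferentiableAt 𝓘(ℝ, E) 𝓘(ℝ, EB) p q) :
    (tmap 𝓘(ℝ, EB) 𝓘(ℝ, EB) c.cod (p q)).comp (tmap 𝓘(ℝ, E) 𝓘(ℝ, EB) p q)
      = (ContinuousLinearMap.fst ℝ EB F).comp (tmap 𝓘(ℝ, E) 𝓘(ℝ, EB × F) c.dom q) := by
  rw [← tmap_comp ((c.cod_smooth _ c.mem_cod).mdifferentiableAt (by simp)) hp]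
  have h3 : HasMFDerivAt 𝓘(ℝ, EB × F) 𝓘(ℝ, EB) Prod.fst
      (c.dom q) (ContinuousLinearMap.fst ℝ EB F :) := hasFDerivAt_fst.hasMFDerivAt
  refine Eq.trans (tmap_congr ?_) (tmap_eq_of_hasMFDerivAt (h3.comp q
    (hasMFDerivAt_tmap ((c.dom_smooth q c.mem_dom).mdifferentiableAt (by simp)))))
  filter_upwards [c.dom.open_source.mem_nhds c.mem_dom] with x hx
  exact c.eq_fst x hx

theorem tmap_section {p : Q → X} {q : Q} {σ : X → Q}
    (hp : MDifferentiableAt 𝓘(ℝ, E) 𝓘(ℝ, EB) p q) (hσq : σ (p q) = q)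
    (hσ : MDifferentiableAt 𝓘(ℝ, EB) 𝓘(ℝ, E) σ (p q)) (h : ∀ᶠ x in 𝓝 (p q), p (σ x) = x) :
    (tmap 𝓘(ℝ, E) 𝓘(ℝ, EB) p q).comp (tmap 𝓘(ℝ, EB) 𝓘(ℝ, E) σ (p q))
      = ContinuousLinearMap.id ℝ EB := by
  have h2 := tmap_comp (F := p) (F' := σ) (l := p q)
    (I := 𝓘(ℝ, EB)) (J := 𝓘(ℝ, E)) (K := 𝓘(ℝ, EB)) (by rwa [hσq]) hσ
  rw [hσq] at h2
  rw [← h2, ← tmap_id (J := 𝓘(ℝ, EB)) (p q)]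
  exact tmap_congr h

/-- A submersion has a local section whose derivative is any given right inverse of the
derivative of the submersion. -/
theorem exists_local_section {p : Q → X} {q : Q}
    (h : Manifold.IsSubmersionAt 𝓘(ℝ, E) 𝓘(ℝ, EB) ∞ p q) {s : EB →L[ℝ] E}
    (hs : (tmap 𝓘(ℝ, E) 𝓘(ℝ, EB) p q).comp s = ContinuousLinearMap.id ℝ EB) :
    ∃ σ : X → Q, σ (p q) = q ∧ ContMDiffAt 𝓘(ℝ, EB) 𝓘(ℝ, E) ∞ σ (p q) ∧
      (∀ᶠ x in 𝓝 (p q), p (σ x) = x) ∧ tmap 𝓘(ℝ, EB) 𝓘(ℝ, E) σ (p q) = s := by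
  obtain ⟨c⟩ := exists_submersionChart h
  have hp : MDifferentiableAt 𝓘(ℝ, E) 𝓘(ℝ, EB) p q := h.contMDiffAt.mdifferentiableAt (by simp)
  -- The flat section, of slope `0`, serves only to prove `C` injective: its derivative is
  -- injective, being a right inverse of `P`, and `D` carries it to `(C, 0)`.
  obtain ⟨σ₀, h1, h2, h3, h4⟩ := exists_local_section_aux c 0
  -- the derivative of the chart of the target is invertible
  have hT := tmap_section hp h1 (h2.mdifferentiableAt (by simp)) h3
  have hC := c.cod_comp hp
  set P := tmap 𝓘(ℝ, E) 𝓘(ℝ, EB) p q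
  set C := tmap 𝓘(ℝ, EB) 𝓘(ℝ, EB) c.cod (p q)
  set D := tmap 𝓘(ℝ, E) 𝓘(ℝ, EB × h.complement) c.dom q with hD
  have hDsurj : ∃ D' : EB × h.complement →L[ℝ] E, D.comp D' = ContinuousLinearMap.id ℝ _ := by
    refine ⟨tmap 𝓘(ℝ, EB × h.complement) 𝓘(ℝ, E) c.dom.symm (c.dom q), ?_⟩
    have h5 := tmap_comp (F := c.dom) (F' := c.dom.symm) (l := c.dom q)
      (I := 𝓘(ℝ, EB × h.complement)) (J := 𝓘(ℝ, E)) (K := 𝓘(ℝ, EB × h.complement))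
      (by rw [c.dom.left_inv c.mem_dom]
          exact (c.dom_smooth q c.mem_dom).mdifferentiableAt (by simp))
      ((c.symm_smooth _ (c.dom.map_source c.mem_dom)).mdifferentiableAt (by simp))
    rw [c.dom.left_inv c.mem_dom] at h5
    rw [hD, ← h5, ← tmap_id (J := 𝓘(ℝ, EB × h.complement)) (c.dom q)]
    refine tmap_congr ?_
    filter_upwards [c.dom.open_target.mem_nhds (c.dom.map_source c.mem_dom)] with x hx
    exact c.dom.right_inv hx
  obtain ⟨D', hD'⟩ := hDsurj
  -- Since `C ∘ P = fst ∘ D`, lifting a vector of the base through `D'` and projecting by `P`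
  -- inverts `C` on the right.
  let C' : EB →L[ℝ] EB := P.comp (D'.comp (ContinuousLinearMap.inl ℝ EB h.complement))
  have hCC' : C.comp C' = ContinuousLinearMap.id ℝ EB := by
    have : C.comp C' = (C.comp P).comp (D'.comp (ContinuousLinearMap.inl ℝ EB h.complement)) :=
      rfl
    rw [this, hC]
    ext v
    have h6 := congrArg (fun T : (EB × h.complement) →L[ℝ] (EB × h.complement) => T (v, 0)) hD'
    simp only [ContinuousLinearMap.comp_apply, ContinuousLinearMap.id_apply] at h6
    simp [h6]
  have hC'C : C'.comp C = ContinuousLinearMap.id ℝ EB := by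
    have hinj : Injective C := by
      intro u v huv
      have h5 : ∀ u, D (tmap 𝓘(ℝ, EB) 𝓘(ℝ, E) σ₀ (p q) u) = (C u, 0) := by
        intro u
        have h6 := congrArg (fun T : EB →L[ℝ] EB × h.complement => T u) h4
        simp only [ContinuousLinearMap.comp_apply] at h6
        rw [h6]
        rfl
      have hDD : D (tmap 𝓘(ℝ, EB) 𝓘(ℝ, E) σ₀ (p q) u) = D (tmap 𝓘(ℝ, EB) 𝓘(ℝ, E) σ₀ (p q) v) := by
        rw [h5, h5, huv]
      have h7 := c.injective_tmap_dom hDD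
      have h8 := congrArg (fun T : EB →L[ℝ] EB => T u) hT
      have h9 := congrArg (fun T : EB →L[ℝ] EB => T v) hT
      simp only [ContinuousLinearMap.comp_apply] at h8 h9
      rw [h7, h9] at h8
      exact h8.symm
    ext u
    exact hinj (congrArg (fun T : EB →L[ℝ] EB => T (C u)) hCC')
  -- The slope is chosen so that `D ∘ Tσ = (C, B ∘ C)` has second component `snd ∘ D ∘ s`. The first
  -- components of `D ∘ Tσ` and `D ∘ s` agree automatically, and `D` is injective.
  obtain ⟨σ, h5, h6, h7, h8⟩ := exists_local_section_aux c
    (((ContinuousLinearMap.snd ℝ EB h.complement).comp (D.comp s)).comp C')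
  refine ⟨σ, h5, h6, h7, ?_⟩
  ext u
  apply c.injective_tmap_dom
  have h9 := congrArg (fun T : EB →L[ℝ] EB × h.complement => T u) h8
  refine h9.trans ?_
  have h10 := congrArg (fun T : EB →L[ℝ] EB => T u) hC'C
  have h11 := congrArg (fun T : E →L[ℝ] EB => T (s u)) hC
  have h12 := congrArg (fun T : EB →L[ℝ] EB => T u) hs
  simp only [ContinuousLinearMap.comp_apply, ContinuousLinearMap.id_apply] at h10 h11 h12
  rw [h12] at h11
  refine Prod.ext ?_ ?_
  · exact h11
  · change (D (s (C' (C u)))).2 = (D (s u)).2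
    rw [h10]

/-- The derivative of a submersion is surjective. -/
theorem tmap_surjective_of_isSubmersionAt {p : Q → X} {q : Q}
    (h : Manifold.IsSubmersionAt 𝓘(ℝ, E) 𝓘(ℝ, EB) ∞ p q) :
    Surjective (tmap 𝓘(ℝ, E) 𝓘(ℝ, EB) p q) := by
  obtain ⟨c⟩ := exists_submersionChart h
  obtain ⟨σ, h1, h2, h3, -⟩ := exists_local_section_aux c 0
  have := tmap_section (h.contMDiffAt.mdifferentiableAt (by simp)) h1
    (h2.mdifferentiableAt (by simp)) h3
  exact fun v => ⟨_, congrArg (fun T : EB →L[ℝ] EB => T v) this⟩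

end Submersion
end Nonholonomic

/-! ### The kernel of `Tπ` as the tangent space of the orbit. -/

namespace Nonholonomic

section Orbits

variable {E : Type*} [NormedAddCommGroup E] [NormedSpace ℝ E] [FiniteDimensional ℝ E]
  {EG : Type*} [NormedAddCommGroup EG] [NormedSpace ℝ EG] [FiniteDimensional ℝ EG]
  {EB : Type*} [NormedAddCommGroup EB] [NormedSpace ℝ EB] [FiniteDimensional ℝ EB]
  {Q : Type*} [TopologicalSpace Q] [ChartedSpace E Q] [IsManifold 𝓘(ℝ, E) ∞ Q]
  {G : Type*} [TopologicalSpace G] [ChartedSpace EG G] [Group G] [LieGroup 𝓘(ℝ, EG) ∞ G]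
  [MulAction G Q] [ContMDiffSMul 𝓘(ℝ, EG) 𝓘(ℝ, E) ∞ G Q] [IsCancelSMul G Q]
  [ChartedSpace EB (OrbitSpace G Q)] [IsManifold 𝓘(ℝ, EB) ∞ (OrbitSpace G Q)]

theorem orbitProj_smul {G Q : Type*} [Group G] [MulAction G Q] (g : G) (q : Q) :
    orbitProj G (g • q) = orbitProj G q :=
  Quotient.sound (s := MulAction.orbitRel G Q) (MulAction.mem_orbit q g)

theorem exists_smul_eq_of_orbitProj_eq {G Q : Type*} [Group G] [MulAction G Q] {q q' : Q}
    (h : orbitProj G q = orbitProj G q') : ∃ g : G, g • q = q' := by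
  have := Quotient.exact (s := MulAction.orbitRel G Q) h.symm
  exact this

/-- For a free and proper action, `g q → q` forces `g → 1`. -/
theorem comap_orbit_le_nhds_one {G Q : Type*} [TopologicalSpace G] [TopologicalSpace Q] [Group G]
    [MulAction G Q] [IsCancelSMul G Q] [ProperSMul G Q] (q : Q) :
    Filter.comap (fun g : G => g • q) (𝓝 q) ≤ 𝓝 1 := by
  rw [Filter.le_iff_ultrafilter]
  intro U hU
  have hp := isProperMap_iff_ultrafilter.1 (ProperSMul.isProperMap_smul_pair (G := G) (X := Q))
  have ht : Filter.Tendsto (fun g : G => g • q) U (𝓝 q) := Filter.tendsto_iff_comap.2 hU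
  -- Along the ultrafilter, `(g q, q)` converges to `(q, q)`. Properness makes `(g, q)` converge to
  -- some preimage of `(q, q)`, and freeness leaves `(1, q)` as the only one.
  obtain ⟨⟨g, x⟩, h1, h2⟩ := hp.2 (𝒰 := U.map (fun g : G => (g, q))) (y := (q, q)) (by
    rw [Ultrafilter.coe_map, Filter.tendsto_map'_iff]
    exact ht.prodMk_nhds tendsto_const_nhds)
  simp only [Prod.mk.injEq] at h1
  obtain ⟨h1, rfl⟩ := h1
  have hg : g = 1 := IsCancelSMul.right_cancel _ _ x (by rw [h1, one_smul])
  subst hg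
  rw [Ultrafilter.coe_map, nhds_prod_eq, ← Filter.Tendsto] at h2
  exact Filter.tendsto_fst.comp h2

-- In a submersion chart the fibre of `π` through `q` is an open piece of `F`, and it consists of
-- points of the orbit. By properness and freeness, a point `g q` of it close to `q` has `g` close
-- to `1`, so a single chart ball of `G` covers a neighbourhood in `F`. The covering map is `C¹` and
-- cannot raise Hausdorff dimension, which bounds `dim F` by `dim G`.
variable (EG) in
theorem finrank_complement_le [ProperSMul G Q] {F : Type*} [NormedAddCommGroup F] [NormedSpace ℝ F]
    [FiniteDimensional ℝ F] {q : Q}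
    (c : SubmersionChart E EB F (orbitProj G : Q → OrbitSpace G Q) q) :
    Module.finrank ℝ F ≤ Module.finrank ℝ EG := by
  let χ := extChartAt 𝓘(ℝ, EG) (1 : G)
  let a : G → F := fun g => (c.dom (g • q)).2
  -- the orbit map in charts is smooth near the identity
  have ha : ContMDiffAt 𝓘(ℝ, EG) 𝓘(ℝ, F) ∞ a 1 := by
    have h1 : ContMDiffAt 𝓘(ℝ, EG) 𝓘(ℝ, EB × F) ∞ (fun g : G => c.dom (g • q)) 1 := by
      refine ContMDiffAt.comp (I' := 𝓘(ℝ, E)) 1 ?_ (contMDiff_orbit E EG G q 1)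
      rw [one_smul]
      exact c.dom_smooth q c.mem_dom
    exact (ContinuousLinearMap.snd ℝ EB F).contMDiff.contMDiffAt.comp _ h1
  have hâ : ContDiffAt ℝ 1 (fun y => a (χ.symm y)) (χ 1) := by
    rw [← contMDiffAt_iff_contDiffAt]
    refine ContMDiffAt.of_le (n := ∞) ?_ (by simp)
    have h2 : ContMDiffAt 𝓘(ℝ, EG) 𝓘(ℝ, EG) ∞ χ.symm (χ 1) :=
      contMDiffAt_extChartAt_symm_of_mem (mem_extChartAt_target 1)
    have h3 : ContMDiffAt 𝓘(ℝ, EG) 𝓘(ℝ, F) ∞ a (χ.symm (χ 1)) := by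
      rw [extChartAt_to_inv]
      exact ha
    exact h3.comp (χ 1) h2
  obtain ⟨u, hu, hau⟩ := hâ.contDiffOn (m := 1) le_rfl (by simp)
  obtain ⟨ε, hε, hball⟩ := Metric.mem_nhds_iff.1 hu
  -- a neighbourhood of the identity covers a neighbourhood of `q` in the fibre
  have hN : χ ⁻¹' Metric.ball (χ 1) ε ∩ χ.source ∈ 𝓝 (1 : G) :=
    Filter.inter_mem (continuousAt_extChartAt (I := 𝓘(ℝ, EG)) (1 : G)
      (Metric.ball_mem_nhds _ hε)) (extChartAt_source_mem_nhds (I := 𝓘(ℝ, EG)) (1 : G))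
  obtain ⟨W, hW, hWN⟩ := Filter.mem_comap.1 (comap_orbit_le_nhds_one q hN)
  let ψ : F → Q := fun v => c.dom.symm ((c.dom q).1, v)
  have hψq : ψ (c.dom q).2 = q := c.dom.left_inv c.mem_dom
  have hpt : ((c.dom q).1, (c.dom q).2) ∈ c.dom.target := c.dom.map_source c.mem_dom
  have hcont : Filter.Tendsto (fun v : F => ((c.dom q).1, v)) (𝓝 (c.dom q).2)
      (𝓝 ((c.dom q).1, (c.dom q).2)) :=
    (by fun_prop : Continuous fun v : F => ((c.dom q).1, v)).tendsto _
  have hψt : ∀ᶠ v in 𝓝 (c.dom q).2, ((c.dom q).1, v) ∈ c.dom.target :=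
    hcont (c.dom.open_target.mem_nhds hpt)
  have hψW : ∀ᶠ v in 𝓝 (c.dom q).2, ψ v ∈ W := by
    have : Filter.Tendsto ψ (𝓝 (c.dom q).2) (𝓝 q) := by
      have h1 := (c.dom.continuousAt_symm hpt).tendsto.comp hcont
      have h2 : c.dom.symm ((c.dom q).1, (c.dom q).2) = q := hψq
      rwa [h2] at h1
    exact this hW
  have himg : (fun y => a (χ.symm y)) '' Metric.ball (χ 1) ε ∈ 𝓝 (c.dom q).2 := by
    filter_upwards [hψt, hψW] with v hv hvW
    have hvs := c.dom.map_target hv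
    have hπ : orbitProj G q = orbitProj G (ψ v) := by
      -- The point `ψ v` has the same base coordinate as `q`, hence the same projection, hence lies
      -- on its orbit.
      refine c.cod.injOn c.mem_cod (c.mapsTo _ hvs) ?_
      rw [c.eq_fst q c.mem_dom, c.eq_fst _ hvs, c.dom.right_inv hv]
    obtain ⟨g, hg⟩ := exists_smul_eq_of_orbitProj_eq hπ
    have hgN := hWN (show g • q ∈ W by rw [hg]; exact hvW)
    refine ⟨χ g, hgN.1, ?_⟩
    simp only [χ.left_inv hgN.2, a, hg, ψ, c.dom.right_inv hv]
  have h1 := Real.dimH_of_mem_nhds himg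
  have h2 := (hau.mono hball).dimH_image_le (convex_ball _ _) Subset.rfl
  have h3 := dimH_mono (subset_univ (Metric.ball (χ 1) ε))
  rw [Real.dimH_univ_eq_finrank] at h3
  rw [h1] at h2
  exact_mod_cast h2.trans h3

variable (E EB G) in
/-- The derivative of the orbit projection, between the model spaces. -/
def projQ (q : Q) : E →L[ℝ] EB :=
  tmap 𝓘(ℝ, E) 𝓘(ℝ, EB) (orbitProj G : Q → OrbitSpace G Q) q

/-- The kernel of `Tπ` is the tangent space of the orbit. -/
theorem ker_projQ [ProperSMul G Q]
    (hπ : Manifold.IsSubmersion 𝓘(ℝ, E) 𝓘(ℝ, EB) ∞ (orbitProj G : Q → OrbitSpace G Q)) (q : Q) :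
    LinearMap.ker (projQ E EB G q).toLinearMap = LinearMap.range (gen E EG G q).toLinearMap := by
  have hq := hπ.isSubmersionAt q
  obtain ⟨c⟩ := exists_submersionChart hq
  have hle : LinearMap.range (gen E EG G q).toLinearMap
      ≤ LinearMap.ker (projQ E EB G q).toLinearMap := by
    rintro _ ⟨ξ, rfl⟩
    have h1 := tmap_comp (F := (orbitProj G : Q → OrbitSpace G Q)) (F' := fun g : G => g • q)
      (I := 𝓘(ℝ, EB)) (J := 𝓘(ℝ, E)) (K := 𝓘(ℝ, EG)) (l := 1)
      (hπ.contMDiff.mdifferentiable (by simp) _)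
      ((contMDiff_orbit E EG G q).mdifferentiable (by simp) 1)
    simp only [orbitProj_smul] at h1
    rw [one_smul] at h1
    have h2 : tmap 𝓘(ℝ, EG) 𝓘(ℝ, EB) (fun _ : G => orbitProj G q) 1 = 0 := mfderiv_const
    rw [h2] at h1
    exact (congrArg (fun T : EG →L[ℝ] EB => T ξ) h1).symm
  have hF : FiniteDimensional ℝ (EB × hq.complement) :=
    LinearEquiv.finiteDimensional hq.equiv.toLinearEquiv
  have hF' : FiniteDimensional ℝ hq.complement :=
    FiniteDimensional.of_surjective (LinearMap.snd ℝ EB hq.complement) LinearMap.snd_surjective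
  have hdim := hq.equiv.toLinearEquiv.finrank_eq
  rw [Module.finrank_prod] at hdim
  have h1 := LinearMap.finrank_range_add_finrank_ker (projQ E EB G q).toLinearMap
  have h2 : LinearMap.range (projQ E EB G q).toLinearMap = ⊤ :=
    LinearMap.range_eq_top.2 (tmap_surjective_of_isSubmersionAt hq)
  rw [h2, finrank_top] at h1
  have h3 := LinearMap.finrank_range_of_inj
    (f := (gen E EG G q).toLinearMap) (gen_injective E EG G q)
  -- One inclusion is the chain rule. Equality follows from dimensions: the kernel has dimension
  -- `dim F ≤ dim G`, while the range of the injective generator map already has dimension `dim G`.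
  have h4 := finrank_complement_le EG c
  exact (Submodule.eq_of_le_of_finrank_le hle (by omega)).symm

end Orbits
end Nonholonomic

/-! ### Fibrewise linear algebra: horizontal lifts, connection, Legendre transformations, and the
extension of `ρ` to `T*Q`. -/

namespace Nonholonomic

namespace WeaklyDegenerateChaplyginSystem

section Pointwise

variable {E : Type*} [NormedAddCommGroup E] [NormedSpace ℝ E] [FiniteDimensional ℝ E]
  {EG : Type*} [NormedAddCommGroup EG] [NormedSpace ℝ EG] [FiniteDimensional ℝ EG]
  {EB : Type*} [NormedAddCommGroup EB] [NormedSpace ℝ EB] [FiniteDimensional ℝ EB]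
  {Q : Type*} [TopologicalSpace Q] [ChartedSpace E Q] [IsManifold 𝓘(ℝ, E) ∞ Q]
  {G : Type*} [TopologicalSpace G] [ChartedSpace EG G] [Group G] [LieGroup 𝓘(ℝ, EG) ∞ G]
  [MulAction G Q] [ContMDiffSMul 𝓘(ℝ, EG) 𝓘(ℝ, E) ∞ G Q] [IsCancelSMul G Q] [ProperSMul G Q]
  (S : WeaklyDegenerateChaplyginSystem E EG Q G)
  [ChartedSpace EB (OrbitSpace G Q)] [IsManifold 𝓘(ℝ, EB) ∞ (OrbitSpace G Q)]
  (hπ : Manifold.IsSubmersion 𝓘(ℝ, E) 𝓘(ℝ, EB) ∞ (orbitProj G : Q → OrbitSpace G Q))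

/-- The distribution, as a subspace of the model space. -/
def dist (q : Q) : Submodule ℝ E := S.Δ q

/-- The metric, as a bilinear form on the model space. -/
def bil (q : Q) : E →L[ℝ] E →L[ℝ] ℝ := S.metric q

theorem bil_symm (q : Q) (v w : E) : S.bil q v w = S.bil q w v := S.metric_symm q v w

theorem isCompl_dist (q : Q) :
    IsCompl (S.dist q) (LinearMap.range (gen E EG G q).toLinearMap) := S.isCompl q

include hπ in
theorem disjoint_ker_dist (q : Q) {v : E} (hv : v ∈ S.dist q) (h : projQ E EB G q v = 0) :
    v = 0 := by
  have h1 : v ∈ LinearMap.ker (projQ E EB G q).toLinearMap := h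
  rw [ker_projQ (EG := EG) hπ] at h1
  exact Submodule.disjoint_def.1 (S.isCompl_dist q).disjoint v hv h1

variable (EB) in
/-- The horizontal lift, between the model spaces. -/
def hl (q : Q) : EB →L[ℝ] E :=
  let A : EB →ₗ[ℝ] E := S.hlΔ EB q
  LinearMap.toContinuousLinearMap A

theorem hl_mem (q : Q) (y : EB) : S.hl EB q y ∈ S.dist q := Submodule.coe_mem _

include hπ in
theorem hl_projQ (q : Q) {v : E} (hv : v ∈ S.dist q) : S.hl EB q (projQ E EB G q v) = v := by
  have h := LinearMap.leftInverse_apply_of_inj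
    (f := (tangentOrbitProj E G EB q).toLinearMap ∘ₗ (S.Δ q).subtype)
    (LinearMap.ker_eq_bot'.2 fun w hw => Subtype.ext (S.disjoint_ker_dist hπ q w.2 hw)) ⟨v, hv⟩
  exact congrArg Subtype.val h

include hπ in
theorem projQ_hl (q : Q) (y : EB) : projQ E EB G q (S.hl EB q y) = y := by
  obtain ⟨v, rfl⟩ := tmap_surjective_of_isSubmersionAt (hπ.isSubmersionAt q) y
  have hv : v ∈ S.dist q ⊔ LinearMap.range (gen E EG G q).toLinearMap := by
    rw [(S.isCompl_dist q).sup_eq_top]; trivial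
  obtain ⟨a, ha, b, hb, rfl⟩ := Submodule.mem_sup.1 hv
  rw [← ker_projQ (EG := EG) hπ] at hb
  have hb' : projQ E EB G q b = 0 := hb
  change projQ E EB G q (S.hl EB q (projQ E EB G q (a + b))) = projQ E EB G q (a + b)
  rw [map_add, hb', add_zero, S.hl_projQ hπ q ha]

/-- The connection form, between the model spaces. -/
def conn (q : Q) : E →L[ℝ] EG := S.connection q

theorem conn_of_mem (q : Q) {v : E} (hv : v ∈ S.dist q) : S.conn q v = 0 := by
  have h : S.ver q v = 0 := (Submodule.projection_apply_eq_zero_iff (S.isCompl q).symm).2 hv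
  change (infGen EG G q).toLinearMap.leftInverse (S.ver q v) = 0
  rw [h, map_zero]

theorem conn_gen (q : Q) (ξ : EG) : S.conn q (gen E EG G q ξ) = ξ := by
  have h : S.ver q (gen E EG G q ξ) = infGen EG G q ξ :=
    (Submodule.projection_apply_of_mem_left (S.isCompl q).symm ⟨ξ, rfl⟩)
  change (infGen EG G q).toLinearMap.leftInverse (S.ver q (gen E EG G q ξ)) = ξ
  rw [h]
  exact LinearMap.leftInverse_apply_of_inj (f := (infGen EG G q).toLinearMap)
    (LinearMap.ker_eq_bot.2 (gen_injective E EG G q)) ξ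

include hπ in
theorem hl_add_gen_conn (q : Q) (v : E) :
    S.hl EB q (projQ E EB G q v) + gen E EG G q (S.conn q v) = v := by
  have hv : v ∈ S.dist q ⊔ LinearMap.range (gen E EG G q).toLinearMap := by
    rw [(S.isCompl_dist q).sup_eq_top]; trivial
  obtain ⟨a, ha, b, ⟨ξ, rfl⟩, rfl⟩ := Submodule.mem_sup.1 hv
  have hb' : projQ E EB G q (gen E EG G q ξ) = 0 := by
    have : gen E EG G q ξ ∈ LinearMap.ker (projQ E EB G q).toLinearMap := by
      rw [ker_projQ (EG := EG) hπ]; exact ⟨ξ, rfl⟩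
    exact this
  change S.hl EB q (projQ E EB G q (a + gen E EG G q ξ)) + gen E EG G q
    (S.conn q (a + gen E EG G q ξ)) = a + gen E EG G q ξ
  rw [map_add (projQ E EB G q), map_add (S.conn q), hb', add_zero, S.hl_projQ hπ q ha,
    S.conn_of_mem q ha, S.conn_gen, zero_add]

theorem hor_of_mem (q : Q) {v : E} (hv : v ∈ S.dist q) : S.hor q v = v :=
  Submodule.projection_apply_of_mem_left (S.isCompl q) hv

/-! ### The action -/

variable (E) in
/-- The tangent action, between the model spaces. -/
def _root_.Nonholonomic.act (g : G) (q : Q) : E →L[ℝ] E :=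
  tmap 𝓘(ℝ, E) 𝓘(ℝ, E) (fun x : Q => g • x) q

include EG in
theorem _root_.Nonholonomic.act_act (g h : G) (q : Q) (v : E) :
    act E h (g • q) (act E g q v) = act E (h * g) q v := by
  have h1 := tmap_comp (F := fun x : Q => h • x) (F' := fun x : Q => g • x) (l := q)
    (I := 𝓘(ℝ, E)) (J := 𝓘(ℝ, E)) (K := 𝓘(ℝ, E))
    ((contMDiff_smul_left E EG h).mdifferentiable (by simp) _)
    ((contMDiff_smul_left E EG g).mdifferentiable (by simp) _)
  simp only [smul_smul] at h1
  exact (congrArg (fun T : E →L[ℝ] E => T v) h1).symm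

theorem _root_.Nonholonomic.act_one (q : Q) (v : E) : act E (1 : G) q v = v := by
  have h : (fun x : Q => (1 : G) • x) = fun x => x := by funext x; exact one_smul G x
  unfold act
  rw [h, tmap_id]
  rfl

include S in
theorem act_inv_act (g : G) (q : Q) (v : E) : act E g⁻¹ (g • q) (act E g q v) = v := by
  rw [act_act (EG := EG), inv_mul_cancel, act_one]

theorem act_mem (g : G) (q : Q) {v : E} (hv : v ∈ S.dist q) : act E g q v ∈ S.dist (g • q) := by
  have h := S.Δ_invariant g q
  change act E g q v ∈ S.Δ (g • q)
  rw [← h]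
  exact ⟨v, hv, rfl⟩

include S hπ in
theorem projQ_act (g : G) (q : Q) (v : E) : projQ E EB G (g • q) (act E g q v) = projQ E EB G q v := by
  have h1 := tmap_comp (F := (orbitProj G : Q → OrbitSpace G Q)) (F' := fun x : Q => g • x)
    (I := 𝓘(ℝ, EB)) (J := 𝓘(ℝ, E)) (K := 𝓘(ℝ, E)) (l := q)
    (hπ.contMDiff.mdifferentiable (by simp) _)
    ((contMDiff_smul_left E EG g).mdifferentiable (by simp) _)
  simp only [orbitProj_smul] at h1
  exact (congrArg (fun T : E →L[ℝ] EB => T v) h1).symm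

include hπ in
theorem hl_smul (g : G) (q : Q) (y : EB) : S.hl EB (g • q) y = act E g q (S.hl EB q y) := by
  have h := S.hl_projQ hπ (g • q) (S.act_mem g q (S.hl_mem q y))
  rwa [S.projQ_act hπ, S.projQ_hl hπ] at h

theorem V_smul (g : G) (q : Q) : S.V (g • q) = S.V q := by
  have h := S.lagrangian_invariant g q (0 : E)
  change (1 / 2) * S.bil (g • q) (act E g q 0) (act E g q 0) - S.V (g • q)
    = (1 / 2) * S.bil q 0 0 - S.V q at h
  rw [map_zero, map_zero, map_zero] at h
  simpa using h

/-- Invariance of `L` at the zero vector gives invariance of `V`; what remains is invariance of the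
quadratic form, which polarises because `g` is symmetric. -/
theorem bil_smul (g : G) (q : Q) (v w : E) :
    S.bil (g • q) (act E g q v) (act E g q w) = S.bil q v w := by
  have hd : ∀ v, S.bil (g • q) (act E g q v) (act E g q v) = S.bil q v v := by
    intro v
    have h := S.lagrangian_invariant g q v
    change (1 / 2) * S.bil (g • q) (act E g q v) (act E g q v) - S.V (g • q)
      = (1 / 2) * S.bil q v v - S.V q at h
    rw [V_smul] at h
    linarith
  have h1 := hd (v + w)
  have h2 := S.bil_symm q w v
  have h3 := S.bil_symm (g • q) (act E g q w) (act E g q v)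
  simp only [map_add, add_apply, hd] at h1
  linarith

/-! ### Legendre transformations -/

theorem _root_.Nonholonomic.fderiv_half_quadratic {W : Type*} [NormedAddCommGroup W]
    [NormedSpace ℝ W] (b : W →L[ℝ] W →L[ℝ] ℝ) (hb : ∀ v w, b v w = b w v) (c : ℝ) (v : W) :
    fderiv ℝ (fun w : W => (1 / 2) * b w w - c) v = b v := by
  have h : HasFDerivAt (fun w : W => (1 / 2) * b w w - c)
      ((1 / 2 : ℝ) • ((b v).comp (ContinuousLinearMap.id ℝ W)
        + (b.comp (ContinuousLinearMap.id ℝ W)).flip v)) v :=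
    (((b.hasFDerivAt.comp v (hasFDerivAt_id v)).clm_apply
      (hasFDerivAt_id v)).const_mul (1 / 2)).sub_const _
  refine h.fderiv.trans ?_
  ext w
  have := hb w v
  simp only [smul_apply, add_apply, ContinuousLinearMap.comp_apply,
    ContinuousLinearMap.flip_apply, ContinuousLinearMap.id_apply, smul_eq_mul]
  linarith

variable (EB) in
/-- The metric of the reduced Lagrangian, at `π q`. -/
def gbar (q : Q) : EB →L[ℝ] EB →L[ℝ] ℝ :=
  ((ContinuousLinearMap.compL ℝ EB E ℝ).flip (S.hl EB q)).comp ((S.bil q).comp (S.hl EB q))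

theorem gbar_apply (q : Q) (y z : EB) :
    S.gbar EB q y z = S.bil q (S.hl EB q y) (S.hl EB q z) := rfl

include hπ in
theorem gbar_smul (g : G) (q : Q) : S.gbar EB (g • q) = S.gbar EB q := by
  ext y z
  simp only [gbar_apply, S.hl_smul hπ, S.bil_smul]

include hπ in
theorem gbar_eq_of_orbitProj_eq {q q' : Q} (h : orbitProj G q = orbitProj G q') :
    S.gbar EB q = S.gbar EB q' := by
  obtain ⟨g, rfl⟩ := exists_smul_eq_of_orbitProj_eq h
  exact (S.gbar_smul hπ g q).symm

include hπ in
theorem V_eq_of_orbitProj_eq {q q' : Q} (h : orbitProj G q = orbitProj G q') : S.V q = S.V q' := by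
  obtain ⟨g, rfl⟩ := exists_smul_eq_of_orbitProj_eq h
  exact (S.V_smul g q).symm

include hπ in
theorem injective_gbar (q : Q) : Injective (S.gbar EB q) := by
  rw [injective_iff_map_eq_zero]
  intro y hy
  by_contra hne
  have h1 : S.hl EB q y ≠ 0 := by
    intro h
    have := S.projQ_hl hπ q y
    rw [h, map_zero] at this
    exact hne this.symm
  have h2 : 0 < S.bil q (S.hl EB q y) (S.hl EB q y) := S.pos_on_Δ q _ (S.hl_mem q y) h1
  rw [← gbar_apply, hy] at h2
  exact lt_irrefl _ h2

include hπ in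
theorem exists_equiv_gbar (q : Q) :
    ∃ e : EB ≃L[ℝ] (EB →L[ℝ] ℝ), (e : EB →L[ℝ] (EB →L[ℝ] ℝ)) = S.gbar EB q := by
  have hdim : Module.finrank ℝ EB = Module.finrank ℝ (EB →L[ℝ] ℝ) := by
    rw [← (LinearMap.toContinuousLinearMap (𝕜 := ℝ) (E := EB) (F' := ℝ)).finrank_eq]
    exact Subspace.dual_finrank_eq.symm
  exact ⟨(LinearEquiv.ofInjectiveOfFinrankEq (S.gbar EB q).toLinearMap
    (S.injective_gbar hπ q) hdim).toContinuousLinearEquiv, ContinuousLinearMap.ext fun y => rfl⟩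

include hπ in
theorem inverse_gbar_gbar (q : Q) (y : EB) : (S.gbar EB q).inverse (S.gbar EB q y) = y := by
  obtain ⟨e, he⟩ := S.exists_equiv_gbar hπ q
  rw [← he, ContinuousLinearMap.inverse_equiv]
  exact e.symm_apply_apply y

include hπ in
theorem gbar_inverse_gbar (q : Q) (α : EB →L[ℝ] ℝ) : S.gbar EB q ((S.gbar EB q).inverse α) = α := by
  obtain ⟨e, he⟩ := S.exists_equiv_gbar hπ q
  rw [← he, ContinuousLinearMap.inverse_equiv]
  exact e.apply_symm_apply α

variable (EB) in
/-- The inverse of the Legendre transformation along the distribution: `cometric q p` is the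
vector `v` of the distribution with `g(v, w) = ⟨p, w⟩` for all `w` in the distribution. -/
def cometric (q : Q) : (E →L[ℝ] ℝ) →L[ℝ] E :=
  (S.hl EB q).comp ((S.gbar EB q).inverse.comp
    ((ContinuousLinearMap.compL ℝ EB E ℝ).flip (S.hl EB q)))

theorem cometric_apply (q : Q) (p : E →L[ℝ] ℝ) :
    S.cometric EB q p = S.hl EB q ((S.gbar EB q).inverse (p.comp (S.hl EB q))) := rfl

theorem cometric_mem (q : Q) (p : E →L[ℝ] ℝ) : S.cometric EB q p ∈ S.dist q := by
  rw [cometric_apply]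
  exact S.hl_mem (EB := EB) q _

include hπ in
theorem bil_cometric (q : Q) (p : E →L[ℝ] ℝ) {w : E} (hw : w ∈ S.dist q) :
    S.bil q (S.cometric EB q p) w = p w := by
  conv_lhs => rw [← S.hl_projQ hπ q hw]
  rw [cometric_apply, ← gbar_apply, S.gbar_inverse_gbar hπ, ContinuousLinearMap.comp_apply,
    S.hl_projQ hπ q hw]

include hπ in
theorem cometric_bil (q : Q) {v : E} (hv : v ∈ S.dist q) : S.cometric EB q (S.bil q v) = v := by
  have h : (S.bil q v).comp (S.hl EB q) = S.gbar EB q (projQ E EB G q v) := by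
    ext y
    rw [gbar_apply, S.hl_projQ hπ q hv]
    rfl
  rw [cometric_apply, h, S.inverse_gbar_gbar hπ, S.hl_projQ hπ q hv]

theorem _root_.Nonholonomic.orbitProj_out (x : OrbitSpace G Q) : orbitProj G x.out = x :=
  Quotient.out_eq x

/-- The Legendre transformation of the reduced Lagrangian, between the model spaces. -/
def flbar (x : OrbitSpace G Q) : EB → (EB →L[ℝ] ℝ) := S.FLbar (EB := EB) x

theorem flbar_eq (x : OrbitSpace G Q) (v : EB) : S.flbar x v = S.gbar EB x.out v :=
  fderiv_half_quadratic (S.gbar EB x.out)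
    (fun v w => S.bil_symm x.out (S.hl EB x.out v) (S.hl EB x.out w)) (S.V x.out) v

/-- The inverse of `flbar`. -/
def flbarInv (x : OrbitSpace G Q) : (EB →L[ℝ] ℝ) → EB := S.FLbarInv (EB := EB) x

-- The reduced Legendre transformation is computed at the chosen representative `x.out`. Invariance
-- of `gbar` along orbits allows any point `q` over `x` in its place.
include hπ in
theorem flbarInv_eq (q : Q) (α : EB →L[ℝ] ℝ) :
    S.flbarInv (orbitProj G q) α = (S.gbar EB q).inverse α := by
  have h1 : S.gbar EB (orbitProj G q).out = S.gbar EB q :=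
    S.gbar_eq_of_orbitProj_eq hπ (orbitProj_out _)
  have h2 : S.flbar (orbitProj G q) = S.gbar EB q := by
    funext v
    rw [flbar_eq, h1]
  change invFun (S.flbar (orbitProj G q)) α = _
  rw [h2]
  conv_lhs => rw [← S.gbar_inverse_gbar hπ q α]
  exact leftInverse_invFun (S.injective_gbar hπ q) _

/-- The Legendre transformation, between the model spaces. -/
def fl (q : Q) : E → (E →L[ℝ] ℝ) := S.FL q

theorem fl_eq (q : Q) (v : E) : S.fl q v = S.bil q v :=
  fderiv_half_quadratic (S.bil q) (S.bil_symm q) (S.V q) v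

variable (EB) in
/-- The horizontal lift of covectors, between the model spaces. -/
def hlCov (q : Q) (α : EB →L[ℝ] ℝ) : (E →L[ℝ] ℝ) := S.hlP EB q α

include hπ in
theorem hlCov_eq (q : Q) (α : EB →L[ℝ] ℝ) :
    S.hlCov EB q α = S.bil q (S.hl EB q ((S.gbar EB q).inverse α)) := by
  change S.fl q (S.hl EB q (S.flbarInv (orbitProj G q) α)) = _
  rw [S.flbarInv_eq hπ, fl_eq]

include hπ in
theorem hlCov_comp_hl (q : Q) (α : EB →L[ℝ] ℝ) : (S.hlCov EB q α).comp (S.hl EB q) = α := by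
  rw [S.hlCov_eq hπ]
  exact S.gbar_inverse_gbar hπ q α

-- This exhibits `P` as the set of fixed points of the fibrewise linear map `p ↦ g(cometric p, ·)`,
-- which is what makes it a retract of `T*Q`.
include hπ in
theorem mem_P_iff (z : CotangentBundle E Q) :
    z ∈ S.P ↔ S.bil z.proj (S.cometric EB z.proj (cov z)) = cov z := by
  constructor
  · rintro ⟨v, hv, h⟩
    have h' : S.bil z.proj v = cov z := (S.fl_eq z.proj v).symm.trans h
    rw [← h', S.cometric_bil hπ _ hv]
  · intro h
    exact ⟨S.cometric EB z.proj (cov z), S.cometric_mem _ _, (S.fl_eq _ _).trans h⟩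

/-- The extension of `ρ` to `T*Q`: the covector is restricted to the distribution. -/
def red (EB : Type*) [NormedAddCommGroup EB] [NormedSpace ℝ EB] [FiniteDimensional ℝ EB]
    [ChartedSpace EB (OrbitSpace G Q)] (z : CotangentBundle E Q) : CotangentBundle EB (OrbitSpace G Q) :=
  mkCov (orbitProj G z.proj) ((cov z).comp (S.hl EB z.proj))

variable (EB) in
/-- The projection of `T*Q` onto `P`. -/
def toP (z : CotangentBundle E Q) : CotangentBundle E Q :=
  mkCov z.proj (S.bil z.proj (S.cometric EB z.proj (cov z)))

include hπ in
theorem toP_mem (z : CotangentBundle E Q) : S.toP EB z ∈ S.P := by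
  rw [S.mem_P_iff (EB := EB) hπ]
  exact congrArg (S.bil z.proj) (S.cometric_bil hπ z.proj (S.cometric_mem z.proj _))

include hπ in
theorem toP_of_mem {z : CotangentBundle E Q} (hz : z ∈ S.P) : S.toP EB z = z := by
  rw [S.mem_P_iff (EB := EB) hπ] at hz
  exact cotangent_ext rfl hz

-- The covectors `p` and `g(cometric p, ·)` agree on `Δ_Q`, and `red` sees a covector only through
-- its values there.
include hπ in
theorem red_toP (z : CotangentBundle E Q) : S.red EB (S.toP EB z) = S.red EB z := by
  refine cotangent_ext rfl (ContinuousLinearMap.ext fun y => ?_)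
  exact S.bil_cometric hπ z.proj _ (S.hl_mem z.proj y)

include hπ in
theorem hlCov_red {z : CotangentBundle E Q} (hz : z ∈ S.P) :
    S.hlCov EB z.proj ((cov z).comp (S.hl EB z.proj)) = cov z := by
  rw [S.hlCov_eq hπ, ← S.cometric_apply]
  exact (S.mem_P_iff (EB := EB) hπ z).1 hz

-- Restriction to the distribution is a left inverse of the lift `hlCov`, so on `P` the inverse that
-- defines `ρ` is the explicit map `red`. Unlike `ρ`, `red` is defined on all of `T*Q`, where it can
-- be differentiated in canonical charts.
include hπ in
theorem rho_eq_red (z : S.P) : S.rho EB z = S.red EB z.1 := by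
  refine cotangent_ext rfl ?_
  change invFun (S.hlCov EB z.1.proj) (cov z.1) = _
  conv_lhs => rw [← S.hlCov_red (EB := EB) hπ z.2]
  refine leftInverse_invFun (fun α β h => ?_) _
  rw [← S.hlCov_comp_hl hπ z.1.proj α, h, S.hlCov_comp_hl hπ]

include hπ in
theorem mkCov_hlCov_mem (q : Q) (α : EB →L[ℝ] ℝ) :
    (mkCov q (S.hlCov EB q α) : CotangentBundle E Q) ∈ S.P := by
  rw [S.hlCov_eq hπ]
  exact ⟨_, S.hl_mem q _, S.fl_eq q _⟩

include hπ in
theorem red_hlCov (q : Q) (α : EB →L[ℝ] ℝ) :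
    S.red EB (mkCov q (S.hlCov EB q α)) = mkCov (orbitProj G q) α :=
  cotangent_ext rfl (S.hlCov_comp_hl hπ q α)

end Pointwise

end WeaklyDegenerateChaplyginSystem

end Nonholonomic

/-! ### Smooth dependence of the lifts, the metrics and the connection on the base point. -/

namespace Nonholonomic

section FrameCalculus

variable {EN : Type*} [NormedAddCommGroup EN] [NormedSpace ℝ EN]
  {HN : Type*} [TopologicalSpace HN] {J : ModelWithCorners ℝ EN HN}
  {N : Type*} [TopologicalSpace N] [ChartedSpace HN N]
  {U : Type*} [NormedAddCommGroup U] [NormedSpace ℝ U]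
  {V : Type*} [NormedAddCommGroup V] [NormedSpace ℝ V]
  {W : Type*} [NormedAddCommGroup W] [NormedSpace ℝ W]

theorem contMDiffAt_inverse [CompleteSpace U] {f : N → (U →L[ℝ] V)} {n : N}
    (hf : ContMDiffAt J 𝓘(ℝ, U →L[ℝ] V) ∞ f n) (h : ∃ e : U ≃L[ℝ] V, (e : U →L[ℝ] V) = f n) :
    ContMDiffAt J 𝓘(ℝ, V →L[ℝ] U) ∞ (fun m => (f m).inverse) n ∧
      ∀ᶠ m in 𝓝 n, ∃ e : U ≃L[ℝ] V, (e : U →L[ℝ] V) = f m := by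
  obtain ⟨e, he⟩ := h
  have h1 : ContMDiffAt 𝓘(ℝ, U →L[ℝ] V) 𝓘(ℝ, V →L[ℝ] U) ∞
      ContinuousLinearMap.inverse (f n) := by
    rw [← he]
    exact (contDiffAt_map_inverse e).contMDiffAt
  refine ⟨h1.comp n hf, ?_⟩
  have h2 : range ((↑) : (U ≃L[ℝ] V) → (U →L[ℝ] V)) ∈ 𝓝 (f n) := by
    rw [← he]; exact ContinuousLinearEquiv.nhds e
  exact hf.continuousAt h2

theorem contMDiffAt_clm_comp {A : N → (V →L[ℝ] W)} {B : N → (U →L[ℝ] V)} {n : N}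
    (hA : ContMDiffAt J 𝓘(ℝ, V →L[ℝ] W) ∞ A n) (hB : ContMDiffAt J 𝓘(ℝ, U →L[ℝ] V) ∞ B n) :
    ContMDiffAt J 𝓘(ℝ, U →L[ℝ] W) ∞ (fun m => (A m).comp (B m)) n := hA.clm_comp hB

theorem contMDiffAt_clm_apply {A : N → (V →L[ℝ] W)} {B : N → V} {n : N}
    (hA : ContMDiffAt J 𝓘(ℝ, V →L[ℝ] W) ∞ A n) (hB : ContMDiffAt J 𝓘(ℝ, V) ∞ B n) :
    ContMDiffAt J 𝓘(ℝ, W) ∞ (fun m => A m (B m)) n := hA.clm_apply hB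

/-- Composition with `T` from the right. -/
def precomp (T : U →L[ℝ] V) : (V →L[ℝ] W) →L[ℝ] (U →L[ℝ] W) := T.precomp W

theorem precomp_apply (T : U →L[ℝ] V) (p : V →L[ℝ] W) : precomp T p = p.comp T := rfl

theorem contMDiffAt_precomp {T : N → (U →L[ℝ] V)} {n : N}
    (hT : ContMDiffAt J 𝓘(ℝ, U →L[ℝ] V) ∞ T n) :
    ContMDiffAt J 𝓘(ℝ, (V →L[ℝ] W) →L[ℝ] (U →L[ℝ] W)) ∞
      (fun m => precomp (W := W) (T m)) n :=
  hT.clm_precomp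

/-- The bilinear form `(u, w) ↦ b (T u) (T w)`. -/
def pullBil (b : V →L[ℝ] V →L[ℝ] W) (T : U →L[ℝ] V) : U →L[ℝ] U →L[ℝ] W :=
  (precomp T).comp (b.comp T)

theorem pullBil_apply (b : V →L[ℝ] V →L[ℝ] W) (T : U →L[ℝ] V) (u w : U) :
    pullBil b T u w = b (T u) (T w) := rfl

theorem contMDiffAt_pullBil {b : N → (V →L[ℝ] V →L[ℝ] W)} {T : N → (U →L[ℝ] V)} {n : N}
    (hb : ContMDiffAt J 𝓘(ℝ, V →L[ℝ] V →L[ℝ] W) ∞ b n)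
    (hT : ContMDiffAt J 𝓘(ℝ, U →L[ℝ] V) ∞ T n) :
    ContMDiffAt J 𝓘(ℝ, U →L[ℝ] U →L[ℝ] W) ∞ (fun m => pullBil (b m) (T m)) n :=
  contMDiffAt_clm_comp (contMDiffAt_precomp hT) (contMDiffAt_clm_comp hb hT)

/-- The bilinear form `(u, w) ↦ j (b u w)`. -/
def postBil {W' : Type*} [NormedAddCommGroup W'] [NormedSpace ℝ W'] (j : W →L[ℝ] W')
    (b : V →L[ℝ] V →L[ℝ] W) : V →L[ℝ] V →L[ℝ] W' :=
  (j.postcomp V).comp b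

theorem postBil_apply {W' : Type*} [NormedAddCommGroup W'] [NormedSpace ℝ W'] (j : W →L[ℝ] W')
    (b : V →L[ℝ] V →L[ℝ] W) (u w : V) : postBil j b u w = j (b u w) := rfl

theorem contMDiffAt_postBil {W' : Type*} [NormedAddCommGroup W'] [NormedSpace ℝ W']
    {j : N → (W →L[ℝ] W')} {b : N → (V →L[ℝ] V →L[ℝ] W)} {n : N}
    (hj : ContMDiffAt J 𝓘(ℝ, W →L[ℝ] W') ∞ j n)
    (hb : ContMDiffAt J 𝓘(ℝ, V →L[ℝ] V →L[ℝ] W) ∞ b n) :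
    ContMDiffAt J 𝓘(ℝ, V →L[ℝ] V →L[ℝ] W') ∞ (fun m => postBil (j m) (b m)) n :=
  contMDiffAt_clm_comp hj.clm_postcomp hb

end FrameCalculus

namespace WeaklyDegenerateChaplyginSystem

section Smoothness

variable {E : Type*} [NormedAddCommGroup E] [NormedSpace ℝ E] [FiniteDimensional ℝ E]
  {EG : Type*} [NormedAddCommGroup EG] [NormedSpace ℝ EG] [FiniteDimensional ℝ EG]
  {EB : Type*} [NormedAddCommGroup EB] [NormedSpace ℝ EB] [FiniteDimensional ℝ EB]
  {Q : Type*} [TopologicalSpace Q] [ChartedSpace E Q] [IsManifold 𝓘(ℝ, E) ∞ Q]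
  {G : Type*} [TopologicalSpace G] [ChartedSpace EG G] [Group G] [LieGroup 𝓘(ℝ, EG) ∞ G]
  [MulAction G Q] [ContMDiffSMul 𝓘(ℝ, EG) 𝓘(ℝ, E) ∞ G Q] [IsCancelSMul G Q] [ProperSMul G Q]
  (S : WeaklyDegenerateChaplyginSystem E EG Q G)
  [ChartedSpace EB (OrbitSpace G Q)] [IsManifold 𝓘(ℝ, EB) ∞ (OrbitSpace G Q)]
  (hπ : Manifold.IsSubmersion 𝓘(ℝ, E) 𝓘(ℝ, EB) ∞ (orbitProj G : Q → OrbitSpace G Q))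


/-- The images of a basis of `EB` are extended one by one to local sections of `Δ_Q`, as regularity
permits, and recombined linearly. -/
theorem exists_local_frame (q₀ : Q) (s : EB →L[ℝ] E) (hs : ∀ y, s y ∈ S.dist q₀) :
    ∃ X : Q → (EB →L[ℝ] E), X q₀ = s ∧ (∀ᶠ q in 𝓝 q₀, ∀ y, X q y ∈ S.dist q) ∧
      ContMDiffAt 𝓘(ℝ, E) 𝓘(ℝ, EB →L[ℝ] E) ∞ (fun q => (coframe 𝓘(ℝ, E) q₀ q).comp (X q)) q₀ := by
  let b := Module.finBasis ℝ EB
  have h := fun i => S.regular.2 q₀ (s (b i)) (hs (b i))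
  choose U X hU hq hX hX₀ hmem using h
  let X' : Fin (Module.finrank ℝ EB) → Q → E := fun i q => X i q
  let φ : Fin (Module.finrank ℝ EB) → (EB →L[ℝ] ℝ) := fun i =>
    LinearMap.toContinuousLinearMap (b.coord i)
  refine ⟨fun q => ∑ i, (φ i).smulRight (X' i q), ?_, ?_, ?_⟩
  · ext y
    have h1 : ∀ i, X' i q₀ = s (b i) := hX₀
    simp only [h1]
    have h2 := b.sum_repr y
    conv_rhs => rw [← h2]
    rw [map_sum, sum_apply]
    refine Finset.sum_congr rfl fun i _ => ?_
    rw [map_smul]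
    rfl
  · have h1 : ∀ᶠ q in 𝓝 q₀, ∀ i, q ∈ U i :=
      Filter.eventually_all.2 fun i => (hU i).mem_nhds (hq i)
    filter_upwards [h1] with q h1 y
    rw [sum_apply]
    exact Submodule.sum_mem _ fun i _ => Submodule.smul_mem _ _ (hmem i q (h1 i))
  · have h1 : ∀ i, ContMDiffAt 𝓘(ℝ, E) 𝓘(ℝ, E) ∞ (fun q => coframe 𝓘(ℝ, E) q₀ q (X' i q)) q₀ :=
      fun i => (contMDiffAt_tangentBundle_iff.1
        ((hX i).contMDiffAt ((hU i).mem_nhds (hq i)))).2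
    have h2 : ContMDiffAt 𝓘(ℝ, E) 𝓘(ℝ, EB →L[ℝ] E) ∞
        (fun q => ∑ i, (φ i).smulRight (coframe 𝓘(ℝ, E) q₀ q (X' i q))) q₀ := by
      refine contMDiffAt_finsetSum fun i _ => ?_
      exact ((ContinuousLinearMap.smulRightL ℝ EB E (φ i)).contMDiff (n := ∞)).contMDiffAt.comp q₀
        (h1 i)
    refine h2.congr_of_eventuallyEq (Filter.Eventually.of_forall fun q => ?_)
    ext y
    simp

-- For a smooth local family `X` with values in `Δ_Q` that equals the lift at `q₀`, the composite
-- `Tπ ∘ X` is the identity at `q₀` and so invertible nearby. There the lift is `X ∘ (Tπ ∘ X)⁻¹`,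
-- and inversion is smooth.
include hπ in
theorem contMDiffAt_hl (q₀ : Q) :
    ContMDiffAt 𝓘(ℝ, E) 𝓘(ℝ, EB →L[ℝ] E) ∞ (fun q => (coframe 𝓘(ℝ, E) q₀ q).comp
      ((S.hl EB q).comp (frame 𝓘(ℝ, EB) (orbitProj G q₀) (orbitProj G q)))) q₀ := by
  obtain ⟨X, hX₀, hXm, hX⟩ := S.exists_local_frame q₀ (S.hl EB q₀) (S.hl_mem q₀)
  have hp : ContMDiffAt 𝓘(ℝ, E) 𝓘(ℝ, EB) ∞ (orbitProj G : Q → OrbitSpace G Q) q₀ :=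
    hπ.contMDiff.contMDiffAt
  have hM := contMDiffAt_clm_comp (contMDiffAt_mfderiv_in_frames hp) hX
  have hM₀ : (((coframe 𝓘(ℝ, EB) (orbitProj G q₀) (orbitProj G q₀)).comp
      ((tmap 𝓘(ℝ, E) 𝓘(ℝ, EB) (orbitProj G : Q → OrbitSpace G Q) q₀).comp
        (frame 𝓘(ℝ, E) q₀ q₀))).comp ((coframe 𝓘(ℝ, E) q₀ q₀).comp (X q₀)))
      = ContinuousLinearMap.id ℝ EB := by
    rw [coframe_self, coframe_self, frame_self, hX₀]
    ext y
    exact S.projQ_hl hπ q₀ y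
  obtain ⟨hI, hE⟩ := contMDiffAt_inverse hM ⟨ContinuousLinearEquiv.refl ℝ EB, hM₀.symm⟩
  refine (contMDiffAt_clm_comp hX hI).congr_of_eventuallyEq ?_
  filter_upwards [hXm, hE, extChartAt_source_mem_nhds (I := 𝓘(ℝ, E)) q₀,
    hp.continuousAt (extChartAt_source_mem_nhds (I := 𝓘(ℝ, EB)) (orbitProj G q₀))]
    with q hXm ⟨e, he⟩ hq hq'
  rw [← he, ContinuousLinearMap.inverse_equiv]
  refine ContinuousLinearMap.ext fun y => ?_
  have h1 : (e : EB →L[ℝ] EB) (e.symm y) = y := e.apply_symm_apply y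
  rw [he] at h1
  simp only [ContinuousLinearMap.comp_apply, frame_coframe hq] at h1
  have h2 : projQ E EB G q (X q (e.symm y))
      = frame 𝓘(ℝ, EB) (orbitProj G q₀) (orbitProj G q) y := by
    conv_rhs => rw [← h1]
    rw [frame_coframe hq']
    rfl
  simp only [ContinuousLinearMap.comp_apply]
  rw [← h2, S.hl_projQ hπ q (hXm _)]
  rfl

theorem contMDiffAt_bil (q₀ : Q) :
    ContMDiffAt 𝓘(ℝ, E) 𝓘(ℝ, E →L[ℝ] E →L[ℝ] ℝ) ∞
      (fun q => pullBil (S.bil q) (frame 𝓘(ℝ, E) q₀ q)) q₀ := by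
  have h := (contMDiffAt_hom_bundle _).1 (S.metric_smooth q₀)
  refine h.2.congr_of_eventuallyEq ?_
  filter_upwards [extChartAt_source_mem_nhds (I := 𝓘(ℝ, E)) q₀] with q hq
  refine ContinuousLinearMap.ext fun u => ?_
  have h1 : ∀ φ : E →L[ℝ] ℝ, ((trivializationAt (E →L[ℝ] ℝ)
      (fun q : Q => TangentSpace 𝓘(ℝ, E) q →L[ℝ] ℝ) q₀).continuousLinearMapAt ℝ q φ : E →L[ℝ] ℝ)
      = φ.comp (frame 𝓘(ℝ, E) q₀ q) := by
    intro φ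
    have hq2 : q ∈ (trivializationAt (E →L[ℝ] ℝ)
        (fun q : Q => TangentSpace 𝓘(ℝ, E) q →L[ℝ] ℝ) q₀).baseSet := by
      rw [hom_trivializationAt_baseSet]
      rw [extChartAt_source] at hq
      exact ⟨hq, mem_univ _⟩
    refine (Trivialization.continuousLinearMapAt_apply_of_mem _ _ hq2 _).trans ?_
    rw [hom_trivializationAt_apply]
    exact inCoordinates_eq_comp_frame hq _ _ φ
  refine Eq.symm ((h1 _).trans ?_)
  have h2 := congrArg (fun T : E →L[ℝ] E => T u) (symmL_eq_frame (I := 𝓘(ℝ, E)) hq)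
  exact congrArg (fun v : E => (S.bil q v).comp (frame 𝓘(ℝ, E) q₀ q)) h2

include hπ in
theorem contMDiffAt_gbar (q₀ : Q) :
    ContMDiffAt 𝓘(ℝ, E) 𝓘(ℝ, EB →L[ℝ] EB →L[ℝ] ℝ) ∞ (fun q => pullBil (S.gbar EB q)
      (frame 𝓘(ℝ, EB) (orbitProj G q₀) (orbitProj G q))) q₀ := by
  refine (contMDiffAt_pullBil (S.contMDiffAt_bil q₀) (S.contMDiffAt_hl hπ q₀)).congr_of_eventuallyEq
    ?_
  filter_upwards [extChartAt_source_mem_nhds (I := 𝓘(ℝ, E)) q₀] with q hq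
  ext u w
  simp only [pullBil_apply, ContinuousLinearMap.comp_apply, frame_coframe hq, gbar_apply]

include hπ in
theorem contMDiffAt_cometric (q₀ : Q) :
    ContMDiffAt 𝓘(ℝ, E) 𝓘(ℝ, (E →L[ℝ] ℝ) →L[ℝ] E) ∞ (fun q => (coframe 𝓘(ℝ, E) q₀ q).comp
      ((S.cometric EB q).comp (precomp (coframe 𝓘(ℝ, E) q₀ q)))) q₀ := by
  have hg := S.contMDiffAt_gbar hπ q₀
  have hl := S.contMDiffAt_hl hπ q₀
  have h₀ : pullBil (S.gbar EB q₀) (frame 𝓘(ℝ, EB) (orbitProj G q₀) (orbitProj G q₀))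
      = S.gbar EB q₀ := by
    rw [frame_self]; rfl
  obtain ⟨e, he⟩ := S.exists_equiv_gbar hπ q₀
  obtain ⟨hI, hE⟩ := contMDiffAt_inverse hg ⟨e, he.trans h₀.symm⟩
  refine (contMDiffAt_clm_comp hl (contMDiffAt_clm_comp hI (contMDiffAt_precomp hl))).congr_of_eventuallyEq ?_
  filter_upwards [hE, extChartAt_source_mem_nhds (I := 𝓘(ℝ, E)) q₀,
    hπ.contMDiff.contMDiffAt.continuousAt
      (extChartAt_source_mem_nhds (I := 𝓘(ℝ, EB)) (orbitProj G q₀))] with q ⟨e, he⟩ hq hq'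
  refine ContinuousLinearMap.ext fun p => ?_
  have hc : ((p.comp (coframe 𝓘(ℝ, E) q₀ q)).comp (S.hl EB q)).comp
      (frame 𝓘(ℝ, EB) (orbitProj G q₀) (orbitProj G q)) = e (coframe 𝓘(ℝ, EB) (orbitProj G q₀)
      (orbitProj G q) ((S.gbar EB q).inverse
        ((p.comp (coframe 𝓘(ℝ, E) q₀ q)).comp (S.hl EB q)))) := by
    have h1 := congrArg (fun T : EB →L[ℝ] EB →L[ℝ] ℝ => T (coframe 𝓘(ℝ, EB) (orbitProj G q₀)
      (orbitProj G q) ((S.gbar EB q).inverse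
        ((p.comp (coframe 𝓘(ℝ, E) q₀ q)).comp (S.hl EB q))))) he
    refine Eq.symm (h1.trans (ContinuousLinearMap.ext fun y => ?_))
    rw [pullBil_apply, frame_coframe hq', S.gbar_inverse_gbar hπ]
    rfl
  rw [← he, ContinuousLinearMap.inverse_equiv]
  change coframe 𝓘(ℝ, E) q₀ q (S.cometric EB q (p.comp (coframe 𝓘(ℝ, E) q₀ q)))
    = coframe 𝓘(ℝ, E) q₀ q (S.hl EB q (frame 𝓘(ℝ, EB) (orbitProj G q₀) (orbitProj G q)
      (e.symm (((p.comp (coframe 𝓘(ℝ, E) q₀ q)).comp (S.hl EB q)).comp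
      (frame 𝓘(ℝ, EB) (orbitProj G q₀) (orbitProj G q))))))
  rw [hc, e.symm_apply_apply, frame_coframe hq']
  rfl

theorem contMDiffAt_gen (q₀ : Q) :
    ContMDiffAt 𝓘(ℝ, E) 𝓘(ℝ, EG →L[ℝ] E) ∞
      (fun q => (coframe 𝓘(ℝ, E) q₀ q).comp (gen E EG G q)) q₀ := by
  have h1 : ContMDiffAt (𝓘(ℝ, E).prod 𝓘(ℝ, EG)) 𝓘(ℝ, E) ∞
      (Function.uncurry fun (q : Q) (g : G) => g • q) (q₀, (fun _ : Q => (1 : G)) q₀) :=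
    ((contMDiff_smul (I := 𝓘(ℝ, EG)) (I' := 𝓘(ℝ, E)) (n := ∞) (G := G) (M := Q)).comp
      (contMDiff_snd.prodMk contMDiff_fst)).contMDiffAt
  have h := ContMDiffAt.mfderiv (fun (q : Q) (g : G) => g • q) (fun _ : Q => (1 : G)) (m := ∞)
    h1 contMDiffAt_const (by simp)
  refine h.congr_of_eventuallyEq ?_
  filter_upwards [extChartAt_source_mem_nhds (I := 𝓘(ℝ, E)) q₀] with q hq
  rw [extChartAt_source] at hq
  have h2 := inTangentCoordinates_eq_mfderiv_comp (I := 𝓘(ℝ, EG)) (I' := 𝓘(ℝ, E))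
    (f := fun _ : Q => (1 : G)) (g := fun q : Q => (1 : G) • q)
    (ϕ := fun q => mfderiv 𝓘(ℝ, EG) 𝓘(ℝ, E) (fun g : G => g • q) 1) (x₀ := q₀) (x := q)
    (mem_chart_source EG (1 : G)) (by rw [one_smul, one_smul]; exact hq)
  rw [𝓘(ℝ, EG).range_eq_univ, mfderivWithin_univ] at h2
  refine Eq.symm (h2.trans ?_)
  change (coframe 𝓘(ℝ, E) ((1 : G) • q₀) ((1 : G) • q)).comp
    ((gen E EG G q).comp (frame 𝓘(ℝ, EG) (1 : G) (1 : G))) = _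
  rw [one_smul, one_smul, frame_self]
  rfl

-- The map `(y, ξ) ↦ hl y + ξ_Q` from `EB × EG` to `T_qQ` depends smoothly on `q` and is an
-- isomorphism, by the splitting of `T_qQ`. The connection is the second component of its inverse.
include hπ in
theorem contMDiffAt_conn (q₀ : Q) :
    ContMDiffAt 𝓘(ℝ, E) 𝓘(ℝ, E →L[ℝ] EG) ∞
      (fun q => (S.conn q).comp (frame 𝓘(ℝ, E) q₀ q)) q₀ := by
  have hg := contMDiffAt_gen (E := E) (EG := EG) (G := G) q₀
  have hl := S.contMDiffAt_hl hπ q₀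
  have hT := (contMDiffAt_clm_comp hl (contMDiffAt_const (c := ContinuousLinearMap.fst ℝ EB EG))).add
    (contMDiffAt_clm_comp hg (contMDiffAt_const (c := ContinuousLinearMap.snd ℝ EB EG)))
  let e : (EB × EG) ≃L[ℝ] E := ContinuousLinearEquiv.equivOfInverse
    ((S.hl EB q₀).comp (ContinuousLinearMap.fst ℝ EB EG)
      + (gen E EG G q₀).comp (ContinuousLinearMap.snd ℝ EB EG))
    ((projQ E EB G q₀).prod (S.conn q₀)) (fun x => by
      have h1 : projQ E EB G q₀ (gen E EG G q₀ x.2) = 0 := by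
        have : gen E EG G q₀ x.2 ∈ LinearMap.ker (projQ E EB G q₀).toLinearMap := by
          rw [ker_projQ (EG := EG) hπ]; exact ⟨_, rfl⟩
        exact this
      change ((projQ E EB G q₀) (S.hl EB q₀ x.1 + gen E EG G q₀ x.2),
        (S.conn q₀) (S.hl EB q₀ x.1 + gen E EG G q₀ x.2)) = x
      rw [map_add, map_add, S.projQ_hl hπ, h1, S.conn_of_mem q₀ (S.hl_mem q₀ _), S.conn_gen,
        add_zero, zero_add]) (S.hl_add_gen_conn hπ q₀)
  obtain ⟨hI, hE⟩ := contMDiffAt_inverse hT ⟨e, by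
    simp only [Pi.add_apply, coframe_self, frame_self]; rfl⟩
  refine (contMDiffAt_clm_comp (contMDiffAt_const (c := ContinuousLinearMap.snd ℝ EB EG)) hI
    ).congr_of_eventuallyEq ?_
  filter_upwards [hE, extChartAt_source_mem_nhds (I := 𝓘(ℝ, E)) q₀,
    hπ.contMDiff.contMDiffAt.continuousAt
      (extChartAt_source_mem_nhds (I := 𝓘(ℝ, EB)) (orbitProj G q₀))] with q ⟨e, he⟩ hq hq'
  rw [← he, ContinuousLinearMap.inverse_equiv]
  refine ContinuousLinearMap.ext fun v => ?_
  have h1 : e (coframe 𝓘(ℝ, EB) (orbitProj G q₀) (orbitProj G q)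
      (projQ E EB G q (frame 𝓘(ℝ, E) q₀ q v)), S.conn q (frame 𝓘(ℝ, E) q₀ q v)) = v := by
    have h2 := congrArg (fun T : EB × EG →L[ℝ] E => T (coframe 𝓘(ℝ, EB) (orbitProj G q₀)
      (orbitProj G q) (projQ E EB G q (frame 𝓘(ℝ, E) q₀ q v)),
      S.conn q (frame 𝓘(ℝ, E) q₀ q v))) he
    refine h2.trans ?_
    change coframe 𝓘(ℝ, E) q₀ q (S.hl EB q (frame 𝓘(ℝ, EB) (orbitProj G q₀) (orbitProj G q)
      (coframe 𝓘(ℝ, EB) (orbitProj G q₀) (orbitProj G q) (projQ E EB G q (frame 𝓘(ℝ, E) q₀ q v)))))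
      + coframe 𝓘(ℝ, E) q₀ q (gen E EG G q (S.conn q (frame 𝓘(ℝ, E) q₀ q v))) = v
    rw [frame_coframe hq', ← map_add, S.hl_add_gen_conn hπ, coframe_frame hq]
  have h3 := congrArg e.symm h1
  rw [e.symm_apply_apply] at h3
  change _ = (e.symm v).2
  rw [← h3]
  rfl

end Smoothness

end WeaklyDegenerateChaplyginSystem

end Nonholonomic

/-! ### Smooth maps built on `T*Q`: `red`, `toP`, cotangent lifts, the momentum map, the
Hamiltonian, and local sections of `red`. -/

namespace Nonholonomic

namespace WeaklyDegenerateChaplyginSystem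

section SmoothMaps

variable {E : Type*} [NormedAddCommGroup E] [NormedSpace ℝ E] [FiniteDimensional ℝ E]
  {EG : Type*} [NormedAddCommGroup EG] [NormedSpace ℝ EG] [FiniteDimensional ℝ EG]
  {EB : Type*} [NormedAddCommGroup EB] [NormedSpace ℝ EB] [FiniteDimensional ℝ EB]
  {Q : Type*} [TopologicalSpace Q] [ChartedSpace E Q] [IsManifold 𝓘(ℝ, E) ∞ Q]
  {G : Type*} [TopologicalSpace G] [ChartedSpace EG G] [Group G] [LieGroup 𝓘(ℝ, EG) ∞ G]
  [MulAction G Q] [ContMDiffSMul 𝓘(ℝ, EG) 𝓘(ℝ, E) ∞ G Q] [IsCancelSMul G Q] [ProperSMul G Q]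
  (S : WeaklyDegenerateChaplyginSystem E EG Q G)
  [ChartedSpace EB (OrbitSpace G Q)] [IsManifold 𝓘(ℝ, EB) ∞ (OrbitSpace G Q)]
  (hπ : Manifold.IsSubmersion 𝓘(ℝ, E) 𝓘(ℝ, EB) ∞ (orbitProj G : Q → OrbitSpace G Q))


theorem _root_.Nonholonomic.contMDiffAt_cov (z₀ : CotangentBundle E Q) :
    ContMDiffAt (cotangentModel E) 𝓘(ℝ, E →L[ℝ] ℝ) ∞
      (fun z : CotangentBundle E Q => (cov z).comp (frame 𝓘(ℝ, E) z₀.proj z.proj)) z₀ :=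
  (contMDiffAt_cotangentBundle_iff.1 contMDiffAt_id).2

theorem _root_.Nonholonomic.eventually_proj_mem (z₀ : CotangentBundle E Q) :
    ∀ᶠ z : CotangentBundle E Q in 𝓝 z₀, z.proj ∈ (extChartAt 𝓘(ℝ, E) z₀.proj).source :=
  contMDiff_proj.continuous.continuousAt (extChartAt_source_mem_nhds (I := 𝓘(ℝ, E)) z₀.proj)

theorem _root_.Nonholonomic.contMDiffAt_comp_proj {V : Type*} [NormedAddCommGroup V]
    [NormedSpace ℝ V] {f : Q → V} (z₀ : CotangentBundle E Q)
    (hf : ContMDiffAt 𝓘(ℝ, E) 𝓘(ℝ, V) ∞ f z₀.proj) :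
    ContMDiffAt (cotangentModel E) 𝓘(ℝ, V) ∞ (fun z : CotangentBundle E Q => f z.proj) z₀ :=
  hf.comp z₀ contMDiff_proj.contMDiffAt

include hπ in
theorem contMDiff_red : ContMDiff (cotangentModel E) (cotangentModel EB) ∞ (S.red EB) := by
  intro z₀
  rw [contMDiffAt_cotangentBundle_iff]
  have hp : ContMDiff 𝓘(ℝ, E) 𝓘(ℝ, EB) ∞ (orbitProj G : Q → OrbitSpace G Q) := hπ.contMDiff
  refine ⟨(hp.comp contMDiff_proj).contMDiffAt, ?_⟩
  refine (contMDiffAt_clm_comp (contMDiffAt_cov z₀)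
    (contMDiffAt_comp_proj z₀ (S.contMDiffAt_hl hπ z₀.proj))).congr_of_eventuallyEq ?_
  filter_upwards [eventually_proj_mem z₀] with z hz
  ext y
  simp only [ContinuousLinearMap.comp_apply, frame_coframe hz]
  rfl

include hπ in
theorem contMDiff_toP : ContMDiff (cotangentModel E) (cotangentModel E) ∞ (S.toP EB) := by
  intro z₀
  rw [contMDiffAt_cotangentBundle_iff]
  refine ⟨contMDiff_proj.contMDiffAt, ?_⟩
  refine (contMDiffAt_clm_apply (contMDiffAt_comp_proj z₀ (S.contMDiffAt_bil z₀.proj))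
    (contMDiffAt_clm_apply (contMDiffAt_comp_proj z₀ (S.contMDiffAt_cometric hπ z₀.proj))
      (contMDiffAt_cov z₀))).congr_of_eventuallyEq ?_
  filter_upwards [eventually_proj_mem z₀] with z hz
  ext y
  have h1 : ((cov z).comp (frame 𝓘(ℝ, E) z₀.proj z.proj)).comp (coframe 𝓘(ℝ, E) z₀.proj z.proj)
      = cov z := by
    rw [ContinuousLinearMap.comp_assoc, frame_comp_coframe hz, ContinuousLinearMap.comp_id]
  simp only [ContinuousLinearMap.comp_apply, pullBil_apply, precomp_apply, h1, frame_coframe hz]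
  rfl

include EG in
theorem _root_.Nonholonomic.contMDiff_cotangentLift (g : G) :
    ContMDiff (cotangentModel E) (cotangentModel E) ∞
      (cotangentLift g : CotangentBundle E Q → CotangentBundle E Q) := by
  intro z₀
  rw [contMDiffAt_cotangentBundle_iff]
  have hg := contMDiff_smul_left E EG (Q := Q) g
  refine ⟨(hg.comp contMDiff_proj).contMDiffAt, ?_⟩
  have h1 := contMDiffAt_mfderiv_in_frames
    ((contMDiff_smul_left E EG (Q := Q) g⁻¹).contMDiffAt (x := g • z₀.proj))
  have h2 : ContMDiffAt 𝓘(ℝ, E) 𝓘(ℝ, E →L[ℝ] E) ∞ (fun q => (coframe 𝓘(ℝ, E) z₀.proj q).comp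
      ((act E g⁻¹ (g • q)).comp (frame 𝓘(ℝ, E) (g • z₀.proj) (g • q)))) z₀.proj := by
    have := h1.comp z₀.proj hg.contMDiffAt
    simp only [Function.comp_def, inv_smul_smul] at this
    exact this
  refine (contMDiffAt_clm_comp (contMDiffAt_cov z₀)
    (contMDiffAt_comp_proj z₀ h2)).congr_of_eventuallyEq ?_
  filter_upwards [eventually_proj_mem z₀] with z hz
  ext y
  simp only [ContinuousLinearMap.comp_apply, frame_coframe hz]
  rfl

variable (EG G) in
/-- The momentum map, between the model spaces. -/
def _root_.Nonholonomic.jmap (z : CotangentBundle E Q) : EG →L[ℝ] ℝ :=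
  (cov z).comp (gen E EG G z.proj)

theorem _root_.Nonholonomic.contMDiff_jmap : ContMDiff (cotangentModel E) 𝓘(ℝ, EG →L[ℝ] ℝ) ∞
    (jmap EG G : CotangentBundle E Q → (EG →L[ℝ] ℝ)) := by
  intro z₀
  refine (contMDiffAt_clm_comp (contMDiffAt_cov z₀) (contMDiffAt_comp_proj z₀
    (contMDiffAt_gen (E := E) (EG := EG) (G := G) z₀.proj))).congr_of_eventuallyEq ?_
  filter_upwards [eventually_proj_mem z₀] with z hz
  ext y
  simp only [ContinuousLinearMap.comp_apply, frame_coframe hz]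
  rfl

/-- The extension of the constrained Hamiltonian to `T*Q`. -/
def ham (EB : Type*) [NormedAddCommGroup EB] [NormedSpace ℝ EB] [FiniteDimensional ℝ EB]
    [ChartedSpace EB (OrbitSpace G Q)] (z : CotangentBundle E Q) : ℝ :=
  (1 / 2) * cov z (S.cometric EB z.proj (cov z)) + S.V z.proj

include hπ in
theorem contMDiff_ham : ContMDiff (cotangentModel E) 𝓘(ℝ, ℝ) ∞ (S.ham EB) := by
  intro z₀
  have h1 : ContMDiffAt (cotangentModel E) 𝓘(ℝ, ℝ) ∞
      (fun z : CotangentBundle E Q => cov z (S.cometric EB z.proj (cov z))) z₀ := by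
    refine (contMDiffAt_clm_apply (contMDiffAt_cov z₀) (contMDiffAt_clm_apply
      (contMDiffAt_comp_proj z₀ (S.contMDiffAt_cometric hπ z₀.proj))
      (contMDiffAt_cov z₀))).congr_of_eventuallyEq ?_
    filter_upwards [eventually_proj_mem z₀] with z hz
    have h1 : ((cov z).comp (frame 𝓘(ℝ, E) z₀.proj z.proj)).comp
        (coframe 𝓘(ℝ, E) z₀.proj z.proj) = cov z := by
      rw [ContinuousLinearMap.comp_assoc, frame_comp_coframe hz, ContinuousLinearMap.comp_id]
    simp only [ContinuousLinearMap.comp_apply, precomp_apply, h1, frame_coframe hz]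
  have h2 : ContMDiffAt (cotangentModel E) 𝓘(ℝ, ℝ) ∞
      (fun z : CotangentBundle E Q => S.V z.proj) z₀ := contMDiffAt_comp_proj z₀ (S.V_smooth _)
  exact (contMDiffAt_const.mul h1).add h2

/-- The section of `red` induced by a section of the projection `Q → Q/G`. -/
def _root_.Nonholonomic.cotSection (E : Type*) [NormedAddCommGroup E] [NormedSpace ℝ E]
    [ChartedSpace E Q] (σ : OrbitSpace G Q → Q)
    (x : CotangentBundle EB (OrbitSpace G Q)) : CotangentBundle E Q :=
  mkCov (σ x.proj) ((cov x).comp (projQ E EB G (σ x.proj)))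

include hπ in
theorem red_cotSection {σ : OrbitSpace G Q → Q} {x : CotangentBundle EB (OrbitSpace G Q)}
    (h : orbitProj G (σ x.proj) = x.proj) : S.red EB (cotSection E σ x) = x := by
  refine cotangent_ext h (ContinuousLinearMap.ext fun y => ?_)
  exact congrArg (cov x) (S.projQ_hl hπ _ y)

include hπ in
theorem _root_.Nonholonomic.contMDiffAt_cotSection {σ : OrbitSpace G Q → Q}
    {x₀ : CotangentBundle EB (OrbitSpace G Q)} (hσ : ContMDiffAt 𝓘(ℝ, EB) 𝓘(ℝ, E) ∞ σ x₀.proj)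
    (h : ∀ᶠ x in 𝓝 x₀.proj, orbitProj G (σ x) = x) :
    ContMDiffAt (cotangentModel EB) (cotangentModel E) ∞ (cotSection E σ) x₀ := by
  rw [contMDiffAt_cotangentBundle_iff]
  refine ⟨hσ.comp x₀ contMDiff_proj.contMDiffAt, ?_⟩
  have h1 := (contMDiffAt_mfderiv_in_frames (hπ.contMDiff.contMDiffAt (x := σ x₀.proj))).comp
    x₀.proj hσ
  refine (contMDiffAt_clm_comp (contMDiffAt_cov x₀)
    (contMDiffAt_comp_proj x₀ h1)).congr_of_eventuallyEq ?_
  filter_upwards [eventually_proj_mem x₀, contMDiff_proj.continuous.continuousAt.eventually h]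
    with x hx hx'
  ext y
  simp only [ContinuousLinearMap.comp_apply, Function.comp_apply]
  rw [h.self_of_nhds, hx', frame_coframe hx]
  rfl

end SmoothMaps

end WeaklyDegenerateChaplyginSystem

end Nonholonomic

/-! ### Comparison of `Ω` with the pull-back of `Ω̄` along `red`, and the invariance of `Ξ`. -/

namespace Nonholonomic

/-- The canonical symplectic form, between the model spaces. -/
def omega {E : Type*} [NormedAddCommGroup E] [NormedSpace ℝ E] {M : Type*} [TopologicalSpace M]
    [ChartedSpace E M] [IsManifold 𝓘(ℝ, E) ∞ M] (z : CotangentBundle E M)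
    (u w : E × (E →L[ℝ] ℝ)) : ℝ := canonicalTwoForm z u w

namespace WeaklyDegenerateChaplyginSystem

section ReducedForm

variable {E : Type*} [NormedAddCommGroup E] [NormedSpace ℝ E] [FiniteDimensional ℝ E]
  {EG : Type*} [NormedAddCommGroup EG] [NormedSpace ℝ EG] [FiniteDimensional ℝ EG]
  {EB : Type*} [NormedAddCommGroup EB] [NormedSpace ℝ EB] [FiniteDimensional ℝ EB]
  {Q : Type*} [TopologicalSpace Q] [ChartedSpace E Q] [IsManifold 𝓘(ℝ, E) ∞ Q]
  {G : Type*} [TopologicalSpace G] [ChartedSpace EG G] [Group G] [LieGroup 𝓘(ℝ, EG) ∞ G]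
  [MulAction G Q] [ContMDiffSMul 𝓘(ℝ, EG) 𝓘(ℝ, E) ∞ G Q] [IsCancelSMul G Q] [ProperSMul G Q]
  (S : WeaklyDegenerateChaplyginSystem E EG Q G)
  [ChartedSpace EB (OrbitSpace G Q)] [IsManifold 𝓘(ℝ, EB) ∞ (OrbitSpace G Q)]
  (hπ : Manifold.IsSubmersion 𝓘(ℝ, E) 𝓘(ℝ, EB) ∞ (orbitProj G : Q → OrbitSpace G Q))


/-- The tangent map of `red`, between the model spaces. -/
def redT (EB : Type*) [NormedAddCommGroup EB] [NormedSpace ℝ EB] [FiniteDimensional ℝ EB]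
    [ChartedSpace EB (OrbitSpace G Q)] [IsManifold 𝓘(ℝ, EB) ∞ (OrbitSpace G Q)]
    (z : CotangentBundle E Q) : E × (E →L[ℝ] ℝ) →L[ℝ] EB × (EB →L[ℝ] ℝ) :=
  tmap (cotangentModel E) (cotangentModel EB) (S.red EB) z

include hπ in
theorem projT_redT (z : CotangentBundle E Q) (u : E × (E →L[ℝ] ℝ)) :
    projT (S.red EB z) (S.redT EB z u) = projQ E EB G z.proj (projT z u) := by
  have h1 : tmap (cotangentModel E) 𝓘(ℝ, EB) (fun z => (S.red EB z).proj) z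
      = (projT (S.red EB z)).comp (S.redT EB z) :=
    tmap_comp (contMDiff_proj.mdifferentiable (by simp) _)
      ((S.contMDiff_red hπ).mdifferentiable (by simp) _)
  have h2 : tmap (cotangentModel E) 𝓘(ℝ, EB) (fun z : CotangentBundle E Q => orbitProj G z.proj) z
      = (projQ E EB G z.proj).comp (projT z) :=
    tmap_comp (hπ.contMDiff.mdifferentiable (by simp) _)
      (contMDiff_proj.mdifferentiable (by simp) _)
  exact congrArg (fun T : E × (E →L[ℝ] ℝ) →L[ℝ] EB => T u) (h1.symm.trans h2)

-- `red^*Θ̄ = Θ - ⟨J, 𝒜⟩`: pairing `z` with the horizontal part of `Tπ_Q(u)` means subtracting its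
-- pairing with the vertical part `(𝒜(Tπ_Q u))_Q`.
include hπ in
theorem liouville_red (z : CotangentBundle E Q) :
    (liouville (S.red EB z)).comp (S.redT EB z)
      = liouville z + (-jmap EG G z).comp ((S.conn z.proj).comp (projT z)) := by
  refine ContinuousLinearMap.ext fun u => ?_
  change cov (S.red EB z) (projT (S.red EB z) (S.redT EB z u))
    = cov z (projT z u) + -(cov z (gen E EG G z.proj (S.conn z.proj (projT z u))))
  rw [S.projT_redT hπ]
  conv_rhs => enter [1]; rw [← S.hl_add_gen_conn hπ z.proj (projT z u), map_add]
  rw [add_neg_cancel_right]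
  rfl

variable {V : Type*} [NormedAddCommGroup V] [NormedSpace ℝ V]

theorem _root_.Nonholonomic.contMDiffAt_comp_projT {θ : Q → (E →L[ℝ] V)} {z₀ : CotangentBundle E Q}
    (h : ContMDiffAt 𝓘(ℝ, E) 𝓘(ℝ, E →L[ℝ] V) ∞
      (fun q => (θ q).comp (frame 𝓘(ℝ, E) z₀.proj q)) z₀.proj) :
    ContMDiffAt (cotangentModel E) 𝓘(ℝ, E × (E →L[ℝ] ℝ) →L[ℝ] V) ∞
      (fun z : CotangentBundle E Q => ((θ z.proj).comp (projT z)).comp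
        (frame (cotangentModel E) z₀ z)) z₀ := by
  refine (contMDiffAt_clm_comp (contMDiffAt_comp_proj z₀ h) (contMDiffAt_const
    (c := ContinuousLinearMap.fst ℝ E (E →L[ℝ] ℝ)))).congr_of_eventuallyEq ?_
  filter_upwards [eventually_proj_mem z₀] with z hz
  refine ContinuousLinearMap.ext fun u => ?_
  simp only [ContinuousLinearMap.comp_apply, projT_frame hz]
  rfl

include hπ in
theorem differentiableAt_formInChart_conn (q : Q) :
    DifferentiableAt ℝ (formInChart 𝓘(ℝ, E) S.conn q) (extChartAt 𝓘(ℝ, E) q q) :=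
  (contDiffAt_formInChart (mem_extChartAt_source (I := 𝓘(ℝ, E)) q)
    (S.contMDiffAt_conn hπ q)).differentiableAt (by simp)

-- The exterior derivative of `liouville_red`. The hypotheses on `u` and `w` say that `𝒜` kills
-- their projections, so that of `d⟨J, 𝒜⟩` only `⟨J, d𝒜⟩` survives (`extD_comp_of_eq_zero`).
include hπ in
theorem omega_eq (z : CotangentBundle E Q) {u w : E × (E →L[ℝ] ℝ)} (hu : projT z u ∈ S.dist z.proj)
    (hw : projT z w ∈ S.dist z.proj) :
    omega z u w = omega (S.red EB z) (S.redT EB z u) (S.redT EB z w)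
      - jmap EG G z (extD 𝓘(ℝ, E) S.conn z.proj (projT z u) (projT z w)) := by
  have hη := contMDiffAt_comp_projT (S.contMDiffAt_conn hπ z.proj)
  have hj : ContMDiffAt (cotangentModel E) 𝓘(ℝ, EG →L[ℝ] ℝ) ∞
      (fun z : CotangentBundle E Q => -jmap EG G z) z := contMDiff_jmap.contMDiffAt.neg
  have hmem := mem_extChartAt_source (I := cotangentModel E) z
  have hηd := (contDiffAt_formInChart hmem hη).differentiableAt (by simp)
  have hjη : ContMDiffAt (cotangentModel E) 𝓘(ℝ, E × (E →L[ℝ] ℝ) →L[ℝ] ℝ) ∞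
      (fun y : CotangentBundle E Q => ((-jmap EG G y).comp
        ((S.conn y.proj).comp (projT y))).comp (frame (cotangentModel E) z y)) z :=
    (contMDiffAt_clm_comp hj hη :)
  have hjηd := (contDiffAt_formInChart hmem hjη).differentiableAt (by simp)
  have h1 := extD_pullback (J := cotangentModel E) (S.contMDiff_red hπ (EB := EB)).contMDiffAt
    (differentiableAt_formInChart_liouville (S.red EB z))
    (Filter.Eventually.of_forall fun y => (S.liouville_red hπ (EB := EB) y).symm) u w
  rw [extD_add (differentiableAt_formInChart_liouville z) hjηd,
    extD_comp_of_eq_zero (hj.mdifferentiableAt (by simp)) hηd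
      (S.conn_of_mem _ hu) (S.conn_of_mem _ hw)] at h1
  have h2 := extD_pullback (J := cotangentModel E) (F := fun z : CotangentBundle E Q => z.proj)
    contMDiff_proj.contMDiffAt (S.differentiableAt_formInChart_conn hπ z.proj)
    (θ' := fun y => (S.conn y.proj).comp (projT y)) (Filter.Eventually.of_forall fun y => rfl) u w
  rw [h2] at h1
  change -extD (cotangentModel E) liouville z u w = -extD (cotangentModel EB) liouville (S.red EB z)
    (S.redT EB z u) (S.redT EB z w) - _
  have h3 : extD (cotangentModel E) liouville z u w - jmap EG G z (extD 𝓘(ℝ, E) S.conn z.proj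
      (projT z u) (projT z w)) = extD (cotangentModel EB) liouville (S.red EB z)
    (S.redT EB z u) (S.redT EB z w) := (sub_eq_add_neg _ _).trans h1
  rw [← h3]
  ring

/-! ### Invariance -/

/-- The tangent map of the cotangent lift, between the model spaces. -/
def _root_.Nonholonomic.liftT (g : G) (z : CotangentBundle E Q) :
    E × (E →L[ℝ] ℝ) →L[ℝ] E × (E →L[ℝ] ℝ) :=
  tmap (cotangentModel E) (cotangentModel E)
    (cotangentLift g : CotangentBundle E Q → CotangentBundle E Q) z

include EG in
theorem _root_.Nonholonomic.projT_liftT (g : G) (z : CotangentBundle E Q)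
    (u : E × (E →L[ℝ] ℝ)) :
    projT (cotangentLift g z) (liftT g z u) = act E g z.proj (projT z u) := by
  have h1 : tmap (cotangentModel E) 𝓘(ℝ, E)
      (fun z : CotangentBundle E Q => (cotangentLift g z).proj) z
      = (projT (cotangentLift g z)).comp (liftT g z) :=
    tmap_comp (contMDiff_proj.mdifferentiable (by simp) _)
      ((contMDiff_cotangentLift (EG := EG) g).mdifferentiable (by simp) _)
  have h2 : tmap (cotangentModel E) 𝓘(ℝ, E) (fun z : CotangentBundle E Q => g • z.proj) z
      = (act E g z.proj).comp (projT z) :=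
    tmap_comp ((contMDiff_smul_left E EG g).mdifferentiable (by simp) _)
      (contMDiff_proj.mdifferentiable (by simp) _)
  exact congrArg (fun T : E × (E →L[ℝ] ℝ) →L[ℝ] E => T u) (h1.symm.trans h2)

-- Cotangent lifts preserve the Liouville form itself, and `d` commutes with pull-back.
include S in
theorem omega_liftT (g : G) (z : CotangentBundle E Q) (u w : E × (E →L[ℝ] ℝ)) :
    omega (cotangentLift g z) (liftT g z u) (liftT g z w) = omega z u w := by
  have h : ∀ (y : CotangentBundle E Q) (u : E × (E →L[ℝ] ℝ)), liouville y u
      = liouville (cotangentLift g y) (liftT g y u) := by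
    intro y u
    change cov y (projT y u) = cov y (act E g⁻¹ (g • y.proj) (projT (cotangentLift g y)
      (liftT g y u)))
    rw [projT_liftT (EG := EG), S.act_inv_act]
  exact congrArg Neg.neg (Eq.symm (extD_pullback (J := cotangentModel E)
    (contMDiff_cotangentLift (EG := EG) g).contMDiffAt
    (differentiableAt_formInChart_liouville (cotangentLift g z))
    (Filter.Eventually.of_forall fun y => ContinuousLinearMap.ext fun u => h y u) u w))

include hπ in
theorem red_cotangentLift (g : G) (z : CotangentBundle E Q) :
    S.red EB (cotangentLift g z) = S.red EB z := by
  refine cotangent_ext (orbitProj_smul g z.proj) (ContinuousLinearMap.ext fun y => ?_)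
  change cov z (act E g⁻¹ (g • z.proj) (S.hl EB (g • z.proj) y)) = cov z (S.hl EB z.proj y)
  rw [S.hl_smul hπ, S.act_inv_act]

include hπ in
theorem redT_liftT (g : G) (z : CotangentBundle E Q) (u : E × (E →L[ℝ] ℝ)) :
    S.redT EB (cotangentLift g z) (liftT g z u) = S.redT EB z u := by
  have h1 := tmap_comp (I := cotangentModel EB) (J := cotangentModel E) (K := cotangentModel E)
    (F := S.red EB) (F' := cotangentLift g) (l := z)
    ((S.contMDiff_red hπ).mdifferentiable (by simp) _)
    ((contMDiff_cotangentLift (EG := EG) g).mdifferentiable (by simp) _)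
  simp only [S.red_cotangentLift hπ] at h1
  exact (congrArg (fun T : E × (E →L[ℝ] ℝ) →L[ℝ] EB × (EB →L[ℝ] ℝ) => T u) h1).symm

-- By `omega_eq`, `⟨J, d𝒜⟩` on horizontal vectors is the difference of `red^*Ω̄` and `Ω`, both
-- invariant under cotangent lifts. This gives the invariance without the adjoint equivariance of
-- `𝒜` and `J`.
include hπ in
theorem jmap_curvature_smul (g : G) (z : CotangentBundle E Q) {v v' : E}
    (hv : v ∈ S.dist z.proj) (hv' : v' ∈ S.dist z.proj) :
    jmap EG G (cotangentLift g z) (extD 𝓘(ℝ, E) S.conn (g • z.proj) (act E g z.proj v)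
      (act E g z.proj v')) = jmap EG G z (extD 𝓘(ℝ, E) S.conn z.proj v v') := by
  -- Any lift of `v` to `T_z T*Q` would do; in the canonical chart at `z` the vector `(v, 0)` is
  -- one.
  have hp : ∀ v : E, projT z (v, 0) = v := fun v => by rw [projT_self]; rfl
  have h1 := S.omega_eq hπ (EB := EB) z (u := (v, 0)) (w := (v', 0)) (by rwa [hp]) (by rwa [hp])
  have h2 := S.omega_eq hπ (EB := EB) (cotangentLift g z) (u := liftT g z (v, 0))
    (w := liftT g z (v', 0)) (by rw [projT_liftT (EG := EG), hp]; exact S.act_mem _ _ hv)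
    (by rw [projT_liftT (EG := EG), hp]; exact S.act_mem _ _ hv')
  rw [S.omega_liftT, S.redT_liftT hπ, S.redT_liftT hπ, projT_liftT (EG := EG),
    projT_liftT (EG := EG), hp, hp, S.red_cotangentLift hπ] at h2
  rw [hp, hp] at h1
  have h3 := h1.symm.trans h2
  exact (sub_right_injective h3).symm

/-- `xiAt`, between the model spaces. -/
def xi (q : Q) (α : EB →L[ℝ] ℝ) (y y' : EB) : ℝ :=
  S.hlCov EB q α (gen E EG G q (extD 𝓘(ℝ, E) S.conn q (S.hl EB q y) (S.hl EB q y')))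

theorem xi_eq_xiAt (q : Q) (α : EB →L[ℝ] ℝ) (y y' : EB) : S.xi q α y y' = S.xiAt q α y y' := by
  have h : ∀ y : EB, S.hor q (S.hl EB q y) = S.hl EB q y := fun y => S.hor_of_mem q (S.hl_mem q y)
  change _ = S.hlCov EB q α (gen E EG G q (extD 𝓘(ℝ, E) S.conn q (S.hor q (S.hl EB q y))
    (S.hor q (S.hl EB q y'))))
  rw [h, h]
  rfl

-- Both sides lie in `P` over the same point and have the same image under `red`, which determines
-- the covector.
include hπ in
theorem cotangentLift_hlCov (g : G) (q : Q) (α : EB →L[ℝ] ℝ) :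
    cotangentLift g (mkCov q (S.hlCov EB q α) : CotangentBundle E Q)
      = mkCov (g • q) (S.hlCov EB (g • q) α) := by
  refine cotangent_ext rfl ?_
  have h1 := S.hlCov_red (EB := EB) hπ (S.mem_P_cotangentLift g (S.mkCov_hlCov_mem hπ q α))
  have h2 := congrArg cov ((S.red_cotangentLift hπ g (mkCov q (S.hlCov EB q α))).trans
    (S.red_hlCov hπ q α))
  exact h1.symm.trans (congrArg (S.hlCov EB (g • q)) h2)

include hπ in
theorem xi_smul (g : G) (q : Q) (α : EB →L[ℝ] ℝ) (y y' : EB) :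
    S.xi (g • q) α y y' = S.xi q α y y' := by
  have h := S.jmap_curvature_smul hπ g (mkCov q (S.hlCov EB q α)) (S.hl_mem q y) (S.hl_mem q y')
  rw [S.cotangentLift_hlCov hπ] at h
  rw [xi, S.hl_smul hπ, S.hl_smul hπ]
  exact h

include hπ in
theorem xi_eq_of_orbitProj_eq {q q' : Q} (h : orbitProj G q = orbitProj G q') (α : EB →L[ℝ] ℝ)
    (y y' : EB) : S.xi q α y y' = S.xi q' α y y' := by
  obtain ⟨g, rfl⟩ := exists_smul_eq_of_orbitProj_eq h
  exact (S.xi_smul hπ g q α y y').symm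

theorem Xi_eq_xi_out (x : CotangentBundle EB (OrbitSpace G Q)) (u w : EB × (EB →L[ℝ] ℝ)) :
    S.Xi x u w = S.xi x.proj.out (cov x) (projT x u) (projT x w) :=
  (S.xi_eq_xiAt _ _ _ _).symm

include hπ in
theorem Xi_eq_xi {x : CotangentBundle EB (OrbitSpace G Q)} {q : Q} (h : orbitProj G q = x.proj)
    (u w : EB × (EB →L[ℝ] ℝ)) : S.Xi x u w = S.xi q (cov x) (projT x u) (projT x w) :=
  (S.Xi_eq_xi_out x u w).trans
    (S.xi_eq_of_orbitProj_eq hπ ((orbitProj_out _).trans h.symm) _ _ _)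

include hπ in
theorem Xi_eq_xiAt (q : Q) (α : EB →L[ℝ] ℝ) (u w : EB × (EB →L[ℝ] ℝ)) :
    S.Xi (mkCov (orbitProj G q) α) u w = S.xiAt q α
      (projT (mkCov (orbitProj G q) α : CotangentBundle EB (OrbitSpace G Q)) u)
      (projT (mkCov (orbitProj G q) α : CotangentBundle EB (OrbitSpace G Q)) w) :=
  (S.Xi_eq_xi hπ rfl u w).trans (S.xi_eq_xiAt q α _ _)

/-- `OmegaNH`, between the model spaces. -/
def omegaNH (x : CotangentBundle EB (OrbitSpace G Q)) (u w : EB × (EB →L[ℝ] ℝ)) : ℝ :=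
  S.OmegaNH x u w

-- At a point of `P` the covector is `hl^P` of its restriction, and horizontal vectors are the lifts
-- of their projections. The correction `⟨J, d𝒜⟩` in `omega_eq` is then exactly `Ξ`.
include hπ in
theorem omega_eq_omegaNH (z : S.P) {u w : E × (E →L[ℝ] ℝ)}
    (hu : projT z.1 u ∈ S.dist z.1.proj) (hw : projT z.1 w ∈ S.dist z.1.proj) :
    omega z.1 u w = S.omegaNH (S.red EB z.1) (S.redT EB z.1 u) (S.redT EB z.1 w) := by
  rw [S.omega_eq hπ (EB := EB) z.1 hu hw]
  refine congrArg (fun t => omega (S.red EB z.1) (S.redT EB z.1 u) (S.redT EB z.1 w) - t) ?_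
  refine Eq.symm ((S.Xi_eq_xi hπ (q := z.1.proj) rfl _ _).trans ?_)
  rw [S.projT_redT hπ, S.projT_redT hπ, xi, S.hl_projQ hπ _ hu, S.hl_projQ hπ _ hw]
  exact congrArg (fun p : E →L[ℝ] ℝ => p (gen E EG G z.1.proj (extD 𝓘(ℝ, E) S.conn z.1.proj
    (projT z.1 u) (projT z.1 w)))) (S.hlCov_red hπ z.2)

end ReducedForm

end WeaklyDegenerateChaplyginSystem

end Nonholonomic

/-! ### Smoothness of exterior derivatives, and graphs of two-forms as Dirac structures. -/

namespace Nonholonomic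

section Forms

variable {EM : Type*} [NormedAddCommGroup EM] [NormedSpace ℝ EM]
  {HM : Type*} [TopologicalSpace HM] {I : ModelWithCorners ℝ EM HM} [I.Boundaryless]
  {M : Type*} [TopologicalSpace M] [ChartedSpace HM M] [IsManifold I ∞ M]
  {V : Type*} [NormedAddCommGroup V] [NormedSpace ℝ V]

/-- This is the derivative of a change of charts; it shows that the frame of the chart at `x₀` is
smooth at every point of its domain. -/
theorem contMDiffAt_coframe_comp_frame {x₀ x₁ : M} (h : x₁ ∈ (extChartAt I x₀).source) :
    ContMDiffAt I 𝓘(ℝ, EM →L[ℝ] EM) ∞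
      (fun x => (coframe I x₁ x).comp (frame I x₀ x)) x₁ := by
  have h0 : (extChartAt I x₀).symm (extChartAt I x₀ x₁) = x₁ := (extChartAt I x₀).left_inv h
  have h1 := contMDiffAt_mfderiv_in_frames
    (contMDiffAt_extChartAt_symm_of_mem ((extChartAt I x₀).map_source h))
  have h2 : ContMDiffAt I 𝓘(ℝ, EM) ∞ (extChartAt I x₀) x₁ :=
    contMDiffAt_extChartAt' (by rwa [← extChartAt_source I])
  refine (h1.comp x₁ h2).congr_of_eventuallyEq ?_
  filter_upwards [(isOpen_extChartAt_source (I := I) x₀).mem_nhds h] with x hx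
  have h3 : (extChartAt I x₀).symm (extChartAt I x₀ x) = x := (extChartAt I x₀).left_inv hx
  have h4 : frame 𝓘(ℝ, EM) (extChartAt I x₀ x₁) (extChartAt I x₀ x) = ContinuousLinearMap.id ℝ EM := by
    have : frame 𝓘(ℝ, EM) (extChartAt I x₀ x₁) (extChartAt I x₀ x)
      = tmap 𝓘(ℝ, EM) 𝓘(ℝ, EM) (fun y : EM => y) (extChartAt I x₀ x) := by
      rfl
    rw [this, tmap_id]
  simp only [Function.comp_apply]
  rw [h0, h3, h4, ContinuousLinearMap.comp_id]
  rfl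

variable (I) in
/-- The exterior derivative, as a continuous bilinear form. -/
def extDL (θ : M → (EM →L[ℝ] V)) (x : M) : EM →L[ℝ] EM →L[ℝ] V :=
  fderiv ℝ (formInChart I θ x) (extChartAt I x x)
    - (fderiv ℝ (formInChart I θ x) (extChartAt I x x)).flip

theorem extDL_apply (θ : M → (EM →L[ℝ] V)) (x : M) (u w : EM) :
    extDL I θ x u w = extD I θ x u w := by
  rw [extD_self_chart]
  rfl

theorem isBoundedLinearMap_flip :
    IsBoundedLinearMap ℝ (fun A : EM →L[ℝ] EM →L[ℝ] V => A.flip) :=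
  { map_add := fun _ _ => rfl
    map_smul := fun _ _ => rfl
    bound := ⟨1, one_pos, fun A => by rw [ContinuousLinearMap.opNorm_flip, one_mul]⟩ }

theorem contDiff_flip : ContDiff ℝ ∞ (fun A : EM →L[ℝ] EM →L[ℝ] V => A.flip) :=
  isBoundedLinearMap_flip.contDiff

theorem contMDiffAt_extDL {θ : M → (EM →L[ℝ] V)}
    (hθ : ∀ x₀, ContMDiffAt I 𝓘(ℝ, EM →L[ℝ] V) ∞ (fun x => (θ x).comp (frame I x₀ x)) x₀)
    (x₀ : M) :
    ContMDiffAt I 𝓘(ℝ, EM →L[ℝ] EM →L[ℝ] V) ∞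
      (fun x => pullBil (extDL I θ x) (frame I x₀ x)) x₀ := by
  have hs := mem_extChartAt_source (I := I) x₀
  have h1 : ContDiffAt ℝ ∞ (fderiv ℝ (formInChart I θ x₀)) (extChartAt I x₀ x₀) :=
    (contDiffAt_formInChart hs (hθ x₀)).fderiv_right (by simp)
  have h2 : ContDiffAt ℝ ∞ (fun y => fderiv ℝ (formInChart I θ x₀) y
      - (fderiv ℝ (formInChart I θ x₀) y).flip) (extChartAt I x₀ x₀) :=
    h1.sub (contDiff_flip.contDiffAt.comp _ h1)
  refine (h2.contMDiffAt.comp x₀ contMDiffAt_extChartAt).congr_of_eventuallyEq ?_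
  filter_upwards [extChartAt_source_mem_nhds (I := I) x₀] with x hx
  ext u w
  rw [pullBil_apply, extDL_apply, extD_frame hx
    ((contDiffAt_formInChart (mem_extChartAt_source x) (hθ x)).differentiableAt (by simp))]
  rfl

/-- The graph of a smooth two-form is a Dirac structure. -/
theorem isDiracStructure_graph {B : M → (EM →L[ℝ] EM →L[ℝ] ℝ)}
    (hB : ∀ x u w, B x w u = -B x u w)
    (hs : ∀ x₀, ContMDiffAt I 𝓘(ℝ, EM →L[ℝ] EM →L[ℝ] ℝ) ∞
      (fun x => pullBil (B x) (frame I x₀ x)) x₀) :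
    IsDiracStructure I (fun x : M => {a : TangentSpace I x × CotangentSpace I x |
      ∀ w : EM, a.2 w = B x a.1 w}) := by
  refine ⟨fun x => Set.ext fun a => ⟨fun h w => ?_, fun h b hb => ?_⟩, fun x₀ a ha => ?_⟩
  -- Testing orthogonality against the graph element `(w, B w)`, for all `w`, recovers the equation
  -- of the graph.
  · have h1 : (B x w : EM →L[ℝ] ℝ) a.1 + a.2 w = 0 := h (w, B x w) fun w' => rfl
    have h2 : B x w a.1 = - B x a.1 w := hB x a.1 w
    linarith
  · have h1 : b.2 a.1 = B x b.1 a.1 := hb a.1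
    have h2 : a.2 b.1 = B x a.1 b.1 := h b.1
    have h3 : B x b.1 a.1 = - B x a.1 b.1 := hB x a.1 b.1
    change b.2 a.1 + a.2 b.1 = 0
    linarith
  -- The element is extended by keeping its tangent component constant in the coordinates at `x₀`
  -- and taking the covector given by `B`.
  · let u : EM := a.1
    have hsm : ∀ x₁ ∈ (extChartAt I x₀).source, ContMDiffAt I 𝓘(ℝ, EM) ∞
        (fun x => coframe I x₁ x (frame I x₀ x u)) x₁ := fun x₁ h =>
      (contMDiffAt_clm_apply (contMDiffAt_coframe_comp_frame h) (contMDiffAt_const (c := u)) :)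
    refine ⟨(extChartAt I x₀).source, fun x => frame I x₀ x u, fun x => B x (frame I x₀ x u),
      isOpen_extChartAt_source x₀, mem_extChartAt_source x₀, fun x₁ h => ?_, fun x₁ h => ?_, ?_,
      fun x _ w => rfl⟩
    · exact ContMDiffAt.contMDiffWithinAt
        (contMDiffAt_tangentBundle_iff.2 ⟨contMDiffAt_id, hsm x₁ h⟩)
    · refine ContMDiffAt.contMDiffWithinAt (contMDiffAt_oneForm_iff.2 ⟨contMDiffAt_id, ?_⟩)
      refine (contMDiffAt_clm_apply (hs x₁) (hsm x₁ h)).congr_of_eventuallyEq ?_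
      filter_upwards [extChartAt_source_mem_nhds (I := I) x₁] with x hx
      refine ContinuousLinearMap.ext fun w => ?_
      rw [pullBil_apply, frame_coframe hx]
      rfl
    · have h1 : frame I x₀ x₀ u = u := by rw [frame_self]; rfl
      refine Prod.ext h1 (ContinuousLinearMap.ext fun w => ?_)
      exact (congrArg (fun v : EM => B x₀ v w) h1).trans (ha w).symm

end Forms

end Nonholonomic

/-! ### Non-degeneracy and smoothness of `Ω̄ - Ξ`. -/

namespace Nonholonomic

set_option maxSynthPendingDepth 3

/-- The canonical symplectic form of `E × E*`. -/
def symp (E : Type*) [NormedAddCommGroup E] [NormedSpace ℝ E] :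
    E × (E →L[ℝ] ℝ) →L[ℝ] E × (E →L[ℝ] ℝ) →L[ℝ] ℝ :=
  let A : E × (E →L[ℝ] ℝ) →L[ℝ] E × (E →L[ℝ] ℝ) →L[ℝ] ℝ :=
    (precomp (ContinuousLinearMap.snd ℝ E (E →L[ℝ] ℝ))).comp
      ((ContinuousLinearMap.apply ℝ ℝ).comp (ContinuousLinearMap.fst ℝ E (E →L[ℝ] ℝ)))
  A - A.flip

theorem symp_apply {E : Type*} [NormedAddCommGroup E] [NormedSpace ℝ E]
    (u w : E × (E →L[ℝ] ℝ)) : symp E u w = w.2 u.1 - u.2 w.1 := rfl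

theorem omega_frame {E : Type*} [NormedAddCommGroup E] [NormedSpace ℝ E] {M : Type*}
    [TopologicalSpace M] [ChartedSpace E M] [IsManifold 𝓘(ℝ, E) ∞ M] {z₀ z : CotangentBundle E M}
    (hz : z.proj ∈ (extChartAt 𝓘(ℝ, E) z₀.proj).source) (u w : E × (E →L[ℝ] ℝ)) :
    omega z (frame (cotangentModel E) z₀ z u) (frame (cotangentModel E) z₀ z w) = symp E u w :=
  canonicalTwoForm_frame hz u w

/-- The frame at `z` of the canonical chart at `z` is the identity, so the constancy of `Ω` in
charts applies directly to the model space. -/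
theorem omega_eq_symp {E : Type*} [NormedAddCommGroup E] [NormedSpace ℝ E] {M : Type*}
    [TopologicalSpace M] [ChartedSpace E M] [IsManifold 𝓘(ℝ, E) ∞ M] (z : CotangentBundle E M)
    (u w : E × (E →L[ℝ] ℝ)) : omega z u w = symp E u w := by
  have h := omega_frame (z₀ := z) (z := z) (mem_extChartAt_source _) u w
  rwa [frame_self] at h

namespace WeaklyDegenerateChaplyginSystem

section NonDegenerate

variable {E : Type*} [NormedAddCommGroup E] [NormedSpace ℝ E] [FiniteDimensional ℝ E]
  {EG : Type*} [NormedAddCommGroup EG] [NormedSpace ℝ EG] [FiniteDimensional ℝ EG]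
  {EB : Type*} [NormedAddCommGroup EB] [NormedSpace ℝ EB] [FiniteDimensional ℝ EB]
  {Q : Type*} [TopologicalSpace Q] [ChartedSpace E Q] [IsManifold 𝓘(ℝ, E) ∞ Q]
  {G : Type*} [TopologicalSpace G] [ChartedSpace EG G] [Group G] [LieGroup 𝓘(ℝ, EG) ∞ G]
  [MulAction G Q] [ContMDiffSMul 𝓘(ℝ, EG) 𝓘(ℝ, E) ∞ G Q] [IsCancelSMul G Q] [ProperSMul G Q]
  (S : WeaklyDegenerateChaplyginSystem E EG Q G)
  [ChartedSpace EB (OrbitSpace G Q)] [IsManifold 𝓘(ℝ, EB) ∞ (OrbitSpace G Q)]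
  (hπ : Manifold.IsSubmersion 𝓘(ℝ, E) 𝓘(ℝ, EB) ∞ (orbitProj G : Q → OrbitSpace G Q))


/-- `xi`, as a continuous bilinear form. -/
def xiL (q : Q) (α : EB →L[ℝ] ℝ) : EB →L[ℝ] EB →L[ℝ] ℝ :=
  postBil (jmap EG G (mkCov q (S.hlCov EB q α)))
    (pullBil (extDL 𝓘(ℝ, E) S.conn q) (S.hl EB q))

theorem xiL_apply (q : Q) (α : EB →L[ℝ] ℝ) (y y' : EB) : S.xiL q α y y' = S.xi q α y y' := by
  rw [xiL, postBil_apply, pullBil_apply, extDL_apply]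
  rfl

/-- `omegaNH`, as a continuous bilinear form. -/
def omegaNHL (x : CotangentBundle EB (OrbitSpace G Q)) :
    EB × (EB →L[ℝ] ℝ) →L[ℝ] EB × (EB →L[ℝ] ℝ) →L[ℝ] ℝ :=
  symp EB - pullBil (S.xiL x.proj.out (cov x)) (projT x)

theorem omegaNHL_apply (x : CotangentBundle EB (OrbitSpace G Q)) (u w : EB × (EB →L[ℝ] ℝ)) :
    S.omegaNHL x u w = S.omegaNH x u w := by
  have h1 : omega x u w = symp EB u w := omega_eq_symp x u w
  have h2 : pullBil (S.xiL x.proj.out (cov x)) (projT x) u w = S.Xi x u w := by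
    rw [pullBil_apply, xiL_apply]
    exact (S.Xi_eq_xi_out x u w).symm
  change symp EB u w - pullBil (S.xiL x.proj.out (cov x)) (projT x) u w = omega x u w - S.Xi x u w
  rw [h1, h2]

theorem omegaNHL_skew (x : CotangentBundle EB (OrbitSpace G Q)) (u w : EB × (EB →L[ℝ] ℝ)) :
    S.omegaNHL x w u = -S.omegaNHL x u w := by
  have h : ∀ y y', S.xiL x.proj.out (cov x) y' y = -S.xiL x.proj.out (cov x) y y' := by
    intro y y'
    rw [xiL, postBil_apply, postBil_apply, pullBil_apply, pullBil_apply, ← map_neg]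
    refine congrArg _ ?_
    exact (neg_sub _ _).symm
  change symp EB w u - S.xiL x.proj.out (cov x) (projT x w) (projT x u)
    = -(symp EB u w - S.xiL x.proj.out (cov x) (projT x u) (projT x w))
  rw [h (projT x u) (projT x w), symp_apply, symp_apply]
  ring

/-- `Ξ` vanishes when one argument is vertical. Pairing with vertical vectors `(0, g)` therefore
involves only `Ω̄` and forces `u.1 = 0`; then `Ξ` disappears altogether and the vectors `(y, 0)`
force `u.2 = 0`. -/
theorem omegaNHL_nondegenerate (x : CotangentBundle EB (OrbitSpace G Q))
    {u : EB × (EB →L[ℝ] ℝ)} (h : ∀ w, S.omegaNHL x u w = 0) : u = 0 := by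
  have h0 : ∀ w : EB × (EB →L[ℝ] ℝ), w.2 u.1 - u.2 w.1 - S.xiL x.proj.out (cov x) u.1 w.1 = 0 := by
    intro w
    have h1 := h w
    rw [omegaNHL, projT_self] at h1
    exact h1
  have h1 : u.1 = 0 := by
    by_contra hne
    obtain ⟨g, hg⟩ := SeparatingDual.exists_ne_zero (R := ℝ) hne
    have h2 := h0 (0, g)
    simp only [map_zero, sub_zero] at h2
    exact hg h2
  have h2 : u.2 = 0 := by
    ext y
    have h3 := h0 (y, 0)
    rw [h1] at h3
    simp at h3
    simpa using h3
  exact Prod.ext h1 h2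

-- Sections of `π` replace the representative `x.out`, which need not vary continuously.
-- Horizontality of the derivative at the base point matters only for lifting vectors into `ℋ`.
include hπ in
theorem exists_horizontal_section (q : Q) : ∃ σ : OrbitSpace G Q → Q, σ (orbitProj G q) = q ∧
    ContMDiffAt 𝓘(ℝ, EB) 𝓘(ℝ, E) ∞ σ (orbitProj G q) ∧
    (∀ᶠ x in 𝓝 (orbitProj G q), orbitProj G (σ x) = x) ∧
    tmap 𝓘(ℝ, EB) 𝓘(ℝ, E) σ (orbitProj G q) = S.hl EB q :=
  exists_local_section (hπ.isSubmersionAt q)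
    (ContinuousLinearMap.ext fun y => S.projQ_hl hπ q y)

include hπ in
theorem toP_cotSection {σ : OrbitSpace G Q → Q} {x : CotangentBundle EB (OrbitSpace G Q)}
    (h : orbitProj G (σ x.proj) = x.proj) :
    S.toP EB (cotSection E σ x) = mkCov (σ x.proj) (S.hlCov EB (σ x.proj) (cov x)) := by
  refine cotangent_ext rfl ?_
  have h1 := S.hlCov_red (EB := EB) hπ (S.toP_mem hπ (EB := EB) (cotSection E σ x))
  have h2 := congrArg cov ((S.red_toP hπ (EB := EB) (cotSection E σ x)).trans
    (S.red_cotSection hπ h))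
  exact h1.symm.trans (congrArg (S.hlCov EB (σ x.proj)) h2)

-- Independence of the representative allows `Ξ` to be evaluated at `σ x` for a smooth local section
-- `σ`; there `J ∘ hl^P` is `jmap` composed with `toP` and the induced section `cotSection` of
-- `red`, all smooth.
include hπ in
theorem contMDiffAt_xiL (x₀ : CotangentBundle EB (OrbitSpace G Q)) :
    ContMDiffAt (cotangentModel EB) 𝓘(ℝ, EB →L[ℝ] EB →L[ℝ] ℝ) ∞
      (fun x : CotangentBundle EB (OrbitSpace G Q) => pullBil (S.xiL x.proj.out (cov x))
        (frame 𝓘(ℝ, EB) x₀.proj x.proj)) x₀ := by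
  obtain ⟨σ, hσ₀, hσ, hpσ, -⟩ := S.exists_horizontal_section hπ (EB := EB) x₀.proj.out
  rw [orbitProj_out] at hσ₀ hσ hpσ
  have hJ : ContMDiffAt (cotangentModel EB) 𝓘(ℝ, EG →L[ℝ] ℝ) ∞
      (fun x => jmap EG G (S.toP EB (cotSection E σ x))) x₀ :=
    contMDiff_jmap.contMDiffAt.comp x₀ ((S.contMDiff_toP hπ).contMDiffAt.comp x₀
      (contMDiffAt_cotSection hπ hσ hpσ))
  have hK := contMDiffAt_pullBil (contMDiffAt_extDL (S.contMDiffAt_conn hπ) (σ x₀.proj))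
    (S.contMDiffAt_hl hπ (EB := EB) (σ x₀.proj))
  refine (contMDiffAt_postBil hJ (contMDiffAt_comp_proj x₀ (hK.comp x₀.proj hσ))
    ).congr_of_eventuallyEq ?_
  filter_upwards [eventually_proj_mem x₀, contMDiff_proj.continuous.continuousAt.eventually hpσ,
    contMDiff_proj.continuous.continuousAt.eventually
      (hσ.continuousAt.eventually (extChartAt_source_mem_nhds (I := 𝓘(ℝ, E)) (σ x₀.proj)))]
    with x hx hx' hx''
  ext y y'
  have h1 := S.xi_eq_of_orbitProj_eq hπ ((orbitProj_out x.proj).trans hx'.symm) (cov x)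
    (frame 𝓘(ℝ, EB) x₀.proj x.proj y) (frame 𝓘(ℝ, EB) x₀.proj x.proj y')
  rw [pullBil_apply, xiL_apply, h1, ← xiL_apply, S.toP_cotSection hπ hx', xiL, postBil_apply,
    postBil_apply]
  refine congrArg _ ?_
  simp only [Function.comp_apply]
  rw [pullBil_apply, pullBil_apply, pullBil_apply]
  simp only [ContinuousLinearMap.comp_apply, frame_coframe hx'']
  rw [hx', hpσ.self_of_nhds]

include hπ in
theorem contMDiffAt_omegaNHL (x₀ : CotangentBundle EB (OrbitSpace G Q)) :
    ContMDiffAt (cotangentModel EB)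
      𝓘(ℝ, EB × (EB →L[ℝ] ℝ) →L[ℝ] EB × (EB →L[ℝ] ℝ) →L[ℝ] ℝ) ∞
      (fun x => pullBil (S.omegaNHL x) (frame (cotangentModel EB) x₀ x)) x₀ := by
  have h1 := contMDiffAt_pullBil (S.contMDiffAt_xiL hπ x₀)
    (contMDiffAt_const (c := ContinuousLinearMap.fst ℝ EB (EB →L[ℝ] ℝ)))
  refine ((contMDiffAt_const (c := symp EB)).sub h1).congr_of_eventuallyEq ?_
  filter_upwards [eventually_proj_mem x₀] with x hx
  refine ContinuousLinearMap.ext fun u => ContinuousLinearMap.ext fun w => ?_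
  have h2 := omega_frame hx u w
  rw [omega_eq_symp] at h2
  change symp EB (frame (cotangentModel EB) x₀ x u) (frame (cotangentModel EB) x₀ x w)
    - S.xiL x.proj.out (cov x) (projT x (frame (cotangentModel EB) x₀ x u))
      (projT x (frame (cotangentModel EB) x₀ x w))
    = symp EB u w - S.xiL x.proj.out (cov x) (frame 𝓘(ℝ, EB) x₀.proj x.proj u.1)
      (frame 𝓘(ℝ, EB) x₀.proj x.proj w.1)
  rw [h2, projT_frame hx, projT_frame hx]

include hπ in
theorem isDiracStructure_Dbar : IsDiracStructure (cotangentModel EB) (S.Dbar (EB := EB)) := by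
  have h := isDiracStructure_graph S.omegaNHL_skew (S.contMDiffAt_omegaNHL hπ)
  have h2 : (S.Dbar (EB := EB)) = fun x : CotangentBundle EB (OrbitSpace G Q) =>
      {a : TangentSpace (cotangentModel EB) x × CotangentSpace (cotangentModel EB) x |
        ∀ w : EB × (EB →L[ℝ] ℝ), a.2 w = S.omegaNHL x a.1 w} := by
    funext x
    refine Set.ext fun a => forall_congr' fun w => ?_
    have h3 : S.omegaNHL x a.1 w = S.OmegaNH x a.1 w := S.omegaNHL_apply x a.1 w
    rw [h3]
  rw [h2]
  exact h

end NonDegenerate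

end WeaklyDegenerateChaplyginSystem

end Nonholonomic

/-! ### `P` as a retract of `T*Q`, and the derivative of `ρ` on `ℋ`. -/

namespace Nonholonomic

set_option maxSynthPendingDepth 3

section Fibre

variable {E : Type*} [NormedAddCommGroup E] [NormedSpace ℝ E] {M : Type*} [TopologicalSpace M]
  [ChartedSpace E M] [IsManifold 𝓘(ℝ, E) ∞ M]

theorem contMDiff_mkCov (q : M) : ContMDiff 𝓘(ℝ, E →L[ℝ] ℝ) (cotangentModel E) ∞
    (fun p : E →L[ℝ] ℝ => (mkCov q p : CotangentBundle E M)) := by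
  intro p
  rw [contMDiffAt_cotangentBundle_iff]
  exact ⟨contMDiffAt_const, contMDiffAt_clm_comp contMDiffAt_id
    (contMDiffAt_const (c := frame 𝓘(ℝ, E) q q))⟩

theorem tmap_mkCov (q : M) (p β : E →L[ℝ] ℝ) :
    tmap 𝓘(ℝ, E →L[ℝ] ℝ) (cotangentModel E) (fun p : E →L[ℝ] ℝ => (mkCov q p : CotangentBundle E M)) p β
      = (0, β) := by
  have h1 := tmap_comp (K := 𝓘(ℝ, E →L[ℝ] ℝ)) (J := cotangentModel E)
    (I := 𝓘(ℝ, E × (E →L[ℝ] ℝ))) (F := extChartAt (cotangentModel E) (mkCov q p : CotangentBundle E M))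
    (F' := fun p : E →L[ℝ] ℝ => (mkCov q p : CotangentBundle E M)) (l := p)
    (mdifferentiableAt_extChartAt_of_mem (mem_extChartAt_source _))
    ((contMDiff_mkCov q).mdifferentiable (by simp) _)
  have h2 : (fun p' : E →L[ℝ] ℝ => extChartAt (cotangentModel E) (mkCov q p : CotangentBundle E M)
      (mkCov q p' : CotangentBundle E M)) = fun p' => (extChartAt 𝓘(ℝ, E) q q, p') := by
    funext p'
    refine (extChartAt_cotangent (z₀ := mkCov q p) (z := mkCov q p')
      (mem_extChartAt_source _)).trans (Prod.ext rfl ?_)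
    change p'.comp (frame 𝓘(ℝ, E) q q) = p'
    rw [frame_self, ContinuousLinearMap.comp_id]
  rw [h2, tmap_extChartAt, coframe_self, ContinuousLinearMap.id_comp] at h1
  rw [← h1]
  have h3 : HasMFDerivAt 𝓘(ℝ, E →L[ℝ] ℝ) 𝓘(ℝ, E × (E →L[ℝ] ℝ))
      (fun p' : E →L[ℝ] ℝ => (extChartAt 𝓘(ℝ, E) q q, p')) p
      (ContinuousLinearMap.inr ℝ E (E →L[ℝ] ℝ) :) :=
    (hasFDerivAt_prodMk_right (𝕜 := ℝ) (extChartAt 𝓘(ℝ, E) q q) p).hasMFDerivAt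
  rw [tmap_eq_of_hasMFDerivAt h3]
  rfl

/-- A map that is constant along a line in the fibre has vanishing derivative along it. -/
theorem tmap_eq_zero_of_const {EN : Type*} [NormedAddCommGroup EN] [NormedSpace ℝ EN]
    {HN : Type*} [TopologicalSpace HN] {J : ModelWithCorners ℝ EN HN} [J.Boundaryless]
    {N : Type*} [TopologicalSpace N] [ChartedSpace HN N] [IsManifold J ∞ N]
    {f : CotangentBundle E M → N} {q : M} {p β : E →L[ℝ] ℝ}
    (hf : MDifferentiableAt (cotangentModel E) J f (mkCov q p))
    (h : ∀ t : ℝ, f (mkCov q (p + t • β)) = f (mkCov q p)) :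
    tmap (cotangentModel E) J f (mkCov q p) (0, β) = 0 := by
  have hl : HasMFDerivAt 𝓘(ℝ, ℝ) 𝓘(ℝ, E →L[ℝ] ℝ) (fun t : ℝ => p + t • β) 0
      ((ContinuousLinearMap.id ℝ ℝ).smulRight β :) :=
    (((hasFDerivAt_id (𝕜 := ℝ) (0 : ℝ)).smul_const β).const_add p).hasMFDerivAt
  have h0 : p + (0 : ℝ) • β = p := by rw [zero_smul, add_zero]
  have h1 := tmap_comp (K := 𝓘(ℝ, ℝ)) (J := 𝓘(ℝ, E →L[ℝ] ℝ)) (I := cotangentModel E)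
    (F := fun p : E →L[ℝ] ℝ => (mkCov q p : CotangentBundle E M))
    (F' := fun t : ℝ => p + t • β) (l := (0 : ℝ))
    ((contMDiff_mkCov q).mdifferentiable (by simp) _) hl.mdifferentiableAt
  have h2 := tmap_comp (K := 𝓘(ℝ, ℝ)) (J := cotangentModel E) (I := J) (F := f)
    (F' := fun t : ℝ => (mkCov q (p + t • β) : CotangentBundle E M)) (l := (0 : ℝ))
    (by rw [h0]; exact hf)
    (((contMDiff_mkCov q).mdifferentiable (by simp) _).comp _ hl.mdifferentiableAt)
  simp only [h, h0] at h1 h2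
  have h3 : tmap 𝓘(ℝ, ℝ) J (fun _ : ℝ => f (mkCov q p)) 0 = 0 :=
    tmap_eq_of_hasMFDerivAt (hasMFDerivAt_const _ _)
  have h4 := congrArg (fun T : ℝ →L[ℝ] EN => T 1) (h3.symm.trans h2)
  rw [h1, tmap_eq_of_hasMFDerivAt hl] at h4
  simp only [ContinuousLinearMap.comp_apply] at h4
  have h5 : ((ContinuousLinearMap.id ℝ ℝ).smulRight β) (1 : ℝ) = β := one_smul ℝ β
  rw [h5, tmap_mkCov] at h4
  exact h4.symm

end Fibre

namespace WeaklyDegenerateChaplyginSystem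

section Submanifold

variable {E : Type*} [NormedAddCommGroup E] [NormedSpace ℝ E] [FiniteDimensional ℝ E]
  {EG : Type*} [NormedAddCommGroup EG] [NormedSpace ℝ EG] [FiniteDimensional ℝ EG]
  {EB : Type*} [NormedAddCommGroup EB] [NormedSpace ℝ EB] [FiniteDimensional ℝ EB]
  {Q : Type*} [TopologicalSpace Q] [ChartedSpace E Q] [IsManifold 𝓘(ℝ, E) ∞ Q]
  {G : Type*} [TopologicalSpace G] [ChartedSpace EG G] [Group G] [LieGroup 𝓘(ℝ, EG) ∞ G]
  [MulAction G Q] [ContMDiffSMul 𝓘(ℝ, EG) 𝓘(ℝ, E) ∞ G Q] [IsCancelSMul G Q] [ProperSMul G Q]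
  (S : WeaklyDegenerateChaplyginSystem E EG Q G)
  [ChartedSpace EB (OrbitSpace G Q)] [IsManifold 𝓘(ℝ, EB) ∞ (OrbitSpace G Q)]
  (hπ : Manifold.IsSubmersion 𝓘(ℝ, E) 𝓘(ℝ, EB) ∞ (orbitProj G : Q → OrbitSpace G Q))
  {EP : Type*} [NormedAddCommGroup EP] [NormedSpace ℝ EP] [FiniteDimensional ℝ EP]
  [ChartedSpace EP S.P] [IsManifold 𝓘(ℝ, EP) ∞ S.P]
  (hP : Manifold.IsSmoothEmbedding 𝓘(ℝ, EP) (cotangentModel E) ∞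
      (Subtype.val : S.P → CotangentBundle E Q))

-- On each fibre `red` is the linear map `p ↦ p ∘ hl`, so it is its own derivative in vertical
-- directions.
include hπ in
theorem redT_vertical (q : Q) (p β : E →L[ℝ] ℝ) :
    S.redT EB (mkCov q p) (0, β) = (0, β.comp (S.hl EB q)) := by
  have h1 := tmap_comp (K := 𝓘(ℝ, E →L[ℝ] ℝ)) (J := cotangentModel E) (I := cotangentModel EB)
    (F := S.red EB) (F' := fun p : E →L[ℝ] ℝ => (mkCov q p : CotangentBundle E Q)) (l := p)
    ((S.contMDiff_red hπ).mdifferentiable (by simp) _)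
    ((contMDiff_mkCov q).mdifferentiable (by simp) _)
  have h2 := tmap_comp (K := 𝓘(ℝ, E →L[ℝ] ℝ)) (J := 𝓘(ℝ, EB →L[ℝ] ℝ)) (I := cotangentModel EB)
    (F := fun p : EB →L[ℝ] ℝ => (mkCov (orbitProj G q) p : CotangentBundle EB (OrbitSpace G Q)))
    (F' := precomp (W := ℝ) (S.hl EB q)) (l := p)
    ((contMDiff_mkCov _).mdifferentiable (by simp) _)
    (precomp (W := ℝ) (S.hl EB q)).differentiableAt.mdifferentiableAt
  have h3 : tmap 𝓘(ℝ, E →L[ℝ] ℝ) 𝓘(ℝ, EB →L[ℝ] ℝ) (precomp (W := ℝ) (S.hl EB q)) p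
      = precomp (S.hl EB q) :=
    tmap_eq_of_hasMFDerivAt ((precomp (W := ℝ) (S.hl EB q)).hasFDerivAt.hasMFDerivAt)
  have h4 := congrArg (fun T : (E →L[ℝ] ℝ) →L[ℝ] EB × (EB →L[ℝ] ℝ) => T β) (h1.symm.trans h2)
  rw [h3] at h4
  simp only [ContinuousLinearMap.comp_apply] at h4
  rw [tmap_mkCov, tmap_mkCov] at h4
  exact h4

variable (EP) in
/-- The tangent map of the inclusion of `P`, between the model spaces. -/
def inclT (z : S.P) : EP →L[ℝ] E × (E →L[ℝ] ℝ) :=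
  tmap 𝓘(ℝ, EP) (cotangentModel E) (Subtype.val : S.P → CotangentBundle E Q) z

/-- The retraction of `T*Q` onto `P`. -/
def retr (z : CotangentBundle E Q) : S.P := ⟨S.toP EB z, S.toP_mem hπ z⟩

theorem retr_val (z : S.P) : S.retr hπ z.1 = z := Subtype.ext (S.toP_of_mem hπ z.2)

-- A continuous map into the immersed manifold `P` is smooth once its composite with the inclusion
-- is, and that composite is `toP`. Smooth maps on `P` and their derivatives are obtained from this
-- retraction.
include hP in
theorem contMDiff_retr : ContMDiff (cotangentModel E) 𝓘(ℝ, EP) ∞ (S.retr hπ) := by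
  rw [ContMDiff.iff_comp_isImmersion hP.isImmersion]
  exact ⟨(S.contMDiff_toP hπ).continuous.subtype_mk _, S.contMDiff_toP hπ⟩

/-- The tangent map of the retraction, between the model spaces. -/
def retrT (EP : Type*) [NormedAddCommGroup EP] [NormedSpace ℝ EP] [FiniteDimensional ℝ EP]
    [ChartedSpace EP S.P] (z : CotangentBundle E Q) : E × (E →L[ℝ] ℝ) →L[ℝ] EP :=
  tmap (cotangentModel E) 𝓘(ℝ, EP) (S.retr hπ) z

include hP in
theorem retrT_inclT (z : S.P) (v : EP) : S.retrT hπ EP z.1 (S.inclT EP z v) = v := by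
  have h1 := tmap_comp (K := 𝓘(ℝ, EP)) (J := cotangentModel E) (I := 𝓘(ℝ, EP))
    (F := S.retr hπ) (F' := (Subtype.val : S.P → CotangentBundle E Q)) (l := z)
    ((S.contMDiff_retr hπ hP).mdifferentiable (by simp) _)
    (hP.contMDiff.mdifferentiable (by simp) _)
  simp only [retr_val, tmap_id] at h1
  exact (congrArg (fun T : EP →L[ℝ] EP => T v) h1).symm

include hP in
theorem inclT_retrT (z : CotangentBundle E Q) (U : E × (E →L[ℝ] ℝ)) :
    S.inclT EP (S.retr hπ z) (S.retrT hπ EP z U)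
      = tmap (cotangentModel E) (cotangentModel E) (S.toP EB) z U := by
  have h1 := tmap_comp (K := cotangentModel E) (J := 𝓘(ℝ, EP)) (I := cotangentModel E)
    (F := (Subtype.val : S.P → CotangentBundle E Q)) (F' := S.retr hπ) (l := z)
    (hP.contMDiff.mdifferentiable (by simp) _)
    ((S.contMDiff_retr hπ hP).mdifferentiable (by simp) _)
  exact (congrArg (fun T : E × (E →L[ℝ] ℝ) →L[ℝ] E × (E →L[ℝ] ℝ) => T U) h1).symm

include hπ in
theorem projT_toP (z : CotangentBundle E Q) (U : E × (E →L[ℝ] ℝ)) :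
    projT (S.toP EB z) (tmap (cotangentModel E) (cotangentModel E) (S.toP EB) z U)
      = projT z U := by
  have h1 := tmap_comp (K := cotangentModel E) (J := cotangentModel E) (I := 𝓘(ℝ, E))
    (F := fun z : CotangentBundle E Q => z.proj) (F' := S.toP EB) (l := z)
    (contMDiff_proj.mdifferentiable (by simp) _)
    ((S.contMDiff_toP hπ).mdifferentiable (by simp) _)
  exact (congrArg (fun T : E × (E →L[ℝ] ℝ) →L[ℝ] E => T U) h1).symm

include hπ in
theorem redT_toP (z : CotangentBundle E Q) (U : E × (E →L[ℝ] ℝ)) :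
    S.redT EB (S.toP EB z) (tmap (cotangentModel E) (cotangentModel E) (S.toP EB) z U)
      = S.redT EB z U := by
  have h1 := tmap_comp (K := cotangentModel E) (J := cotangentModel E) (I := cotangentModel EB)
    (F := S.red EB) (F' := S.toP EB) (l := z)
    ((S.contMDiff_red hπ).mdifferentiable (by simp) _)
    ((S.contMDiff_toP hπ).mdifferentiable (by simp) _)
  simp only [S.red_toP hπ] at h1
  exact (congrArg (fun T : E × (E →L[ℝ] ℝ) →L[ℝ] EB × (EB →L[ℝ] ℝ) => T U) h1).symm

variable (EP) in
/-- The distribution `𝓗`, as a subspace of the model space. -/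
def horP (z : S.P) : Submodule ℝ EP := S.𝓗 EP z

theorem mem_horP_iff (z : S.P) (v : EP) :
    v ∈ S.horP EP z ↔ projT z.1 (S.inclT EP z v) ∈ S.dist z.1.proj := Iff.rfl

/-- The tangent map of `ρ`, between the model spaces. -/
def rhoT (EP EB : Type*) [NormedAddCommGroup EP] [NormedSpace ℝ EP] [FiniteDimensional ℝ EP]
    [ChartedSpace EP S.P] [NormedAddCommGroup EB] [NormedSpace ℝ EB] [FiniteDimensional ℝ EB]
    [ChartedSpace EB (OrbitSpace G Q)] [IsManifold 𝓘(ℝ, EB) ∞ (OrbitSpace G Q)]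
    (z : S.P) : EP →L[ℝ] EB × (EB →L[ℝ] ℝ) := S.tangentRho EP EB z

include hπ in
theorem rho_eq : S.rho EB = fun z => S.red EB z.1 := funext fun z => S.rho_eq_red hπ z

include hπ hP in
theorem contMDiff_rho : ContMDiff 𝓘(ℝ, EP) (cotangentModel EB) ∞ (S.rho EB) := by
  rw [S.rho_eq hπ]
  exact (S.contMDiff_red hπ).comp hP.contMDiff

include hπ hP in
theorem rhoT_apply (z : S.P) (v : EP) : S.rhoT EP EB z v = S.redT EB z.1 (S.inclT EP z v) := by
  have h1 := tmap_comp (K := 𝓘(ℝ, EP)) (J := cotangentModel E) (I := cotangentModel EB)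
    (F := S.red EB) (F' := (Subtype.val : S.P → CotangentBundle E Q)) (l := z)
    ((S.contMDiff_red hπ).mdifferentiable (by simp) _)
    (hP.contMDiff.mdifferentiable (by simp) _)
  rw [← S.rho_eq hπ] at h1
  exact congrArg (fun T : EP →L[ℝ] EB × (EB →L[ℝ] ℝ) => T v) h1

-- If `Tρ(v) = 0`, the projection of `v` to `Q` is killed by `Tπ` and lies in `Δ_Q`, so it is zero
-- and `v` is vertical, `(0, β)`. The fibre part of `Tρ(v) = 0` says that `β` vanishes on `Δ_Q`. The
-- retraction sees covectors only through `Δ_Q`, so its derivative kills `(0, β)`; yet it fixes `v`.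
include hπ hP in
theorem eq_zero_of_rhoT_eq_zero (z : S.P) {v : EP} (hv : v ∈ S.horP EP z)
    (h : S.rhoT EP EB z v = 0) : v = 0 := by
  rw [S.rhoT_apply hπ hP] at h
  have h1 : projT z.1 (S.inclT EP z v) = 0 := by
    refine S.disjoint_ker_dist (EB := EB) hπ _ hv ?_
    rw [← S.projT_redT hπ, h, map_zero]
  have h2 : S.inclT EP z v = (0, (S.inclT EP z v).2) := by
    refine Prod.ext ?_ rfl
    rw [projT_self] at h1
    exact h1
  have h3 : (S.inclT EP z v).2.comp (S.hl EB z.1.proj) = 0 := by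
    rw [h2, ← mkCov_cov z.1, S.redT_vertical hπ] at h
    exact congrArg Prod.snd h
  rw [← S.retrT_inclT hπ hP z v, h2]
  refine tmap_eq_zero_of_const (q := z.1.proj) (p := cov z.1)
    ((S.contMDiff_retr hπ hP).mdifferentiable (by simp) _) fun t => Subtype.ext ?_
  refine cotangent_ext rfl ?_
  change S.bil z.1.proj (S.cometric EB z.1.proj (cov z.1 + t • (S.inclT EP z v).2))
    = S.bil z.1.proj (S.cometric EB z.1.proj (cov z.1))
  rw [cometric_apply, cometric_apply, ContinuousLinearMap.add_comp, ContinuousLinearMap.smul_comp,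
    h3, smul_zero, add_zero]

-- A vector of `T*Q̄` is lifted to `T*Q` by a section of `red` induced from a section of `π` with
-- horizontal derivative, and then pushed into `TP` by the retraction, which changes neither the
-- projection to `Q` nor the image under `red`.
include hπ hP in
theorem exists_mem_horP_rhoT_eq (z : S.P) (Y : EB × (EB →L[ℝ] ℝ)) :
    ∃ v ∈ S.horP EP z, S.rhoT EP EB z v = Y := by
  obtain ⟨σ, hσ₀, hσ, hpσ, hσT⟩ := S.exists_horizontal_section hπ (EB := EB) z.1.proj
  have hτ : ContMDiffAt (cotangentModel EB) (cotangentModel E) ∞ (cotSection E σ) (S.red EB z.1) :=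
    contMDiffAt_cotSection hπ hσ hpσ
  -- The section of `red` need not pass through `z`, since its values need not lie in `P`; its
  -- retraction does.
  have hz : S.retr hπ (cotSection E σ (S.red EB z.1)) = z := by
    refine Subtype.ext ((S.toP_cotSection hπ hpσ.self_of_nhds).trans ?_)
    change mkCov (σ (orbitProj G z.1.proj)) _ = _
    have h := S.hlCov_red (EB := EB) hπ z.2
    refine cotangent_ext hσ₀ ?_
    change S.hlCov EB (σ (orbitProj G z.1.proj)) (cov (S.red EB z.1)) = cov z.1
    rw [hσ₀]
    exact h
  set W := tmap (cotangentModel EB) (cotangentModel E) (cotSection E σ) (S.red EB z.1) Y with hW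
  -- The projection of `W` to `Q` is `Tσ` of a vector of the base, and `Tσ = hl` at this point.
  have hWp : projT (cotSection E σ (S.red EB z.1)) W ∈ S.dist z.1.proj := by
    have h1 := tmap_comp (K := cotangentModel EB) (J := cotangentModel E) (I := 𝓘(ℝ, E))
      (F := fun z : CotangentBundle E Q => z.proj) (F' := cotSection E σ) (l := S.red EB z.1)
      (contMDiff_proj.mdifferentiable (by simp) _) (hτ.mdifferentiableAt (by simp))
    have h2 := tmap_comp (K := cotangentModel EB) (J := 𝓘(ℝ, EB)) (I := 𝓘(ℝ, E))
      (F := σ) (F' := fun x : CotangentBundle EB (OrbitSpace G Q) => x.proj) (l := S.red EB z.1)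
      (hσ.mdifferentiableAt (by simp)) (contMDiff_proj.mdifferentiable (by simp) _)
    have h3 := congrArg (fun T : EB × (EB →L[ℝ] ℝ) →L[ℝ] E => T Y) (h1.symm.trans h2)
    have h4 : projT (cotSection E σ (S.red EB z.1)) W
        = S.hl EB z.1.proj (projT (S.red EB z.1) Y) := by
      rw [← hσT]
      exact h3
    rw [h4]
    exact S.hl_mem _ _
  have hWr : S.redT EB (cotSection E σ (S.red EB z.1)) W = Y := by
    have h1 := tmap_comp (K := cotangentModel EB) (J := cotangentModel E) (I := cotangentModel EB)
      (F := S.red EB) (F' := cotSection E σ) (l := S.red EB z.1)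
      ((S.contMDiff_red hπ).mdifferentiable (by simp) _) (hτ.mdifferentiableAt (by simp))
    have h2 : (fun x => S.red EB (cotSection E σ x)) =ᶠ[𝓝 (S.red EB z.1)] fun x => x := by
      have h3 : ∀ᶠ x : CotangentBundle EB (OrbitSpace G Q) in 𝓝 (S.red EB z.1),
          orbitProj G (σ x.proj) = x.proj := by
        have h4 : ContinuousAt (fun x : CotangentBundle EB (OrbitSpace G Q) => x.proj)
          (S.red EB z.1) := contMDiff_proj.continuous.continuousAt
        exact h4.eventually hpσ
      filter_upwards [h3] with x hx
      exact S.red_cotSection hπ hx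
    rw [tmap_congr h2, tmap_id] at h1
    exact (congrArg (fun T : EB × (EB →L[ℝ] ℝ) →L[ℝ] EB × (EB →L[ℝ] ℝ) => T Y) h1).symm
  have h1 := S.inclT_retrT hπ hP (cotSection E σ (S.red EB z.1)) W
  have hz' : S.toP EB (cotSection E σ (S.red EB z.1)) = z.1 := congrArg Subtype.val hz
  rw [hz] at h1
  refine ⟨S.retrT hπ EP (cotSection E σ (S.red EB z.1)) W, ?_, ?_⟩
  · rw [mem_horP_iff, h1]
    have h2 := S.projT_toP hπ (EB := EB) (cotSection E σ (S.red EB z.1)) W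
    rw [hz'] at h2
    rw [h2]
    exact hWp
  · rw [S.rhoT_apply hπ hP, h1]
    have h2 := S.redT_toP hπ (EB := EB) (cotSection E σ (S.red EB z.1)) W
    rw [hz'] at h2
    rw [h2, hWr]

end Submanifold

end WeaklyDegenerateChaplyginSystem

end Nonholonomic

/-! ### Reduction of the constrained Dirac structure. -/

namespace Nonholonomic

set_option maxSynthPendingDepth 3

namespace WeaklyDegenerateChaplyginSystem

section DiracReduction

variable {E : Type*} [NormedAddCommGroup E] [NormedSpace ℝ E] [FiniteDimensional ℝ E]
  {EG : Type*} [NormedAddCommGroup EG] [NormedSpace ℝ EG] [FiniteDimensional ℝ EG]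
  {EB : Type*} [NormedAddCommGroup EB] [NormedSpace ℝ EB] [FiniteDimensional ℝ EB]
  {Q : Type*} [TopologicalSpace Q] [ChartedSpace E Q] [IsManifold 𝓘(ℝ, E) ∞ Q]
  {G : Type*} [TopologicalSpace G] [ChartedSpace EG G] [Group G] [LieGroup 𝓘(ℝ, EG) ∞ G]
  [MulAction G Q] [ContMDiffSMul 𝓘(ℝ, EG) 𝓘(ℝ, E) ∞ G Q] [IsCancelSMul G Q] [ProperSMul G Q]
  (S : WeaklyDegenerateChaplyginSystem E EG Q G)
  [ChartedSpace EB (OrbitSpace G Q)] [IsManifold 𝓘(ℝ, EB) ∞ (OrbitSpace G Q)]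
  (hπ : Manifold.IsSubmersion 𝓘(ℝ, E) 𝓘(ℝ, EB) ∞ (orbitProj G : Q → OrbitSpace G Q))
  {EP : Type*} [NormedAddCommGroup EP] [NormedSpace ℝ EP] [FiniteDimensional ℝ EP]
  [ChartedSpace EP S.P] [IsManifold 𝓘(ℝ, EP) ∞ S.P]
  (hP : Manifold.IsSmoothEmbedding 𝓘(ℝ, EP) (cotangentModel E) ∞
      (Subtype.val : S.P → CotangentBundle E Q))

include hπ hP in
theorem bijective_tangentRho (z : S.P) :
    Bijective fun u : S.𝓗 EP z => S.tangentRho EP EB z u := by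
  refine ⟨fun u w h => ?_, fun Y => ?_⟩
  · have key : ∀ a ∈ S.horP EP z, ∀ b ∈ S.horP EP z, S.rhoT EP EB z a = S.rhoT EP EB z b → a = b :=
      fun a ha b hb hab => sub_eq_zero.1 (S.eq_zero_of_rhoT_eq_zero hπ hP z
        (Submodule.sub_mem _ ha hb) (by rw [map_sub, hab, sub_self]))
    exact Subtype.ext (key u.1 u.2 w.1 w.2 h)
  · obtain ⟨v, hv, h⟩ := S.exists_mem_horP_rhoT_eq hπ hP z Y
    exact ⟨⟨v, hv⟩, h⟩

/-- The horizontal lift to `P`, between the model spaces. -/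
def hlHor (EP EB : Type*) [NormedAddCommGroup EP] [NormedSpace ℝ EP] [FiniteDimensional ℝ EP]
    [ChartedSpace EP S.P] [NormedAddCommGroup EB] [NormedSpace ℝ EB] [FiniteDimensional ℝ EB]
    [ChartedSpace EB (OrbitSpace G Q)] [IsManifold 𝓘(ℝ, EB) ∞ (OrbitSpace G Q)]
    (z : S.P) : EB × (EB →L[ℝ] ℝ) →L[ℝ] EP := S.hlH EP EB z

theorem hlHor_mem (z : S.P) (Y : EB × (EB →L[ℝ] ℝ)) : S.hlHor EP EB z Y ∈ S.horP EP z :=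
  Submodule.coe_mem _

include hπ hP in
theorem hlHor_rhoT (z : S.P) {v : EP} (hv : v ∈ S.horP EP z) :
    S.hlHor EP EB z (S.rhoT EP EB z v) = v := by
  have h := LinearMap.leftInverse_apply_of_inj
    (f := (S.tangentRho EP EB z).toLinearMap ∘ₗ (S.𝓗 EP z).subtype)
    (LinearMap.ker_eq_bot.2 (S.bijective_tangentRho hπ hP z).1) ⟨v, hv⟩
  exact congrArg Subtype.val h

include hπ hP in
theorem rhoT_hlHor (z : S.P) (Y : EB × (EB →L[ℝ] ℝ)) :
    S.rhoT EP EB z (S.hlHor EP EB z Y) = Y := by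
  obtain ⟨v, hv, rfl⟩ := S.exists_mem_horP_rhoT_eq hπ hP z Y
  rw [S.hlHor_rhoT hπ hP z hv]

include hπ hP in
theorem omega_inclT (z : S.P) {u w : EP} (hu : u ∈ S.horP EP z) (hw : w ∈ S.horP EP z) :
    omega z.1 (S.inclT EP z u) (S.inclT EP z w)
      = S.omegaNH (S.rho EB z) (S.rhoT EP EB z u) (S.rhoT EP EB z w) := by
  rw [S.rho_eq_red hπ, S.rhoT_apply hπ hP, S.rhoT_apply hπ hP]
  exact S.omega_eq_omegaNH hπ z hu hw

/-- The constrained Dirac structure, between the model spaces. -/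
def diracP (EP : Type*) [NormedAddCommGroup EP] [NormedSpace ℝ EP] [FiniteDimensional ℝ EP]
    [ChartedSpace EP S.P] (z : S.P) : Set (EP × (EP →L[ℝ] ℝ)) := S.DP (EP := EP) z

-- Every vector of `ℋ` is the lift of its image under `Tρ`, and `Ω_P` on `ℋ` is the pull-back of `Ω̄
-- - Ξ`. The condition on `α` thus becomes the defining equation of `D̄` for `f(v, α)`; invariance
-- and the image of `f` are read off from this form.
include hπ hP in
theorem mem_diracP_iff (z : S.P) (v : EP) (α : EP →L[ℝ] ℝ) :
    (v, α) ∈ S.diracP EP z ↔ v ∈ S.horP EP z ∧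
      ∀ Y : EB × (EB →L[ℝ] ℝ), α (S.hlHor EP EB z Y)
        = S.omegaNH (S.rho EB z) (S.rhoT EP EB z v) Y := by
  refine and_congr_right fun hv => ⟨fun h Y => ?_,
    fun h (w : EP) (hw : w ∈ S.horP EP z) => ?_⟩
  · have hY : S.hlHor EP EB z Y ∈ S.horP EP z := S.hlHor_mem z Y
    have h1 := h _ hY
    have h2 := S.omega_inclT hπ hP (EB := EB) z (u := v) hv (S.hlHor_mem z Y)
    rw [S.rhoT_hlHor hπ hP] at h2
    have h3 : α (S.hlHor EP EB z Y) - omega z.1 (S.inclT EP z v)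
      (S.inclT EP z (S.hlHor EP EB z Y)) = 0 := h1
    rw [← h2, sub_eq_zero.1 h3]
  · have h1 := h (S.rhoT EP EB z w)
    rw [S.hlHor_rhoT hπ hP z hw, ← S.omega_inclT hπ hP z (u := v) hv hw] at h1
    exact sub_eq_zero.2 h1

/-! ### The action on `P` -/

/-- Written this way, the action on `P` inherits smoothness from the cotangent lift on `T*Q`. -/
theorem actP_eq_retr (g : G) : S.actP g = fun z => S.retr hπ (cotangentLift g z.1) :=
  funext fun z => (S.retr_val hπ (S.actP g z)).symm

include hπ hP in
theorem contMDiff_actP (g : G) : ContMDiff 𝓘(ℝ, EP) 𝓘(ℝ, EP) ∞ (S.actP g) := by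
  rw [S.actP_eq_retr hπ]
  exact (S.contMDiff_retr hπ hP).comp ((contMDiff_cotangentLift (EG := EG) g).comp hP.contMDiff)

/-- The tangent map of the action on `P`, between the model spaces. -/
def actT (EP : Type*) [NormedAddCommGroup EP] [NormedSpace ℝ EP] [FiniteDimensional ℝ EP]
    [ChartedSpace EP S.P] (g : G) (z : S.P) : EP →L[ℝ] EP :=
  tmap 𝓘(ℝ, EP) 𝓘(ℝ, EP) (S.actP g) z

include hπ hP in
theorem inclT_actT (g : G) (z : S.P) (v : EP) :
    S.inclT EP (S.actP g z) (S.actT EP g z v) = liftT g z.1 (S.inclT EP z v) := by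
  have h1 := tmap_comp (K := 𝓘(ℝ, EP)) (J := 𝓘(ℝ, EP)) (I := cotangentModel E)
    (F := (Subtype.val : S.P → CotangentBundle E Q)) (F' := S.actP g) (l := z)
    (hP.contMDiff.mdifferentiable (by simp) _)
    ((S.contMDiff_actP hπ hP g).mdifferentiable (by simp) _)
  have h2 := tmap_comp (K := 𝓘(ℝ, EP)) (J := cotangentModel E) (I := cotangentModel E)
    (F := cotangentLift g) (F' := (Subtype.val : S.P → CotangentBundle E Q)) (l := z)
    ((contMDiff_cotangentLift (EG := EG) g).mdifferentiable (by simp) _)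
    (hP.contMDiff.mdifferentiable (by simp) _)
  exact congrArg (fun T : EP →L[ℝ] E × (E →L[ℝ] ℝ) => T v) (h1.symm.trans h2)

include hπ hP in
theorem actT_mem (g : G) (z : S.P) {v : EP} (hv : v ∈ S.horP EP z) :
    S.actT EP g z v ∈ S.horP EP (S.actP g z) := by
  rw [mem_horP_iff, S.inclT_actT hπ hP]
  have h := projT_liftT (EG := EG) g z.1 (S.inclT EP z v)
  have h2 := S.act_mem g z.1.proj ((S.mem_horP_iff z v).1 hv)
  rw [← h] at h2
  exact h2

include hπ in
theorem rho_actP (g : G) (z : S.P) : S.rho EB (S.actP g z) = S.rho EB z := by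
  rw [S.rho_eq_red hπ, S.rho_eq_red hπ]
  exact S.red_cotangentLift hπ g z.1

include hπ hP in
theorem rhoT_actT (g : G) (z : S.P) (v : EP) :
    S.rhoT EP EB (S.actP g z) (S.actT EP g z v) = S.rhoT EP EB z v := by
  rw [S.rhoT_apply hπ hP, S.rhoT_apply hπ hP, S.inclT_actT hπ hP]
  exact S.redT_liftT hπ g z.1 _

include hπ hP in
theorem hlHor_actP (g : G) (z : S.P) (Y : EB × (EB →L[ℝ] ℝ)) :
    S.hlHor EP EB (S.actP g z) Y = S.actT EP g z (S.hlHor EP EB z Y) := by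
  have h := S.hlHor_rhoT hπ hP (EB := EB) (S.actP g z)
    (S.actT_mem hπ hP g z (S.hlHor_mem (EB := EB) z Y))
  rwa [S.rhoT_actT hπ hP, S.rhoT_hlHor hπ hP] at h

theorem actP_inv_actP (g : G) (z : S.P) : S.actP g⁻¹ (S.actP g z) = z := by
  refine Subtype.ext (cotangent_ext (inv_smul_smul g z.1.proj) (ContinuousLinearMap.ext fun v => ?_))
  change cov z.1 (act E g⁻¹ (g • z.1.proj) (act E g⁻¹⁻¹ (g⁻¹ • g • z.1.proj) v)) = cov z.1 v
  rw [inv_inv, inv_smul_smul, S.act_inv_act]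

include hπ hP in
theorem actT_inv_actT (g : G) (z : S.P) (v : EP) :
    S.actT EP g⁻¹ (S.actP g z) (S.actT EP g z v) = v := by
  have h1 := tmap_comp (K := 𝓘(ℝ, EP)) (J := 𝓘(ℝ, EP)) (I := 𝓘(ℝ, EP))
    (F := S.actP g⁻¹) (F' := S.actP g) (l := z)
    ((S.contMDiff_actP hπ hP g⁻¹).mdifferentiable (by simp) _)
    ((S.contMDiff_actP hπ hP g).mdifferentiable (by simp) _)
  simp only [actP_inv_actP, tmap_id] at h1
  exact (congrArg (fun T : EP →L[ℝ] EP => T v) h1).symm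

/-! ### Pontryagin bundles -/

/-- The element of the Pontryagin bundle with given components. -/
def _root_.Nonholonomic.mkPont {EM : Type*} [NormedAddCommGroup EM] [NormedSpace ℝ EM]
    {HM : Type*} [TopologicalSpace HM] (I : ModelWithCorners ℝ EM HM)
    {M : Type*} [TopologicalSpace M] [ChartedSpace HM M] (x : M) (v : EM) (α : EM →L[ℝ] ℝ) :
    PontryaginBundle I M := ⟨x, (v, α)⟩

theorem _root_.Nonholonomic.exists_eq_mkPont {EM : Type*} [NormedAddCommGroup EM]
    [NormedSpace ℝ EM] {HM : Type*} [TopologicalSpace HM] (I : ModelWithCorners ℝ EM HM)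
    {M : Type*} [TopologicalSpace M] [ChartedSpace HM M] (x : PontryaginBundle I M) :
    ∃ (v : EM) (α : EM →L[ℝ] ℝ), x = mkPont I x.1 v α := ⟨x.2.1, x.2.2, rfl⟩

theorem _root_.Nonholonomic.mkPont_inj {EM : Type*} [NormedAddCommGroup EM]
    [NormedSpace ℝ EM] {HM : Type*} [TopologicalSpace HM] {I : ModelWithCorners ℝ EM HM}
    {M : Type*} [TopologicalSpace M] [ChartedSpace HM M] {x x' : M} {v v' : EM}
    {α α' : EM →L[ℝ] ℝ} :
    mkPont I x v α = mkPont I x' v' α' ↔ x = x' ∧ v = v' ∧ α = α' := by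
  constructor
  · intro h
    obtain ⟨rfl, h2⟩ := Sigma.mk.inj_iff.1 h
    have h3 := Prod.mk_inj.1 (eq_of_heq h2)
    exact ⟨rfl, h3.1, h3.2⟩
  · rintro ⟨rfl, rfl, rfl⟩
    rfl

theorem redMap_mkPont (z : S.P) (v : EP) (α : EP →L[ℝ] ℝ) :
    S.redMap EP EB (mkPont 𝓘(ℝ, EP) z v α)
      = mkPont (cotangentModel EB) (S.rho EB z) (S.rhoT EP EB z v)
        (α.comp (S.hlHor EP EB z)) := rfl

theorem Psi_mkPont (g : G) (z : S.P) (v : EP) (α : EP →L[ℝ] ℝ) :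
    S.Psi g (mkPont 𝓘(ℝ, EP) z v α) = mkPont 𝓘(ℝ, EP) (S.actP g z) (S.actT EP g z v)
      (α.comp (S.actT EP g⁻¹ (S.actP g z))) := rfl

theorem mkPont_mem_totalDP (z : S.P) (v : EP) (α : EP →L[ℝ] ℝ) :
    mkPont 𝓘(ℝ, EP) z v α ∈ S.totalDP EP ↔ (v, α) ∈ S.diracP EP z := Iff.rfl

include hπ hP in
theorem redMap_Psi (g : G) (x : PontryaginBundle 𝓘(ℝ, EP) S.P) :
    S.redMap EP EB (S.Psi g x) = S.redMap EP EB x := by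
  obtain ⟨v, α, hx⟩ := exists_eq_mkPont _ x
  rw [hx, Psi_mkPont, redMap_mkPont, redMap_mkPont, mkPont_inj]
  refine ⟨S.rho_actP hπ g _, S.rhoT_actT hπ hP g _ v, ContinuousLinearMap.ext fun Y => ?_⟩
  simp only [ContinuousLinearMap.comp_apply]
  rw [S.hlHor_actP hπ hP, S.actT_inv_actT hπ hP]

include hπ hP in
theorem Psi_mem_totalDP (g : G) (x : PontryaginBundle 𝓘(ℝ, EP) S.P) (hx : x ∈ S.totalDP EP) :
    S.Psi g x ∈ S.totalDP EP := by
  obtain ⟨v, α, h⟩ := exists_eq_mkPont _ x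
  rw [h] at hx ⊢
  rw [mkPont_mem_totalDP, S.mem_diracP_iff hπ hP (EB := EB)] at hx
  rw [Psi_mkPont, mkPont_mem_totalDP, S.mem_diracP_iff hπ hP (EB := EB)]
  refine ⟨S.actT_mem hπ hP g _ hx.1, fun Y => ?_⟩
  rw [ContinuousLinearMap.comp_apply, S.hlHor_actP hπ hP, S.actT_inv_actT hπ hP,
    S.rhoT_actT hπ hP, S.rho_actP hπ]
  exact hx.2 Y

/-- `Dbar`, between the model spaces. -/
def diracB (EB : Type*) [NormedAddCommGroup EB] [NormedSpace ℝ EB] [FiniteDimensional ℝ EB]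
    [ChartedSpace EB (OrbitSpace G Q)] [IsManifold 𝓘(ℝ, EB) ∞ (OrbitSpace G Q)]
    (x : CotangentBundle EB (OrbitSpace G Q)) :
    Set ((EB × (EB →L[ℝ] ℝ)) × (EB × (EB →L[ℝ] ℝ) →L[ℝ] ℝ)) := S.Dbar (EB := EB) x

-- A preimage is given by the horizontal lift of `Y` and the pull-back of `γ` by `Tρ`.
include hπ hP in
theorem exists_mem_diracP (z : S.P) {Y : EB × (EB →L[ℝ] ℝ)} {γ : EB × (EB →L[ℝ] ℝ) →L[ℝ] ℝ}
    (h : (Y, γ) ∈ S.diracB EB (S.rho EB z)) :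
    ∃ (v : EP) (α : EP →L[ℝ] ℝ), (v, α) ∈ S.diracP EP z ∧ S.rhoT EP EB z v = Y ∧
      α.comp (S.hlHor EP EB z) = γ := by
  refine ⟨S.hlHor EP EB z Y, γ.comp (S.rhoT EP EB z), ?_, S.rhoT_hlHor hπ hP z Y,
    ContinuousLinearMap.ext fun Y' => ?_⟩
  · rw [S.mem_diracP_iff hπ hP (EB := EB)]
    refine ⟨S.hlHor_mem z Y, fun Y' => ?_⟩
    rw [ContinuousLinearMap.comp_apply, S.rhoT_hlHor hπ hP, S.rhoT_hlHor hπ hP]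
    exact h Y'
  · simp only [ContinuousLinearMap.comp_apply]
    rw [S.rhoT_hlHor hπ hP]

include hπ hP in
theorem image_DP (z : S.P) : (fun a => (S.redMap EP EB ⟨z, a⟩).2) '' S.DP (EP := EP) z
    = S.Dbar (S.rho EB z) := by
  refine Set.Subset.antisymm ?_ ?_
  · rintro _ ⟨⟨v, α⟩, h, rfl⟩
    exact ((S.mem_diracP_iff hπ hP (EB := EB) z v α).1 h).2
  · rintro ⟨Y, γ⟩ h
    obtain ⟨v, α, h1, h2, h3⟩ := S.exists_mem_diracP hπ hP z (Y := Y) (γ := γ) h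
    exact ⟨(v, α), h1, Prod.ext h2 h3⟩

/-! ### Fibres of `ρ` -/

include hπ in
theorem eq_of_red_eq {z z' : S.P} (h : z.1.proj = z'.1.proj)
    (h' : S.red EB z.1 = S.red EB z'.1) : z = z' := by
  refine Subtype.ext (cotangent_ext h ?_)
  have h1 : (cov z.1).comp (S.hl EB z.1.proj) = (cov z'.1).comp (S.hl EB z'.1.proj) :=
    congrArg cov h'
  rw [← S.hlCov_red (EB := EB) hπ z.2, ← S.hlCov_red (EB := EB) hπ z'.2, h1, h]

-- Equal images have base points on one orbit. After moving by some `g` the base points coincide,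
-- and over a fixed `q` a point of `P` is determined by its restriction to `Δ_Q(q)`.
include hπ in
theorem rho_eq_rho_iff (z z' : S.P) : S.rho EB z = S.rho EB z' ↔ ∃ g : G, S.actP g z = z' := by
  constructor
  · intro h
    have h1 : orbitProj G z.1.proj = orbitProj G z'.1.proj := congrArg TotalSpace.proj h
    obtain ⟨g, hg⟩ := exists_smul_eq_of_orbitProj_eq h1
    refine ⟨g, S.eq_of_red_eq hπ (EB := EB) hg ?_⟩
    rw [← S.rho_eq_red hπ, ← S.rho_eq_red hπ, S.rho_actP hπ, h]
  · rintro ⟨g, rfl⟩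
    exact (S.rho_actP hπ g z).symm

include hπ in
theorem surjective_rho : Surjective (S.rho EB) := by
  intro x
  refine ⟨⟨_, S.mkCov_hlCov_mem hπ x.proj.out (cov x)⟩, ?_⟩
  rw [S.rho_eq_red hπ]
  exact (S.red_hlCov hπ _ _).trans (cotangent_ext (orbitProj_out _) rfl)

include hπ hP in
theorem exists_quotient_map :
    ∃ F : S.QuotDP EP → PontryaginBundle (cotangentModel EB) (CotangentBundle EB (OrbitSpace G Q)),
      (∀ x : S.totalDP EP, F (Quot.mk _ x) = S.redMap EP EB x.1) ∧
      range F = {y | y.2 ∈ S.Dbar y.1} ∧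
      ∀ x y : S.totalDP EP, F (Quot.mk _ x) = F (Quot.mk _ y) ↔
        ∃ (g : G) (β : CotangentSpace 𝓘(ℝ, EP) y.1.1), (∀ w ∈ S.𝓗 EP y.1.1, β w = 0) ∧
          S.Psi g x.1 = ⟨y.1.1, (y.1.2.1, y.1.2.2 + β)⟩ := by
  refine ⟨Quot.lift (fun x => S.redMap EP EB x.1) ?_, fun x => rfl, ?_, fun x y => ?_⟩
  · rintro x y ⟨g, h⟩
    rw [← h, S.redMap_Psi hπ hP]
  · refine Set.Subset.antisymm ?_ ?_
    · rintro _ ⟨x, rfl⟩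
      induction x using Quot.ind with
      | mk x =>
        have h := S.image_DP hπ hP (EB := EB) x.1.1
        exact h.subset ⟨x.1.2, x.2, rfl⟩
    · rintro ⟨x, Y, γ⟩ h
      obtain ⟨z, rfl⟩ := S.surjective_rho hπ x
      obtain ⟨v, α, h1, h2, h3⟩ := S.exists_mem_diracP hπ hP z (Y := Y) (γ := γ) h
      exact ⟨Quot.mk _ ⟨mkPont 𝓘(ℝ, EP) z v α, h1⟩, mkPont_inj.2 ⟨rfl, h2, h3⟩⟩
  · obtain ⟨x, hx⟩ := x
    obtain ⟨y, hy⟩ := y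
    obtain ⟨v, α, hxe⟩ := exists_eq_mkPont _ y
    change S.redMap EP EB x = S.redMap EP EB y ↔ ∃ (g : G) (β : EP →L[ℝ] ℝ),
      (∀ w ∈ S.horP EP y.1, β w = 0) ∧ S.Psi g x = mkPont 𝓘(ℝ, EP) y.1 y.2.1 ((show EP →L[ℝ] ℝ from y.2.2) + β)
    generalize hz : y.1 = z at hxe
    subst hxe
    change _ ↔ ∃ (g : G) (β : EP →L[ℝ] ℝ), (∀ w ∈ S.horP EP z, β w = 0) ∧
      S.Psi g x = mkPont 𝓘(ℝ, EP) z v (α + β)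
    constructor
    · intro h
      have h0 : S.rho EB x.1 = S.rho EB z := congrArg Sigma.fst h
      obtain ⟨g, hg⟩ := (S.rho_eq_rho_iff hπ _ _).1 h0
      have h1 := (S.redMap_Psi hπ hP g x).trans h
      have h2 := S.Psi_mem_totalDP hπ hP (EB := EB) g x hx
      obtain ⟨v', α', he⟩ := exists_eq_mkPont _ (S.Psi g x)
      have h3 : (S.Psi g x).1 = z := hg
      rw [h3] at he
      rw [he, redMap_mkPont, redMap_mkPont, mkPont_inj] at h1
      rw [he] at h2
      -- Over the same point `z`, equal images under `Tρ` give equal vectors because both lie in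
      -- `ℋ`.
      have hv : v' = v := by
        have h4 := congrArg (S.hlHor EP EB z) h1.2.1
        rwa [S.hlHor_rhoT hπ hP z (v := v') h2.1, S.hlHor_rhoT hπ hP z (v := v) hy.1] at h4
      -- Equality of the second components of `f` says that the covectors agree on horizontal lifts,
      -- that is, on all of `ℋ`.
      refine ⟨g, α' - α, fun w hw => ?_, ?_⟩
      · have h4 := congrArg (fun T : EB × (EB →L[ℝ] ℝ) →L[ℝ] ℝ => T (S.rhoT EP EB z w)) h1.2.2
        simp only [ContinuousLinearMap.comp_apply] at h4
        rw [S.hlHor_rhoT hπ hP z hw] at h4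
        exact sub_eq_zero.2 h4
      · rw [he, hv, add_sub_cancel]
    · rintro ⟨g, β, hβ, h⟩
      rw [← S.redMap_Psi hπ hP g x, h, redMap_mkPont, redMap_mkPont, mkPont_inj]
      refine ⟨rfl, rfl, ContinuousLinearMap.ext fun Y => ?_⟩
      have h4 := hβ _ (S.hlHor_mem z Y)
      simp only [ContinuousLinearMap.comp_apply, add_apply, h4, add_zero]

end DiracReduction

end WeaklyDegenerateChaplyginSystem

end Nonholonomic

/-! ### The Hamiltonians and the reduced vector field. -/

namespace Nonholonomic

set_option maxSynthPendingDepth 3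

namespace WeaklyDegenerateChaplyginSystem

section Dynamics

variable {E : Type*} [NormedAddCommGroup E] [NormedSpace ℝ E] [FiniteDimensional ℝ E]
  {EG : Type*} [NormedAddCommGroup EG] [NormedSpace ℝ EG] [FiniteDimensional ℝ EG]
  {EB : Type*} [NormedAddCommGroup EB] [NormedSpace ℝ EB] [FiniteDimensional ℝ EB]
  {Q : Type*} [TopologicalSpace Q] [ChartedSpace E Q] [IsManifold 𝓘(ℝ, E) ∞ Q]
  {G : Type*} [TopologicalSpace G] [ChartedSpace EG G] [Group G] [LieGroup 𝓘(ℝ, EG) ∞ G]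
  [MulAction G Q] [ContMDiffSMul 𝓘(ℝ, EG) 𝓘(ℝ, E) ∞ G Q] [IsCancelSMul G Q] [ProperSMul G Q]
  (S : WeaklyDegenerateChaplyginSystem E EG Q G)
  [ChartedSpace EB (OrbitSpace G Q)] [IsManifold 𝓘(ℝ, EB) ∞ (OrbitSpace G Q)]
  (hπ : Manifold.IsSubmersion 𝓘(ℝ, E) 𝓘(ℝ, EB) ∞ (orbitProj G : Q → OrbitSpace G Q))
  {EP : Type*} [NormedAddCommGroup EP] [NormedSpace ℝ EP] [FiniteDimensional ℝ EP]
  [ChartedSpace EP S.P] [IsManifold 𝓘(ℝ, EP) ∞ S.P]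
  (hP : Manifold.IsSmoothEmbedding 𝓘(ℝ, EP) (cotangentModel E) ∞
      (Subtype.val : S.P → CotangentBundle E Q))

-- For `p` in `P` the velocity in `Δ_Q` is `cometric p`, and `⟨p, v⟩ = g(v, v)`, so the energy is
-- `½⟨p, cometric p⟩ + V`. This expression makes sense and is smooth on all of `T*Q`.
include hπ in
theorem HP_eq_ham (z : S.P) : S.HP z = S.ham EB z.1 := by
  obtain ⟨v, hv, h⟩ := z.2
  have h1 : ∃ v ∈ S.dist z.1.proj, S.fl z.1.proj v = cov z.1 := ⟨v, hv, h⟩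
  have h2 := invFunOn_mem h1
  have h3 := invFunOn_eq h1
  change cov z.1 (invFunOn (S.fl z.1.proj) (S.dist z.1.proj) (cov z.1))
    - ((1 / 2) * S.bil z.1.proj (invFunOn (S.fl z.1.proj) (S.dist z.1.proj) (cov z.1))
      (invFunOn (S.fl z.1.proj) (S.dist z.1.proj) (cov z.1)) - S.V z.1.proj)
    = (1 / 2) * cov z.1 (S.cometric EB z.1.proj (cov z.1)) + S.V z.1.proj
  generalize invFunOn (S.fl z.1.proj) (S.dist z.1.proj) (cov z.1) = w at h2 h3
  rw [S.fl_eq] at h3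
  rw [← h3, S.cometric_bil hπ _ h2]
  ring

include hπ in
theorem Hbar_red (z : CotangentBundle E Q) : S.Hbar (S.red EB z) = S.ham EB z := by
  have h1 : S.gbar EB (orbitProj G z.proj).out = S.gbar EB z.proj :=
    S.gbar_eq_of_orbitProj_eq hπ (orbitProj_out _)
  have h2 : S.V (orbitProj G z.proj).out = S.V z.proj :=
    S.V_eq_of_orbitProj_eq hπ (orbitProj_out _)
  change (cov z) (S.hl EB z.proj (S.flbarInv (orbitProj G z.proj) ((cov z).comp (S.hl EB z.proj))))
    - ((1 / 2) * S.gbar EB (orbitProj G z.proj).out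
      (S.flbarInv (orbitProj G z.proj) ((cov z).comp (S.hl EB z.proj)))
      (S.flbarInv (orbitProj G z.proj) ((cov z).comp (S.hl EB z.proj)))
      - S.V (orbitProj G z.proj).out) = (1 / 2) * cov z (S.cometric EB z.proj (cov z)) + S.V z.proj
  rw [h1, h2, S.flbarInv_eq hπ, S.gbar_inverse_gbar hπ, S.cometric_apply,
    ContinuousLinearMap.comp_apply]
  ring

include hπ in
theorem HP_eq_Hbar_rho (z : S.P) : S.HP z = S.Hbar (S.rho EB z) := by
  rw [S.rho_eq_red hπ, S.Hbar_red hπ, S.HP_eq_ham (EB := EB) hπ]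

include hπ hP in
theorem contMDiff_HP : ContMDiff 𝓘(ℝ, EP) 𝓘(ℝ, ℝ) ∞ S.HP := by
  have h : S.HP = fun z : S.P => S.ham EB z.1 := funext fun z => S.HP_eq_ham hπ z
  rw [h]
  exact (S.contMDiff_ham hπ).comp hP.contMDiff

include hπ in
theorem exists_cotSection (x₀ : CotangentBundle EB (OrbitSpace G Q)) :
    ∃ τ : CotangentBundle EB (OrbitSpace G Q) → CotangentBundle E Q,
      ContMDiffAt (cotangentModel EB) (cotangentModel E) ∞ τ x₀ ∧
      ∀ᶠ x in 𝓝 x₀, S.red EB (τ x) = x := by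
  obtain ⟨σ, -, hσ, hpσ, -⟩ := S.exists_horizontal_section hπ (EB := EB) x₀.proj.out
  rw [orbitProj_out] at hσ hpσ
  refine ⟨cotSection E σ, contMDiffAt_cotSection hπ hσ hpσ, ?_⟩
  have h4 : ContinuousAt (fun x : CotangentBundle EB (OrbitSpace G Q) => x.proj) x₀ :=
    contMDiff_proj.continuous.continuousAt
  filter_upwards [h4.eventually hpσ] with x hx
  exact S.red_cotSection hπ hx

include hπ in
theorem contMDiff_Hbar : ContMDiff (cotangentModel EB) 𝓘(ℝ, ℝ) ∞ (S.Hbar (EB := EB)) := by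
  intro x₀
  obtain ⟨τ, hτ, h⟩ := S.exists_cotSection hπ x₀
  refine ((S.contMDiff_ham hπ (EB := EB)).contMDiffAt.comp x₀ hτ).congr_of_eventuallyEq ?_
  filter_upwards [h] with x hx
  rw [Function.comp_apply, ← S.Hbar_red hπ, hx]

/-- The differential of the constrained Hamiltonian, between the model spaces. -/
def dHP (EP : Type*) [NormedAddCommGroup EP] [NormedSpace ℝ EP] [FiniteDimensional ℝ EP]
    [ChartedSpace EP S.P] (z : S.P) : EP →L[ℝ] ℝ := tmap 𝓘(ℝ, EP) 𝓘(ℝ, ℝ) S.HP z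

/-- The differential of the reduced Hamiltonian, between the model spaces. -/
def dHbar (EB : Type*) [NormedAddCommGroup EB] [NormedSpace ℝ EB] [FiniteDimensional ℝ EB]
    [ChartedSpace EB (OrbitSpace G Q)] [IsManifold 𝓘(ℝ, EB) ∞ (OrbitSpace G Q)]
    (x : CotangentBundle EB (OrbitSpace G Q)) : EB × (EB →L[ℝ] ℝ) →L[ℝ] ℝ :=
  tmap (cotangentModel EB) 𝓘(ℝ, ℝ) (S.Hbar (EB := EB)) x

include hπ hP in
theorem dHP_eq (z : S.P) : S.dHP EP z = (S.dHbar EB (S.rho EB z)).comp (S.rhoT EP EB z) := by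
  have h1 := tmap_comp (K := 𝓘(ℝ, EP)) (J := cotangentModel EB) (I := 𝓘(ℝ, ℝ))
    (F := S.Hbar (EB := EB)) (F' := S.rho EB) (l := z)
    ((S.contMDiff_Hbar hπ).mdifferentiable (by simp) _)
    ((S.contMDiff_rho hπ hP).mdifferentiable (by simp) _)
  have h2 : S.HP = fun z : S.P => S.Hbar (S.rho EB z) := funext fun z => S.HP_eq_Hbar_rho hπ z
  rw [dHP, h2]
  exact h1

-- The covector component of `f` applied to `dH_P`: by the chain rule for `H_P = H̄ ∘ ρ`, it is
-- `dH̄`.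
include hπ hP in
theorem dHP_comp_hlHor (z : S.P) : (S.dHP EP z).comp (S.hlHor EP EB z)
    = S.dHbar EB (S.rho EB z) := by
  refine ContinuousLinearMap.ext fun Y => ?_
  rw [S.dHP_eq hπ hP (EB := EB)]
  exact congrArg (S.dHbar EB (S.rho EB z)) (S.rhoT_hlHor hπ hP z Y)

theorem eq_of_omegaNH_eq (x : CotangentBundle EB (OrbitSpace G Q)) {Y Y' : EB × (EB →L[ℝ] ℝ)}
    (h : ∀ w, S.omegaNH x Y w = S.omegaNH x Y' w) : Y = Y' := by
  refine sub_eq_zero.1 (S.omegaNHL_nondegenerate x fun w => ?_)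
  have h1 : S.omegaNHL x Y w = S.omegaNHL x Y' w := by
    rw [omegaNHL_apply, omegaNHL_apply, h]
  rw [map_sub, sub_apply, h1, sub_self]

-- At any preimage `z` of `x`, the vector `Tρ(X(z))` solves `(Ω̄ - Ξ)(·, w) = dH̄(w)` at `x`.
-- Non-degeneracy makes the solution unique, so an arbitrary choice `κ` of preimages yields a
-- well-defined field related to `X` everywhere.
include hπ hP in
theorem exists_reduced_vectorField (X : S.P → EP) (hX : ∀ z, (X z, S.dHP EP z) ∈ S.diracP EP z) :
    ∃ Xbar : CotangentBundle EB (OrbitSpace G Q) → EB × (EB →L[ℝ] ℝ),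
      (∀ z, Xbar (S.rho EB z) = S.rhoT EP EB z (X z)) ∧
      ∀ x w, S.omegaNH x (Xbar x) w = S.dHbar EB x w := by
  have h0 : ∀ z w, S.omegaNH (S.rho EB z) (S.rhoT EP EB z (X z)) w = S.dHbar EB (S.rho EB z) w := by
    intro z w
    rw [← ((S.mem_diracP_iff hπ hP (EB := EB) z _ _).1 (hX z)).2 w, ← S.dHP_comp_hlHor hπ hP]
    rfl
  choose κ hκ using S.surjective_rho hπ (EB := EB)
  have h1 : ∀ x w, S.omegaNH x (S.rhoT EP EB (κ x) (X (κ x))) w = S.dHbar EB x w := by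
    intro x w
    have h := h0 (κ x) w
    rwa [hκ] at h
  refine ⟨fun x => S.rhoT EP EB (κ x) (X (κ x)), fun z => ?_, h1⟩
  refine S.eq_of_omegaNH_eq (S.rho EB z) fun w => ?_
  rw [h1, h0]

-- Near `x₀` the field is `Tρ ∘ X ∘ κ` for a smooth local section `κ` of `ρ`, namely the retraction
-- to `P` of a local section of `red`.
include hπ hP in
theorem contMDiff_reduced_vectorField {X : ∀ z : S.P, TangentSpace 𝓘(ℝ, EP) z}
    {Xbar : ∀ x : CotangentBundle EB (OrbitSpace G Q), TangentSpace (cotangentModel EB) x}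
    (h : ∀ z, Xbar (S.rho EB z) = S.tangentRho EP EB z (X z))
    (hX : SmoothVectorFieldOn 𝓘(ℝ, EP) X univ) :
    SmoothVectorFieldOn (cotangentModel EB) Xbar univ := by
  have hX' := contMDiffOn_univ.1 hX
  refine contMDiffOn_univ.2 fun x₀ => ?_
  obtain ⟨τ, hτ, hred⟩ := S.exists_cotSection hπ x₀
  have hκ : ContMDiffAt (cotangentModel EB) 𝓘(ℝ, EP) ∞ (fun x => S.retr hπ (τ x)) x₀ :=
    (S.contMDiff_retr hπ hP).contMDiffAt.comp x₀ hτ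
  have h1 : ContMDiff 𝓘(ℝ, EP).tangent (cotangentModel EB).tangent ∞
      (tangentMap 𝓘(ℝ, EP) (cotangentModel EB) (S.rho EB)) :=
    (S.contMDiff_rho hπ hP).contMDiff_tangentMap (by simp)
  have h2 : ContMDiffAt (cotangentModel EB) 𝓘(ℝ, EP).tangent ∞
      (fun x => (⟨S.retr hπ (τ x), X (S.retr hπ (τ x))⟩ : TangentBundle 𝓘(ℝ, EP) S.P)) x₀ :=
    hX'.contMDiffAt.comp x₀ hκ
  refine (h1.contMDiffAt.comp x₀ h2).congr_of_eventuallyEq ?_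
  filter_upwards [hred] with x hx
  have h3 : S.rho EB (S.retr hπ (τ x)) = x := by
    rw [S.rho_eq_red hπ]
    exact (S.red_toP hπ _).trans hx
  have h4 : (⟨S.rho EB (S.retr hπ (τ x)), Xbar (S.rho EB (S.retr hπ (τ x)))⟩ :
      TangentBundle (cotangentModel EB) (CotangentBundle EB (OrbitSpace G Q))) = ⟨x, Xbar x⟩ := by
    rw [h3]
  rw [← h4, h]
  rfl

end Dynamics

end WeaklyDegenerateChaplyginSystem

end Nonholonomic

theorem mainTheorem3
    {E : Type*} [NormedAddCommGroup E] [NormedSpace ℝ E] [FiniteDimensional ℝ E]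
    {EG : Type*} [NormedAddCommGroup EG] [NormedSpace ℝ EG] [FiniteDimensional ℝ EG]
    {EB : Type*} [NormedAddCommGroup EB] [NormedSpace ℝ EB] [FiniteDimensional ℝ EB]
    {EP : Type*} [NormedAddCommGroup EP] [NormedSpace ℝ EP] [FiniteDimensional ℝ EP]
    -- the configuration manifold and the Lie group with its smooth, free and proper action
    {Q : Type*} [TopologicalSpace Q] [ChartedSpace E Q] [IsManifold 𝓘(ℝ, E) ∞ Q]
    {G : Type*} [TopologicalSpace G] [ChartedSpace EG G] [Group G] [LieGroup 𝓘(ℝ, EG) ∞ G]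
    [MulAction G Q] [ContMDiffSMul 𝓘(ℝ, EG) 𝓘(ℝ, E) ∞ G Q] [IsCancelSMul G Q] [ProperSMul G Q]
    (S : WeaklyDegenerateChaplyginSystem E EG Q G)
    -- the smooth structure of the orbit space `Q/G`
    [ChartedSpace EB (OrbitSpace G Q)] [IsManifold 𝓘(ℝ, EB) ∞ (OrbitSpace G Q)]
    (hπ : Manifold.IsSubmersion 𝓘(ℝ, E) 𝓘(ℝ, EB) ∞ (orbitProj G : Q → OrbitSpace G Q))
    -- the smooth structure of the submanifold `P` of `T*Q`
    [ChartedSpace EP S.P] [IsManifold 𝓘(ℝ, EP) ∞ S.P]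
    (hP : Manifold.IsSmoothEmbedding 𝓘(ℝ, EP) (cotangentModel E) ∞
      (Subtype.val : S.P → CotangentBundle E Q)) :
    -- `ρ : P → T*Q̄` is a smooth quotient map for the action of `G`, with horizontal spaces `ℋ`
    (ContMDiff 𝓘(ℝ, EP) (cotangentModel EB) ∞ (S.rho EB) ∧ Surjective (S.rho EB) ∧
      (∀ z z' : S.P, S.rho EB z = S.rho EB z' ↔ ∃ g : G, S.actP g z = z') ∧
      ∀ z : S.P, Bijective fun u : S.𝓗 EP z => S.tangentRho EP EB z u) ∧
    -- `Ξ` does not depend on the choice of `q`, and `Ω̄ - Ξ` is non-degenerate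
    (∀ (q : Q) (α : CotangentSpace 𝓘(ℝ, EB) (orbitProj G q))
      (Y Z : TangentSpace (cotangentModel EB)
        (⟨orbitProj G q, α⟩ : CotangentBundle EB (OrbitSpace G Q))),
      S.Xi ⟨orbitProj G q, α⟩ Y Z = S.xiAt q α (tangentProj _ Y) (tangentProj _ Z)) ∧
    (∀ (z : CotangentBundle EB (OrbitSpace G Q)) (Y : TangentSpace (cotangentModel EB) z),
      (∀ Z, S.OmegaNH z Y Z = 0) → Y = 0) ∧
    -- `D̄` is a Dirac structure
    IsDiracStructure (cotangentModel EB) (S.Dbar (EB := EB)) ∧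
    -- `D_P` is invariant under `Ψ`, and `f` is `G`-invariant
    (∀ (g : G) (x : PontryaginBundle 𝓘(ℝ, EP) S.P), x ∈ S.totalDP EP → S.Psi g x ∈ S.totalDP EP) ∧
    (∀ (g : G) (x : PontryaginBundle 𝓘(ℝ, EP) S.P),
      S.redMap EP EB (S.Psi g x) = S.redMap EP EB x) ∧
    -- `f` maps `D_P(z)` onto `D̄(ρ(z))`
    (∀ z : S.P, (fun a => (S.redMap EP EB ⟨z, a⟩).2) '' S.DP (EP := EP) z
      = S.Dbar (S.rho EB z)) ∧
    -- the map `[D_P]_G → D̄` induced by `f`: its image and its fibres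
    (∃ F : S.QuotDP EP → PontryaginBundle (cotangentModel EB) (CotangentBundle EB (OrbitSpace G Q)),
      (∀ x : S.totalDP EP, F (Quot.mk _ x) = S.redMap EP EB x.1) ∧
      range F = {y | y.2 ∈ S.Dbar y.1} ∧
      ∀ x y : S.totalDP EP, F (Quot.mk _ x) = F (Quot.mk _ y) ↔
        ∃ (g : G) (β : CotangentSpace 𝓘(ℝ, EP) y.1.1), (∀ w ∈ S.𝓗 EP y.1.1, β w = 0) ∧
          S.Psi g x.1 = ⟨y.1.1, (y.1.2.1, y.1.2.2 + β)⟩) ∧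
    -- the reduced dynamics
    ContMDiff (cotangentModel EB) 𝓘(ℝ, ℝ) ∞ (S.Hbar (EB := EB)) ∧
    ContMDiff 𝓘(ℝ, EP) 𝓘(ℝ, ℝ) ∞ S.HP ∧
    (∀ z : S.P, S.HP z = S.Hbar (S.rho EB z)) ∧
    ∀ X : ∀ z : S.P, TangentSpace 𝓘(ℝ, EP) z,
      (∀ z, (X z, differential 𝓘(ℝ, EP) S.HP z) ∈ S.DP z) →
      ∃ Xbar : ∀ z : CotangentBundle EB (OrbitSpace G Q), TangentSpace (cotangentModel EB) z,
        (∀ z, Xbar (S.rho EB z) = S.tangentRho EP EB z (X z)) ∧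
        (∀ z, S.redMap EP EB ⟨z, (X z, differential 𝓘(ℝ, EP) S.HP z)⟩
          = ⟨S.rho EB z, (Xbar (S.rho EB z),
              differential (cotangentModel EB) S.Hbar (S.rho EB z))⟩) ∧
        (∀ z, (Xbar z, differential (cotangentModel EB) S.Hbar z) ∈ S.Dbar z) ∧
        (∀ z w, S.OmegaNH z (Xbar z) w = differential (cotangentModel EB) S.Hbar z w) ∧
        (SmoothVectorFieldOn 𝓘(ℝ, EP) X univ →
          SmoothVectorFieldOn (cotangentModel EB) Xbar univ) := by

  refine ⟨⟨S.contMDiff_rho hπ hP, S.surjective_rho hπ, S.rho_eq_rho_iff hπ,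
    S.bijective_tangentRho hπ hP⟩, fun q α Y Z => ?_, fun z Y h => ?_, S.isDiracStructure_Dbar hπ,
    S.Psi_mem_totalDP hπ hP (EB := EB), S.redMap_Psi hπ hP, S.image_DP hπ hP, S.exists_quotient_map hπ hP,
    S.contMDiff_Hbar hπ, S.contMDiff_HP hπ hP (EB := EB), S.HP_eq_Hbar_rho hπ, fun X hX => ?_⟩
  · exact S.Xi_eq_xiAt hπ q α Y Z
  · exact S.omegaNHL_nondegenerate z fun w => (S.omegaNHL_apply z Y w).trans (h w)
  · obtain ⟨Xbar, h1, h2⟩ := S.exists_reduced_vectorField hπ hP (EB := EB) X hX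
    refine ⟨Xbar, h1, fun z => ?_, fun z w => (h2 z w).symm, h2,
      S.contMDiff_reduced_vectorField hπ hP h1⟩
    exact mkPont_inj.2 ⟨rfl, (h1 z).symm, S.dHP_comp_hlHor hπ hP z⟩
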